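/- Let $M$ be a complex manifold of complex dimension $n$ with complex structure $J$. For a smooth Hermitian metric $g$ on $M$ (a Riemannian metric with $g(J\cdot,J\cdot)=g$) let $\omega=g(J\cdot,\cdot)$ be its Kähler form, and in local holomorphic coordinates write $\omega=\frac{\sqrt{-1}}{2}\sum g_{i\bar j}\,dz^i\wedge d\bar z^j$; let $(g^{i\bar j})$ be the inverse metric, and call $g$ pluriclosed if $\partial\bar\partial\omega=0$. Let $\partial^*,\bar\partial^*$ be the formal $L^2$ adjoints of $\partial,\bar\partial$ with respect to the volume form $\det g$ (times Lebesgue measure in coordinates) and the pointwise Hermitian inner product on forms of type $(p,q)$ determined by $\langle dz^i,dz^j\rangle=g^{i\bar j}$ (so that $\langle\varphi,\psi\rangle=g^{i\bar k}g^{l\bar j}\varphi_{i\bar j}\overline{\psi_{k\bar l}}$ on forms $\varphi=\sum\varphi_{i\bar j}dz^i\wedge d\bar z^j$ of type $(1,1)$). Put $$\Phi(\omega)=-\partial\partial^*\omega-\bar\partial\bar\partial^*\omega-\tfrac{\sqrt{-1}}{2}\,\partial\bar\partial\log\det g .$$ Then: (1) For every Hermitian metric, $\Phi(\omega)$ is a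 well-defined smooth real form of type $(1,1)$ on $M$, and $\omega\mapsto\Phi(\omega)$ is a quasilinear differential operator of second order: in every holomorphic chart its components are $a(z,g,Dg)(D^2g)+b(z,g,Dg)$ with $a$ linear in $D^2g$ and with $a$, $b$ smooth in $z$, in the positive definite Hermitian matrix $g=(g_{i\bar j})$ and in $Dg$. (2) Restricted to pluriclosed metrics the operator is elliptic, with linearized symbol $-|\xi|^2$ times the identity. That is, let $g$ be pluriclosed. In every holomorphic chart the linearization of $\Phi$ at $\omega$ (the derivative of $\Phi$ along smooth families of Hermitian metrics through $g$, as a function of the derivative of their Kähler forms) is a linear second-order differential operator $L$ with smooth coefficients. For a real covector $\xi=\sum(\xi_p\,dz^p+\overline{\xi_p}\,d\bar z^p)$ put $|\xi|^2=\sum g^{p\bar q}\xi_p\overline{\xi_q}$, let $\sigma_L(\xi)$ be the principal symbol of $L$ (second derivatives replaced by $\xi\otimes\xi$), and let $K_\xi$ be the real vector space of real $(1,1)$-forms at the point which are annihilated by the principal symbol of $\partial\bar\partial$ at $\xi$. Then $\sigma_L(\xi)h=-|\xi|^2h$ for all $h\in K_\xi$. In particular, if $\xi\neq0$, then $|\xi|^2>0$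 and $\sigma_L(\xi)$ maps $K_\xi$ bijectively onto itself. Moreover, in each chart there is a linear second-order operator $L'$ with smooth coefficients, whose principal symbol is $\sigma_{L'}(\xi)h=-|\xi|^2h$ for all real $(1,1)$-forms $h$, such that $Lu=L'u$ for every smooth real $(1,1)$-form $u$ on the chart domain with $\partial\bar\partial u=0$. -/

import Mathlib

open scoped ContDiff Manifold ComplexConjugate ComplexOrder

noncomputable section

/-! ### Local calculus of forms of type `(p,q)` in holomorphic coordinates -/

/-- The coordinate space `ℂⁿ`. -/
abbrev Cn (n : ℕ) : Type := Fin n → ℂ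

/-- `n × n` complex arrays `h j k`, standing for `h_{j k̄}`. -/
abbrev Arr (n : ℕ) : Type := Fin n → Fin n → ℂ

/-- The operator `∂_j = ∂/∂z^j = (1/2) (∂/∂x^j - i ∂/∂y^j)`. -/
def wirt {n : ℕ} (j : Fin n) (f : Cn n → ℂ) (z : Cn n) : ℂ :=
  (1 / 2) * (fderiv ℝ f z (Pi.single j 1) - Complex.I * fderiv ℝ f z (Pi.single j Complex.I))

/-- The operator `∂_j̄ = ∂/∂z̄^j = (1/2) (∂/∂x^j + i ∂/∂y^j)`. -/
def wirtBar {n : ℕ} (j : Fin n) (f : Cn n → ℂ) (z : Cn n) : ℂ :=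
  (1 / 2) * (fderiv ℝ f z (Pi.single j 1) + Complex.I * fderiv ℝ f z (Pi.single j Complex.I))

/-- Component functions `α_{I J̄}` of a form of type `(p,q)`,
`α = (1 / (p! q!)) ∑ α_{I J̄} dz^{I 0} ∧ ⋯ ∧ dz^{I (p-1)} ∧ dz̄^{J 0} ∧ ⋯ ∧ dz̄^{J (q-1)}`
(for a form the array is alternating in `I` and in `J`, which is no condition if `p, q ≤ 1`). -/
abbrev PQ (n p q : ℕ) : Type := Cn n → (Fin p → Fin n) → (Fin q → Fin n) → ℂ

/-- `∂ : Λ^{p,q} → Λ^{p+1,q}`, i.e. `∂α = ∑ ∂_j α_{I J̄} dz^j ∧ dz^I ∧ dz̄^J`, in components. -/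
def del {n p q : ℕ} (α : PQ n p q) : PQ n (p + 1) q := fun z I J =>
  ∑ a : Fin (p + 1), (-1 : ℂ) ^ (a : ℕ) * wirt (I a) (fun w => α w (I ∘ a.succAbove) J) z

/-- `∂̄ : Λ^{p,q} → Λ^{p,q+1}`, i.e. `∂̄α = ∑ ∂_j̄ α_{I J̄} dz̄^j ∧ dz^I ∧ dz̄^J`, in components;
the sign `(-1)^p` comes from moving `dz̄^j` past `dz^I`. -/
def delBar {n p q : ℕ} (α : PQ n p q) : PQ n p (q + 1) := fun z I J =>
  (-1 : ℂ) ^ p * ∑ b : Fin (q + 1),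
    (-1 : ℂ) ^ (b : ℕ) * wirtBar (J b) (fun w => α w I (J ∘ b.succAbove)) z

/-- The form of type `(1,1)` with components `u_{j k̄}` with respect to `dz^j ∧ dz̄^k`. -/
def arrForm {n : ℕ} (u : Cn n → Arr n) : PQ n 1 1 := fun z I J => u z (I 0) (J 0)

/-- The inverse metric `g^{j k̄}`, normalized by `∑ k, g^{j k̄} g_{l k̄} = δ_{j l}`. -/
def invMet {n : ℕ} (G : Arr n) (j k : Fin n) : ℂ := (Matrix.of G)⁻¹ k j

/-- `det g = det (g_{j k̄})`, which is real for a Hermitian array. -/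
def detMet {n : ℕ} (G : Arr n) : ℝ := (Matrix.of G).det.re

/-- The pointwise Hermitian inner product of forms of type `(p,q)` given by
`⟨dz^j, dz^k⟩ = g^{j k̄}`. -/
def formInner {n p q : ℕ} (G : Arr n) (φ ψ : (Fin p → Fin n) → (Fin q → Fin n) → ℂ) : ℂ :=
  (1 / ((p.factorial : ℂ) * (q.factorial : ℂ))) *
    ∑ I : Fin p → Fin n, ∑ K : Fin p → Fin n, ∑ J : Fin q → Fin n, ∑ L : Fin q → Fin n,
      (∏ a, invMet G (I a) (K a)) * (∏ b, invMet G (L b) (J b)) * φ I J * conj (ψ K L)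

/-- The `L²` inner product over the coordinate domain `Ω`, with volume form `det g` times
Lebesgue measure. -/
def l2Inner {n p q : ℕ} (Ω : Set (Cn n)) (G : Cn n → Arr n) (φ ψ : PQ n p q) : ℂ :=
  ∫ z in Ω, formInner (G z) (φ z) (ψ z) * (detMet (G z) : ℂ)

/-- A smooth form with compact support in `Ω`. -/
def IsTestForm {n p q : ℕ} (Ω : Set (Cn n)) (α : PQ n p q) : Prop :=
  ContDiff ℝ ∞ α ∧ HasCompactSupport α ∧ tsupport α ⊆ Ω

/-- The components `ξ_p` of a real covector `ξ = ∑ ξ_p dz^p + conj (ξ_p) dz̄^p`. -/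
def covecComp {n : ℕ} (ξ : Cn n →L[ℝ] ℝ) (p : Fin n) : ℂ :=
  (1 / 2) * ((ξ (Pi.single p 1) : ℂ) - Complex.I * (ξ (Pi.single p Complex.I) : ℂ))

/-- `|ξ|² = ∑ g^{p q̄} ξ_p conj (ξ_q)`. -/
def covecNormSq {n : ℕ} (G : Arr n) (ξ : Cn n →L[ℝ] ℝ) : ℝ :=
  (∑ p, ∑ q, invMet G p q * covecComp ξ p * conj (covecComp ξ q)).re

/-- The symbol of the (homogeneous, constant coefficient, second order) operator `∂∂̄` on forms of
type `(1,1)`: the value of `∂∂̄ ((1/2) ξ² h)` at the origin. -/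
def symbolDelDelBar {n : ℕ} (ξ : Cn n →L[ℝ] ℝ) (h : Arr n) :
    (Fin 2 → Fin n) → (Fin 2 → Fin n) → ℂ :=
  del (delBar (arrForm fun w j k => (1 / 2 : ℂ) * (ξ w : ℂ) ^ 2 * h j k)) 0

/-- The real vector space of Hermitian arrays `h` (real forms `(i/2) ∑ h_{j k̄} dz^j ∧ dz̄^k`) which
are annihilated by the symbol of `∂∂̄` at `ξ`. -/
def symbolKer {n : ℕ} (ξ : Cn n →L[ℝ] ℝ) : Set (Arr n) :=
  {h | (Matrix.of h).IsHermitian ∧ symbolDelDelBar ξ h = 0}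

/-! ### Linear differential operators of second order -/

/-- A linear differential operator `u ↦ c₂ (D²u) + c₁ (Du) + c₀ u` on array-valued functions;
`D` is the real (Fréchet) derivative. -/
structure LinOp2 (n : ℕ) where
  c2 : Cn n → (Cn n →L[ℝ] Cn n →L[ℝ] Arr n) →ₗ[ℝ] Arr n
  c1 : Cn n → (Cn n →L[ℝ] Arr n) →ₗ[ℝ] Arr n
  c0 : Cn n → Arr n →ₗ[ℝ] Arr n

/-- The operator has smooth coefficients on `Ω`: the linear maps `c₂`, `c₁`, `c₀`, which act on
finite-dimensional spaces, depend smoothly on the point. -/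
def LinOp2.SmoothOn {n : ℕ} (L : LinOp2 n) (Ω : Set (Cn n)) : Prop :=
  (∀ B, ContDiffOn ℝ ∞ (fun z => L.c2 z B) Ω) ∧ (∀ P, ContDiffOn ℝ ∞ (fun z => L.c1 z P) Ω) ∧
    ∀ h, ContDiffOn ℝ ∞ (fun z => L.c0 z h) Ω

/-- The value of `L u` at `z`. -/
def LinOp2.app {n : ℕ} (L : LinOp2 n) (u : Cn n → Arr n) (z : Cn n) : Arr n :=
  L.c2 z (fderiv ℝ (fderiv ℝ u) z) + L.c1 z (fderiv ℝ u z) + L.c0 z (u z)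

/-- The principal symbol: `D²` is replaced by `ξ ⊗ ξ`. -/
def LinOp2.symbol {n : ℕ} (L : LinOp2 n) (z : Cn n) (ξ : Cn n →L[ℝ] ℝ) (h : Arr n) : Arr n :=
  L.c2 z (ξ.smulRight (ξ.smulRight h))

/-! ### Hermitian metrics and forms on a complex manifold -/

section Manifold

variable (n : ℕ) (M : Type*) [TopologicalSpace M] [ChartedSpace (Cn n) M]

/-- The holomorphic tangent space, as a complex vector space; `J` is multiplication by `i`. -/
abbrev Tan (x : M) : Type := TangentSpace 𝓘(ℂ, Cn n) x

/-- The holomorphic charts of `M`. -/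
abbrev holCharts : Set (OpenPartialHomeomorph M (Cn n)) :=
  IsManifold.maximalAtlas 𝓘(ℂ, Cn n) ω M

variable {n M}

/-- The tangent vector at `e.symm z` which has the constant components `a` in the chart `e`. -/
def coordVec (e : OpenPartialHomeomorph M (Cn n)) (z a : Cn n) : Tan n M (e.symm z) :=
  mfderiv 𝓘(ℂ, Cn n) 𝓘(ℂ, Cn n) e.symm z a

theorem coordVec_I (e : OpenPartialHomeomorph M (Cn n)) (z a : Cn n) :
    coordVec e z (Complex.I • a) = Complex.I • coordVec e z a :=
  (mfderiv 𝓘(ℂ, Cn n) 𝓘(ℂ, Cn n) e.symm z).map_smul Complex.I a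

variable (n M)

/-- A smooth Hermitian metric: a Riemannian metric `g` with `g (J u, J v) = g (u, v)`. -/
structure HermMetric where
  val : ∀ x : M, Tan n M x →ₗ[ℝ] Tan n M x →ₗ[ℝ] ℝ
  symm : ∀ x u v, val x u v = val x v u
  pos : ∀ x u, u ≠ 0 → 0 < val x u u
  compat : ∀ x u v, val x (Complex.I • u) (Complex.I • v) = val x u v
  smooth : ∀ e ∈ holCharts n M, ∀ a b : Cn n,
    ContDiffOn ℝ ∞ (fun z => val (e.symm z) (coordVec e z a) (coordVec e z b)) e.target

/-- A smooth real form of type `(1,1)`: a real two-form `η` with `η (J u, J v) = η (u, v)`. -/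
structure RealForm11 where
  val : ∀ x : M, Tan n M x →ₗ[ℝ] Tan n M x →ₗ[ℝ] ℝ
  alt : ∀ x u v, val x u v = -val x v u
  compat : ∀ x u v, val x (Complex.I • u) (Complex.I • v) = val x u v
  smooth : ∀ e ∈ holCharts n M, ∀ a b : Cn n,
    ContDiffOn ℝ ∞ (fun z => val (e.symm z) (coordVec e z a) (coordVec e z b)) e.target

/-- A smooth complex form of type `(0,1)`: a field of conjugate-linear functionals. -/
structure Form01 where
  val : ∀ x : M, Tan n M x →ₗ⋆[ℂ] ℂ
  smooth : ∀ e ∈ holCharts n M, ∀ a : Cn n,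
    ContDiffOn ℝ ∞ (fun z => val (e.symm z) (coordVec e z a)) e.target

/-- A smooth complex form of type `(1,0)`: a field of complex-linear functionals. -/
structure Form10 where
  val : ∀ x : M, Tan n M x →ₗ[ℂ] ℂ
  smooth : ∀ e ∈ holCharts n M, ∀ a : Cn n,
    ContDiffOn ℝ ∞ (fun z => val (e.symm z) (coordVec e z a)) e.target

variable {n M}

/-- The Kähler form `ω (u, v) = g (J u, v)`. -/
def HermMetric.kahler (g : HermMetric n M) : RealForm11 n M where
  val x := LinearMap.mk₂ ℝ (fun u v => g.val x (Complex.I • u) v)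
    (fun u u' v => by rw [smul_add, map_add, LinearMap.add_apply])
    (fun c u v => by rw [smul_comm, map_smul, LinearMap.smul_apply])
    (fun u v v' => map_add _ v v') (fun c u v => map_smul _ c v)
  alt x u v := by
    simp only [LinearMap.mk₂_apply]
    rw [g.symm x (Complex.I • v) u, ← g.compat x u (Complex.I • v), smul_smul, Complex.I_mul_I,
      neg_one_smul, map_neg, neg_neg]
  compat x u v := by
    simp only [LinearMap.mk₂_apply]
    exact g.compat x _ v
  smooth e he a b := by
    simp only [LinearMap.mk₂_apply, ← coordVec_I]
    exact g.smooth e he _ b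

/-- The components `η_{j k̄} = η (∂_j, ∂_k̄)` in the chart `e`, so that
`η = ∑ η_{j k̄} dz^j ∧ dz̄^k`. -/
def RealForm11.comp (η : RealForm11 n M) (e : OpenPartialHomeomorph M (Cn n)) (z : Cn n) : Arr n :=
  fun j k => (1 / 2) *
    ((η.val (e.symm z) (coordVec e z (Pi.single j 1)) (coordVec e z (Pi.single k 1)) : ℂ) +
      Complex.I * (η.val (e.symm z) (coordVec e z (Pi.single j 1))
        (Complex.I • coordVec e z (Pi.single k 1)) : ℂ))

/-- The Hermitian components of a real form: `η = (i/2) ∑ (η.herm e)_{j k̄} dz^j ∧ dz̄^k`. For the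
Kähler form of `g` these are the components `g_{j k̄}` of the metric. -/
def RealForm11.herm (η : RealForm11 n M) (e : OpenPartialHomeomorph M (Cn n)) (z : Cn n) : Arr n :=
  fun j k => -2 * Complex.I * η.comp e z j k

/-- The components `g_{j k̄}` of the metric, defined by `ω = (i/2) ∑ g_{j k̄} dz^j ∧ dz̄^k`. -/
def HermMetric.coeff (g : HermMetric n M) (e : OpenPartialHomeomorph M (Cn n)) : Cn n → Arr n :=
  g.kahler.herm e

theorem HermMetric.coeff_eq (g : HermMetric n M) (e : OpenPartialHomeomorph M (Cn n)) (z : Cn n)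
    (j k : Fin n) : g.coeff e z j k =
      (g.val (e.symm z) (coordVec e z (Pi.single j 1)) (coordVec e z (Pi.single k 1)) : ℂ) +
        Complex.I * (g.val (e.symm z) (coordVec e z (Pi.single j 1))
          (Complex.I • coordVec e z (Pi.single k 1)) : ℂ) := by
  have h := g.kahler.alt (e.symm z) (coordVec e z (Pi.single j 1)) (coordVec e z (Pi.single k 1))
  simp only [HermMetric.kahler, LinearMap.mk₂_apply] at h
  simp only [HermMetric.coeff, RealForm11.herm, RealForm11.comp, HermMetric.kahler,
    LinearMap.mk₂_apply, g.compat]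
  rw [h, g.symm _ (Complex.I • _) _]
  push_cast
  linear_combination (-(g.val (e.symm z) (coordVec e z (Pi.single j 1))
    (coordVec e z (Pi.single k 1)) : ℂ)) * Complex.I_mul_I

/-- The components of a form of type `(0,1)` in the chart `e`. -/
def Form01.comp (β : Form01 n M) (e : OpenPartialHomeomorph M (Cn n)) : PQ n 0 1 :=
  fun z _ J => β.val (e.symm z) (coordVec e z (Pi.single (J 0) 1))

/-- The components of a form of type `(1,0)` in the chart `e`. -/
def Form10.comp (γ : Form10 n M) (e : OpenPartialHomeomorph M (Cn n)) : PQ n 1 0 :=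
  fun z I _ => γ.val (e.symm z) (coordVec e z (Pi.single (I 0) 1))

/-- The metric is pluriclosed: `∂∂̄ω = 0`. -/
def HermMetric.Pluriclosed (g : HermMetric n M) : Prop :=
  ∀ e ∈ holCharts n M, ∀ z ∈ e.target, del (delBar (arrForm (g.kahler.comp e))) z = 0

/-- `β = ∂* ω`: one has `(ω, ∂α) = (β, α)` in `L²` for every smooth `(0,1)`-form `α` with compact
support in the domain of a holomorphic chart. -/
def IsDelStar (g : HermMetric n M) (β : Form01 n M) : Prop :=
  ∀ e ∈ holCharts n M, ∀ α : PQ n 0 1, IsTestForm e.target α →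
    l2Inner e.target (g.coeff e) (arrForm (g.kahler.comp e)) (del α) =
      l2Inner e.target (g.coeff e) (β.comp e) α

/-- `γ = ∂̄* ω`: one has `(ω, ∂̄α) = (γ, α)` in `L²` for every smooth `(1,0)`-form `α` with compact
support in the domain of a holomorphic chart. -/
def IsDelBarStar (g : HermMetric n M) (γ : Form10 n M) : Prop :=
  ∀ e ∈ holCharts n M, ∀ α : PQ n 1 0, IsTestForm e.target α →
    l2Inner e.target (g.coeff e) (arrForm (g.kahler.comp e)) (delBar α) =
      l2Inner e.target (g.coeff e) (γ.comp e) α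

/-- The local function `log det g` of the chart `e`. -/
def HermMetric.logDet (g : HermMetric n M) (e : OpenPartialHomeomorph M (Cn n)) : PQ n 0 0 :=
  fun z _ _ => (Real.log (detMet (g.coeff e z)) : ℂ)

/-- `η = Φ(ω) = - ∂∂*ω - ∂̄∂̄*ω - (i/2) ∂∂̄ log det g`. -/
def IsPhi (g : HermMetric n M) (η : RealForm11 n M) : Prop :=
  ∃ (β : Form01 n M) (γ : Form10 n M), IsDelStar g β ∧ IsDelBarStar g γ ∧
    ∀ e ∈ holCharts n M, ∀ z ∈ e.target,
      arrForm (η.comp e) z = -del (β.comp e) z - delBar (γ.comp e) z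
        - (Complex.I / 2) • del (delBar (g.logDet e)) z

/-- An operator from Kähler forms to real `(1,1)`-forms is quasilinear of second order: in every
holomorphic chart it reads `a (z, g, Dg) (D²g) + b (z, g, Dg)`, where `a` is linear in `D²g` and
`a`, `b` are smooth in `z`, in the positive definite Hermitian array `g` and in `Dg`. -/
def IsQuasilinear2 (Φ : HermMetric n M → RealForm11 n M) : Prop :=
  ∀ e ∈ holCharts n M,
    ∃ (a : Cn n × Arr n × (Cn n →L[ℝ] Arr n) →
        (Cn n →L[ℝ] Cn n →L[ℝ] Arr n) →ₗ[ℝ] Arr n)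
      (b : Cn n × Arr n × (Cn n →L[ℝ] Arr n) → Arr n),
      (∀ B, ContDiffOn ℝ ∞ (fun t => a t B) {t | t.1 ∈ e.target ∧ (Matrix.of t.2.1).PosDef}) ∧
      ContDiffOn ℝ ∞ b {t | t.1 ∈ e.target ∧ (Matrix.of t.2.1).PosDef} ∧
      ∀ (g : HermMetric n M), ∀ z ∈ e.target,
        (Φ g).herm e z =
          a (z, g.coeff e z, fderiv ℝ (g.coeff e) z) (fderiv ℝ (fderiv ℝ (g.coeff e)) z) +
            b (z, g.coeff e z, fderiv ℝ (g.coeff e) z)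

/-- A one-parameter family of metrics which is smooth in the parameter and the point. -/
def IsSmoothFamily (G : ℝ → HermMetric n M) : Prop :=
  ∀ e ∈ holCharts n M,
    ContDiffOn ℝ ∞ (fun t : ℝ × Cn n => (G t.1).coeff e t.2) (Set.univ ×ˢ e.target)

/-- `L` is, in the chart `e`, the linearization of `Φ` at (the Kähler form of) `g`: for each smooth
family of Hermitian metrics through `g` whose Kähler forms have the velocity `h` at `s = 0`, the
derivative of `Φ` along the family at `s = 0` is `L h`. -/
def IsLinearization (Φ : HermMetric n M → RealForm11 n M) (g : HermMetric n M)
    (e : OpenPartialHomeomorph M (Cn n)) (L : LinOp2 n) : Prop :=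
  ∀ (G : ℝ → HermMetric n M) (h : RealForm11 n M), IsSmoothFamily G → G 0 = g →
    (∀ x u v, HasDerivAt (fun s => (G s).kahler.val x u v) (h.val x u v) 0) →
    ∀ z ∈ e.target, HasDerivAt (fun s => (Φ (G s)).herm e z) (L.app (h.herm e) z) 0

end Manifold

end

noncomputable section

/-! ### Calculus of the operators `∂_j` and `∂_j̄` -/

section Wirtinger

open Filter Topology

variable {n : ℕ} {f g : Cn n → ℂ} {z : Cn n} {U : Set (Cn n)}

/-! Write `ω = (i/2) ∑ g_{j k̄} dz^j ∧ dz̄^k`. Pairing `ω` with `∂α` contracts `g` with its own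
inverse, so `(ω, ∂α)` is the integral of `(i/2) ∑ g^{l k̄} det g ∂_k̄ conj(α_l)`. One integration by
parts and Jacobi's formula give `(∂*ω)_k = (i/2) ∑ g^{a b̄} (∂_b̄ g_{a k̄} - ∂_k̄ g_{a b̄})`
(`IsMetricOn.l2Inner_del`), and `∂̄*ω` is its conjugate. Smooth forms are determined by their
pairings with test forms, so these formulas are forced in every chart; this gives uniqueness of
`Φ(ω)`.

For existence the local formula must be tensorial. Second derivatives of a holomorphic coordinate
change `T` enter `∂_b̄ g_{a k̄}` symmetrically in `b` and `k`, so the antisymmetrised `∂*ω` does not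
see them. The function `log det g` changes by `log |det T'|²`, which is pluriharmonic. Hence the
components obey the law of a `(1,1)`-form (`IsMetricPullback.phiComp_eq`) and glue
(`exists_realForm11`).

Differentiating once more, each adjoint term contributes a trace term `∑ g^{a b̄} ∂_j ∂_k̄ g_{a b̄}`
and the `log det` term removes one of the two. The second-order part is `-∑ g^{a b̄} (∂_j ∂_b̄ g_{a
k̄} + ∂_a ∂_k̄ g_{j b̄} - ∂_j ∂_k̄ g_{a b̄})` (`IsMetricOn.phiComp_eq`), whence quasilinearity. In
components `∂∂̄u = 0` says that the corresponding bracket for `u` equals `∂_a ∂_b̄ u_{j k̄}`. So on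
`∂∂̄`-closed data the second-order part is `-∑ g^{a b̄} ∂_a ∂_b̄`. This step (`DDBarRel.phiTop_eq`)
is pointwise algebra in the second jet, so it serves both for the symbol, with jet `ξ ⊗ ξ ⊗ h`, and
for closed variations.

Finally, `Φ` is a smooth function of the 2-jet of `g`, affine in `D²g`. Parameter and space
derivatives commute, so the chain rule gives the linearization: the second-order part with `g`
frozen, plus the partial derivatives of the jet function in `Dg` and in `g`
(`isLinearization_linPhi`). -/

theorem wirt_congr (j : Fin n) (h : f =ᶠ[𝓝 z] g) : wirt j f z = wirt j g z := by
  simp only [wirt, h.fderiv_eq]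

theorem wirtBar_congr (j : Fin n) (h : f =ᶠ[𝓝 z] g) : wirtBar j f z = wirtBar j g z := by
  simp only [wirtBar, h.fderiv_eq]

theorem wirt_congr_on (hU : IsOpen U) (h : Set.EqOn f g U) (j : Fin n) (hz : z ∈ U) :
    wirt j f z = wirt j g z :=
  wirt_congr j (h.eventuallyEq_of_mem (hU.mem_nhds hz))

theorem wirtBar_congr_on (hU : IsOpen U) (h : Set.EqOn f g U) (j : Fin n) (hz : z ∈ U) :
    wirtBar j f z = wirtBar j g z :=
  wirtBar_congr j (h.eventuallyEq_of_mem (hU.mem_nhds hz))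

theorem wirt_const (j : Fin n) (c : ℂ) : wirt j (fun _ => c) z = 0 := by
  simp [wirt]

theorem wirtBar_const (j : Fin n) (c : ℂ) : wirtBar j (fun _ => c) z = 0 := by
  simp [wirtBar]

theorem wirt_add (j : Fin n) (hf : DifferentiableAt ℝ f z) (hg : DifferentiableAt ℝ g z) :
    wirt j (fun w => f w + g w) z = wirt j f z + wirt j g z := by
  simp only [wirt, fderiv_fun_add hf hg, _root_.add_apply]; ring

theorem wirtBar_add (j : Fin n) (hf : DifferentiableAt ℝ f z) (hg : DifferentiableAt ℝ g z) :
    wirtBar j (fun w => f w + g w) z = wirtBar j f z + wirtBar j g z := by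
  simp only [wirtBar, fderiv_fun_add hf hg, _root_.add_apply]; ring

theorem wirt_sub (j : Fin n) (hf : DifferentiableAt ℝ f z) (hg : DifferentiableAt ℝ g z) :
    wirt j (fun w => f w - g w) z = wirt j f z - wirt j g z := by
  simp only [wirt, fderiv_fun_sub hf hg, _root_.sub_apply]; ring

theorem wirtBar_sub (j : Fin n) (hf : DifferentiableAt ℝ f z) (hg : DifferentiableAt ℝ g z) :
    wirtBar j (fun w => f w - g w) z = wirtBar j f z - wirtBar j g z := by
  simp only [wirtBar, fderiv_fun_sub hf hg, _root_.sub_apply]; ring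

theorem wirt_mul (j : Fin n) (hf : DifferentiableAt ℝ f z) (hg : DifferentiableAt ℝ g z) :
    wirt j (fun w => f w * g w) z = wirt j f z * g z + f z * wirt j g z := by
  simp only [wirt, fderiv_fun_mul hf hg, _root_.add_apply,
    _root_.smul_apply, smul_eq_mul]
  ring

theorem wirtBar_mul (j : Fin n) (hf : DifferentiableAt ℝ f z) (hg : DifferentiableAt ℝ g z) :
    wirtBar j (fun w => f w * g w) z = wirtBar j f z * g z + f z * wirtBar j g z := by
  simp only [wirtBar, fderiv_fun_mul hf hg, _root_.add_apply,
    _root_.smul_apply, smul_eq_mul]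
  ring

theorem wirt_const_mul (j : Fin n) (c : ℂ) (hf : DifferentiableAt ℝ f z) :
    wirt j (fun w => c * f w) z = c * wirt j f z := by
  rw [wirt_mul j (differentiableAt_const c) hf, wirt_const, zero_mul, zero_add]

theorem wirtBar_const_mul (j : Fin n) (c : ℂ) (hf : DifferentiableAt ℝ f z) :
    wirtBar j (fun w => c * f w) z = c * wirtBar j f z := by
  rw [wirtBar_mul j (differentiableAt_const c) hf, wirtBar_const, zero_mul, zero_add]

theorem wirt_sum {ι : Type*} (s : Finset ι) (F : ι → Cn n → ℂ) (j : Fin n)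
    (hF : ∀ i ∈ s, DifferentiableAt ℝ (F i) z) :
    wirt j (fun w => ∑ i ∈ s, F i w) z = ∑ i ∈ s, wirt j (F i) z := by
  simp only [wirt, fderiv_fun_sum hF, _root_.sum_apply, Finset.mul_sum,
    ← Finset.sum_sub_distrib]

theorem wirtBar_sum {ι : Type*} (s : Finset ι) (F : ι → Cn n → ℂ) (j : Fin n)
    (hF : ∀ i ∈ s, DifferentiableAt ℝ (F i) z) :
    wirtBar j (fun w => ∑ i ∈ s, F i w) z = ∑ i ∈ s, wirtBar j (F i) z := by
  simp only [wirtBar, fderiv_fun_sum hF, _root_.sum_apply, Finset.mul_sum,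
    ← Finset.sum_add_distrib]

theorem fderiv_conj_apply (v : Cn n) :
    fderiv ℝ (fun w => conj (f w)) z v = conj (fderiv ℝ f z v) := by
  have h := Complex.conjCLE.comp_fderiv (f := f) (x := z)
  have h' : (Complex.conjCLE ∘ f) = fun w => conj (f w) := by ext w; simp
  rw [h'] at h
  rw [h]
  simp

theorem wirt_conj (j : Fin n) : wirt j (fun w => conj (f w)) z = conj (wirtBar j f z) := by
  simp only [wirt, wirtBar, fderiv_conj_apply, map_mul, map_add, map_div₀, map_one, Complex.conj_I,
    map_ofNat]
  ring

theorem wirtBar_conj (j : Fin n) : wirtBar j (fun w => conj (f w)) z = conj (wirt j f z) := by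
  simp only [wirt, wirtBar, fderiv_conj_apply, map_mul, map_sub, map_div₀, map_one, Complex.conj_I,
    map_ofNat]
  ring

theorem eq_sum_single (v : Cn n) :
    v = ∑ j, ((v j).re • (Pi.single j 1 : Cn n) + (v j).im • (Pi.single j Complex.I : Cn n)) := by
  ext i
  simp only [Finset.sum_apply, Pi.add_apply, Pi.smul_apply, Pi.single_apply, smul_ite, smul_zero,
    Finset.sum_add_distrib, Finset.sum_ite_eq, Finset.mem_univ, if_true]
  simp

/-- The real derivative in terms of the operators `∂_j` and `∂_j̄`. -/
theorem fderiv_apply_eq_sum_wirt (f : Cn n → ℂ) (z v : Cn n) :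
    fderiv ℝ f z v = ∑ j, (wirt j f z * v j + wirtBar j f z * conj (v j)) := by
  conv_lhs => rw [eq_sum_single v]
  rw [map_sum]
  refine Finset.sum_congr rfl fun j _ => ?_
  rw [map_add, map_smul, map_smul]
  have h1 : (v j) = (v j).re + (v j).im * Complex.I := (Complex.re_add_im _).symm
  have h2 : conj (v j) = (v j).re - (v j).im * Complex.I := by
    apply Complex.ext <;> simp
  rw [h2]
  conv_rhs => rw [h1]
  simp only [wirt, wirtBar, Complex.real_smul, Complex.add_re, Complex.ofReal_re, Complex.mul_re,
    Complex.ofReal_im, Complex.I_re, Complex.I_im, Complex.add_im, Complex.mul_im]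
  push_cast
  linear_combination ((v j).im * fderiv ℝ f z (Pi.single j Complex.I)) * Complex.I_mul_I

theorem contDiffOn_wirt (hU : IsOpen U) (hf : ContDiffOn ℝ ∞ f U) (j : Fin n) :
    ContDiffOn ℝ ∞ (wirt j f) U := by
  have h : ContDiffOn ℝ ∞ (fderiv ℝ f) U := hf.fderiv_of_isOpen hU (by simp)
  exact contDiffOn_const.mul ((h.clm_apply contDiffOn_const).sub
    (contDiffOn_const.mul (h.clm_apply contDiffOn_const)))

theorem contDiffOn_wirtBar (hU : IsOpen U) (hf : ContDiffOn ℝ ∞ f U) (j : Fin n) :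
    ContDiffOn ℝ ∞ (wirtBar j f) U := by
  have h : ContDiffOn ℝ ∞ (fderiv ℝ f) U := hf.fderiv_of_isOpen hU (by simp)
  exact contDiffOn_const.mul ((h.clm_apply contDiffOn_const).add
    (contDiffOn_const.mul (h.clm_apply contDiffOn_const)))

theorem ContDiffOn.conj_smooth (hf : ContDiffOn ℝ ∞ f U) :
    ContDiffOn ℝ ∞ (fun w => conj (f w)) U :=
  Complex.conjCLE.contDiff.comp_contDiffOn hf

theorem ContDiffOn.differentiableAt_of_isOpen {E F : Type*} [NormedAddCommGroup E]
    [NormedSpace ℝ E] [NormedAddCommGroup F] [NormedSpace ℝ F] {f : E → F} {U : Set E} {z : E}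
    (hf : ContDiffOn ℝ ∞ f U) (hU : IsOpen U) (hz : z ∈ U) : DifferentiableAt ℝ f z :=
  (hf.contDiffAt (hU.mem_nhds hz)).differentiableAt (by simp)

theorem fderiv_fderiv_apply (hU : IsOpen U) (hf : ContDiffOn ℝ ∞ f U) (hz : z ∈ U) (u v : Cn n) :
    fderiv ℝ (fun w => fderiv ℝ f w v) z u = fderiv ℝ (fderiv ℝ f) z u v := by
  have h : ContDiffOn ℝ ∞ (fderiv ℝ f) U := hf.fderiv_of_isOpen hU (by simp)
  rw [fderiv_clm_apply (h.differentiableAt_of_isOpen hU hz) (differentiableAt_const v)]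
  simp

theorem fderiv_wirtBar_apply (hU : IsOpen U) (hf : ContDiffOn ℝ ∞ f U) (hz : z ∈ U) (k : Fin n)
    (u : Cn n) : fderiv ℝ (wirtBar k f) z u = (1 / 2) * (fderiv ℝ (fderiv ℝ f) z u (Pi.single k 1)
      + Complex.I * fderiv ℝ (fderiv ℝ f) z u (Pi.single k Complex.I)) := by
  have h : ContDiffOn ℝ ∞ (fderiv ℝ f) U := hf.fderiv_of_isOpen hU (by simp)
  have hd : ∀ v : Cn n, DifferentiableAt ℝ (fun w => fderiv ℝ f w v) z := fun v =>
    (h.clm_apply contDiffOn_const).differentiableAt_of_isOpen hU hz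
  unfold wirtBar
  rw [fderiv_const_mul ((hd _).fun_add ((hd _).const_mul _)),
    fderiv_fun_add (hd _) ((hd _).const_mul _),
    fderiv_const_mul (hd _)]
  simp only [_root_.smul_apply, _root_.add_apply, smul_eq_mul,
    fderiv_fderiv_apply hU hf hz]

theorem fderiv_wirt_apply (hU : IsOpen U) (hf : ContDiffOn ℝ ∞ f U) (hz : z ∈ U) (k : Fin n)
    (u : Cn n) : fderiv ℝ (wirt k f) z u = (1 / 2) * (fderiv ℝ (fderiv ℝ f) z u (Pi.single k 1)
      - Complex.I * fderiv ℝ (fderiv ℝ f) z u (Pi.single k Complex.I)) := by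
  have h : ContDiffOn ℝ ∞ (fderiv ℝ f) U := hf.fderiv_of_isOpen hU (by simp)
  have hd : ∀ v : Cn n, DifferentiableAt ℝ (fun w => fderiv ℝ f w v) z := fun v =>
    (h.clm_apply contDiffOn_const).differentiableAt_of_isOpen hU hz
  unfold wirt
  rw [fderiv_const_mul ((hd _).fun_sub ((hd _).const_mul _)),
    fderiv_fun_sub (hd _) ((hd _).const_mul _),
    fderiv_const_mul (hd _)]
  simp only [_root_.smul_apply, _root_.sub_apply, smul_eq_mul,
    fderiv_fderiv_apply hU hf hz]

theorem fderiv_fderiv_comm (hU : IsOpen U) (hf : ContDiffOn ℝ ∞ f U) (hz : z ∈ U) (u v : Cn n) :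
    fderiv ℝ (fderiv ℝ f) z u v = fderiv ℝ (fderiv ℝ f) z v u :=
  ((hf.contDiffAt (hU.mem_nhds hz)).isSymmSndFDerivAt
    (by simp only [minSmoothness_of_isRCLikeNormedField]; exact ENat.LEInfty.out)) u v

/-- Both sides expand into the same four real second derivatives, by symmetry of `D²f`. -/
theorem wirtBar_wirt_comm (hU : IsOpen U) (hf : ContDiffOn ℝ ∞ f U) (hz : z ∈ U) (j k : Fin n) :
    wirtBar k (wirt j f) z = wirt j (wirtBar k f) z := by
  simp only [wirtBar.eq_1 k (wirt j f), wirt.eq_1 j (wirtBar k f), fderiv_wirtBar_apply hU hf hz,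
    fderiv_wirt_apply hU hf hz]
  rw [fderiv_fderiv_comm hU hf hz (Pi.single k 1) (Pi.single j 1),
    fderiv_fderiv_comm hU hf hz (Pi.single k Complex.I) (Pi.single j 1),
    fderiv_fderiv_comm hU hf hz (Pi.single k 1) (Pi.single j Complex.I),
    fderiv_fderiv_comm hU hf hz (Pi.single k Complex.I) (Pi.single j Complex.I)]
  ring

/-! #### Holomorphic maps -/

/-- The Cauchy–Riemann equations: the real derivative is the restriction of a complex-linear map, so
the two terms differ by the factor `I * I`. -/
theorem wirtBar_eq_zero_of_holomorphic (hf : DifferentiableAt ℂ f z) (j : Fin n) :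
    wirtBar j f z = 0 := by
  have h : Pi.single j Complex.I = Complex.I • (Pi.single j 1 : Cn n) := by
    rw [← Pi.single_smul]; simp
  simp only [wirtBar, hf.fderiv_restrictScalars ℝ, ContinuousLinearMap.coe_restrictScalars', h,
    map_smul, smul_eq_mul]
  linear_combination (1 / 2 * fderiv ℂ f z (Pi.single j 1)) * Complex.I_mul_I

theorem wirt_eq_fderiv_of_holomorphic (hf : DifferentiableAt ℂ f z) (j : Fin n) :
    wirt j f z = fderiv ℂ f z (Pi.single j 1) := by
  have h : Pi.single j Complex.I = Complex.I • (Pi.single j 1 : Cn n) := by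
    rw [← Pi.single_smul]; simp
  simp only [wirt, hf.fderiv_restrictScalars ℝ, ContinuousLinearMap.coe_restrictScalars', h,
    map_smul, smul_eq_mul]
  linear_combination (-1 / 2 * fderiv ℂ f z (Pi.single j 1)) * Complex.I_mul_I

/-- The Jacobian entry `∂T^a/∂z^j`. -/
def holJac {n : ℕ} (T : Cn n → Cn n) (z : Cn n) (a j : Fin n) : ℂ :=
  fderiv ℂ T z (Pi.single j 1) a

variable {T : Cn n → Cn n}

theorem fderiv_comp_holomorphic (hT : DifferentiableAt ℂ T z) (hf : DifferentiableAt ℝ f (T z))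
    (v : Cn n) : fderiv ℝ (fun w => f (T w)) z v = fderiv ℝ f (T z) (fderiv ℂ T z v) := by
  have h := fderiv_comp z hf (hT.restrictScalars ℝ)
  rw [hT.fderiv_restrictScalars ℝ] at h
  change fderiv ℝ (f ∘ T) z v = _
  rw [h]; rfl

theorem fderiv_single_I (T : Cn n → Cn n) (z : Cn n) (j : Fin n) :
    fderiv ℂ T z (Pi.single j Complex.I) = Complex.I • fderiv ℂ T z (Pi.single j 1) := by
  rw [← map_smul, ← Pi.single_smul]; simp

/-- The differential of a holomorphic `T` commutes with `i`, so the `∂_ā f` contributions from the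
two real directions cancel. -/
theorem wirt_comp_holomorphic (hT : DifferentiableAt ℂ T z) (hf : DifferentiableAt ℝ f (T z))
    (j : Fin n) : wirt j (fun w => f (T w)) z = ∑ a, holJac T z a j * wirt a f (T z) := by
  simp only [wirt.eq_1 j, fderiv_comp_holomorphic hT hf, fderiv_single_I, fderiv_apply_eq_sum_wirt,
    Finset.mul_sum, ← Finset.sum_sub_distrib, holJac, Pi.smul_apply, smul_eq_mul, map_mul,
    Complex.conj_I]
  refine Finset.sum_congr rfl fun a _ => ?_
  linear_combination (-1 / 2 * wirt a f (T z) * fderiv ℂ T z (Pi.single j 1) a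
    + 1 / 2 * wirtBar a f (T z) * conj (fderiv ℂ T z (Pi.single j 1) a)) * Complex.I_mul_I

theorem wirtBar_comp_holomorphic (hT : DifferentiableAt ℂ T z) (hf : DifferentiableAt ℝ f (T z))
    (j : Fin n) :
    wirtBar j (fun w => f (T w)) z = ∑ a, conj (holJac T z a j) * wirtBar a f (T z) := by
  simp only [wirtBar.eq_1 j, fderiv_comp_holomorphic hT hf, fderiv_single_I,
    fderiv_apply_eq_sum_wirt, Finset.mul_sum, ← Finset.sum_add_distrib, holJac, Pi.smul_apply,
    smul_eq_mul, map_mul, Complex.conj_I]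
  refine Finset.sum_congr rfl fun a _ => ?_
  linear_combination (1 / 2 * wirt a f (T z) * fderiv ℂ T z (Pi.single j 1) a
    - 1 / 2 * wirtBar a f (T z) * conj (fderiv ℂ T z (Pi.single j 1) a)) * Complex.I_mul_I

end Wirtinger
/-! ### Hermitian metrics in coordinates -/

section LocalMetric

open Filter Topology

variable {n : ℕ}

theorem sum_invMet_mul_left {G : Arr n} (hG : (Matrix.of G).det ≠ 0) (b c : Fin n) :
    ∑ a, invMet G a b * G a c = if b = c then 1 else 0 := by
  have h : (Matrix.of G)⁻¹ * Matrix.of G = 1 :=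
    Matrix.nonsing_inv_mul _ (isUnit_iff_ne_zero.2 hG)
  have h' := congrFun (congrFun h b) c
  rwa [Matrix.mul_apply, Matrix.one_apply] at h'

theorem sum_invMet_mul_right {G : Arr n} (hG : (Matrix.of G).det ≠ 0) (a c : Fin n) :
    ∑ b, invMet G a b * G c b = if a = c then 1 else 0 := by
  have h : Matrix.of G * (Matrix.of G)⁻¹ = 1 :=
    Matrix.mul_nonsing_inv _ (isUnit_iff_ne_zero.2 hG)
  have h' := congrFun (congrFun h c) a
  rw [Matrix.mul_apply, Matrix.one_apply] at h'
  simp only [eq_comm (a := a), ← h', invMet, Matrix.of_apply, mul_comm]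

theorem conj_invMet {G : Arr n} (hG : (Matrix.of G).IsHermitian) (a b : Fin n) :
    conj (invMet G a b) = invMet G b a := by
  have h := hG.inv.apply b a
  simp only [invMet]
  rw [← h]; simp

theorem Matrix.PosDef.det_ne_zero' {G : Arr n} (hG : (Matrix.of G).PosDef) :
    (Matrix.of G).det ≠ 0 := hG.det_pos.ne'

theorem Matrix.PosDef.detMet_pos {G : Arr n} (hG : (Matrix.of G).PosDef) : 0 < detMet G :=
  (Complex.pos_iff.1 hG.det_pos).1

/-- `det Gᴴ = conj (det G)`, so the determinant is real. This moves between the real function needed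
for `Real.log` and the complex one to which Jacobi's formula applies. -/
theorem Matrix.IsHermitian.coe_detMet {G : Arr n} (hG : (Matrix.of G).IsHermitian) :
    (detMet G : ℂ) = (Matrix.of G).det := by
  have h : conj (Matrix.of G).det = (Matrix.of G).det := by
    have := Matrix.det_conjTranspose (Matrix.of G)
    rw [hG.eq] at this
    exact this.symm
  exact Complex.conj_eq_iff_re.1 h

theorem contDiff_det : ContDiff ℝ ∞ (fun G : Arr n => (Matrix.of G).det) := by
  simp only [Matrix.det_apply]
  refine ContDiff.sum fun σ _ => ContDiff.const_smul _ (contDiff_prod fun i _ => ?_)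
  exact (contDiff_apply ℝ ℂ i).comp (contDiff_apply ℝ (Fin n → ℂ) (σ i))

/-- An adjugate entry is the determinant of the array with one row replaced by a constant. With
Cramer's rule this makes the inverse metric smooth wherever `det ≠ 0`. -/
theorem contDiff_adjugate (a b : Fin n) :
    ContDiff ℝ ∞ (fun G : Arr n => (Matrix.of G).adjugate a b) := by
  simp only [Matrix.adjugate_apply]
  have h : ContDiff ℝ ∞ fun G : Arr n =>
      ((fun i j => (Matrix.of G).updateRow b (Pi.single a 1) i j : Arr n)) := by
    refine contDiff_pi.2 fun i => contDiff_pi.2 fun j => ?_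
    by_cases h : i = b
    · subst h; simp only [Matrix.updateRow_self]; exact contDiff_const
    · simp only [Matrix.updateRow_ne h]
      exact (contDiff_apply ℝ ℂ j).comp (contDiff_apply ℝ (Fin n → ℂ) i)
  exact contDiff_det.comp h

theorem invMet_eq (G : Arr n) (a b : Fin n) :
    invMet G a b = ((Matrix.of G).det)⁻¹ * (Matrix.of G).adjugate b a := by
  simp [invMet, Matrix.inv_def, Ring.inverse_eq_inv']

theorem contDiffOn_invMet (a b : Fin n) :
    ContDiffOn ℝ ∞ (fun G : Arr n => invMet G a b) {G | (Matrix.of G).det ≠ 0} := by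
  simp only [invMet_eq]
  exact (contDiff_det.contDiffOn.inv fun G hG => hG).mul (contDiff_adjugate b a).contDiffOn

theorem isOpen_det_ne_zero : IsOpen {G : Arr n | (Matrix.of G).det ≠ 0} :=
  isOpen_ne.preimage contDiff_det.continuous

/-- A smooth family of positive definite Hermitian arrays on a domain: a Hermitian metric. -/
structure IsMetricOn (U : Set (Cn n)) (u : Cn n → Arr n) : Prop where
  isOpen : IsOpen U
  smooth : ContDiffOn ℝ ∞ u U
  posDef : ∀ z ∈ U, (Matrix.of (u z)).PosDef

theorem ContDiffOn.arr_apply {E : Type*} [NormedAddCommGroup E] [NormedSpace ℝ E] {U : Set E}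
    {u : E → Arr n} (hu : ContDiffOn ℝ ∞ u U) (a b : Fin n) :
    ContDiffOn ℝ ∞ (fun w => u w a b) U :=
  contDiffOn_pi.1 (contDiffOn_pi.1 hu a) b

theorem contDiffOn_arr {E : Type*} [NormedAddCommGroup E] [NormedSpace ℝ E] {U : Set E}
    {u : E → Arr n} : ContDiffOn ℝ ∞ u U ↔ ∀ a b, ContDiffOn ℝ ∞ (fun w => u w a b) U :=
  ⟨fun h => h.arr_apply, fun h => contDiffOn_pi.2 fun a => contDiffOn_pi.2 fun b => h a b⟩

/-! #### Components of derivatives of array-valued functions -/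

/-- The components `∂_a u_{j k̄}` in terms of the real derivative `P = Du`. -/
def dA (a : Fin n) (P : Cn n →L[ℝ] Arr n) (j k : Fin n) : ℂ :=
  (1 / 2) * (P (Pi.single a 1) j k - Complex.I * P (Pi.single a Complex.I) j k)

/-- The components `∂_ā u_{j k̄}` in terms of the real derivative `P = Du`. -/
def dbA (a : Fin n) (P : Cn n →L[ℝ] Arr n) (j k : Fin n) : ℂ :=
  (1 / 2) * (P (Pi.single a 1) j k + Complex.I * P (Pi.single a Complex.I) j k)

/-- The components `∂_a ∂_b̄ u_{j k̄}` in terms of the real second derivative `B = D²u`. -/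
def ddA (a b : Fin n) (B : Cn n →L[ℝ] Cn n →L[ℝ] Arr n) (j k : Fin n) : ℂ :=
  (1 / 2) * (dbA b (B (Pi.single a 1)) j k - Complex.I * dbA b (B (Pi.single a Complex.I)) j k)

theorem fderiv_arr_apply {E : Type*} [NormedAddCommGroup E] [NormedSpace ℝ E] {u : E → Arr n}
    {z : E} (hu : DifferentiableAt ℝ u z) (v : E) (j k : Fin n) :
    fderiv ℝ (fun w => u w j k) z v = fderiv ℝ u z v j k := by
  have h1 := hasFDerivAt_pi'.1 (hasFDerivAt_pi'.1 hu.hasFDerivAt j) k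
  rw [h1.fderiv]; rfl

theorem wirt_arr_apply {u : Cn n → Arr n} {z : Cn n} (hu : DifferentiableAt ℝ u z)
    (a j k : Fin n) : wirt a (fun w => u w j k) z = dA a (fderiv ℝ u z) j k := by
  simp only [wirt, dA, fderiv_arr_apply hu]

theorem wirtBar_arr_apply {u : Cn n → Arr n} {z : Cn n} (hu : DifferentiableAt ℝ u z)
    (a j k : Fin n) : wirtBar a (fun w => u w j k) z = dbA a (fderiv ℝ u z) j k := by
  simp only [wirtBar, dbA, fderiv_arr_apply hu]

theorem wirt_wirtBar_arr_apply {U : Set (Cn n)} (hU : IsOpen U) {u : Cn n → Arr n}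
    (hu : ContDiffOn ℝ ∞ u U) {z : Cn n} (hz : z ∈ U) (a b j k : Fin n) :
    wirt a (wirtBar b (fun w => u w j k)) z = ddA a b (fderiv ℝ (fderiv ℝ u) z) j k := by
  have hd : ContDiffOn ℝ ∞ (fderiv ℝ u) U := hu.fderiv_of_isOpen hU (by simp)
  have h2 : ∀ s t : Cn n, fderiv ℝ (fderiv ℝ (fun w => u w j k)) z s t
      = fderiv ℝ (fderiv ℝ u) z s t j k := by
    intro s t
    rw [← fderiv_fderiv_apply hU (hu.arr_apply j k) hz]
    have h3 : Set.EqOn (fun w => fderiv ℝ (fun w => u w j k) w t) (fun w => fderiv ℝ u w t j k) U :=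
      fun w hw => fderiv_arr_apply (hu.differentiableAt_of_isOpen hU hw) t j k
    rw [(h3.eventuallyEq_of_mem (hU.mem_nhds hz)).fderiv_eq,
      fderiv_arr_apply ((hd.clm_apply contDiffOn_const).differentiableAt_of_isOpen hU hz),
      fderiv_clm_apply (hd.differentiableAt_of_isOpen hU hz) (differentiableAt_const t)]
    simp
  simp only [wirt.eq_1 a, fderiv_wirtBar_apply hU (hu.arr_apply j k) hz, h2, ddA, dbA]

/-! #### Jacobi's formula -/

/-- The determinant as a continuous multilinear function of the rows. -/
def detRow (n : ℕ) : ContinuousMultilinearMap ℂ (fun _ : Fin n => Fin n → ℂ) ℂ where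
  toMultilinearMap := (Matrix.detRowAlternating (R := ℂ) (n := Fin n)).toMultilinearMap
  cont := (contDiff_det (n := n)).continuous

/-- Laplace expansion along the replaced row, whose cofactors do not involve that row. -/
theorem det_update_eq (G : Arr n) (i : Fin n) (v : Fin n → ℂ) :
    detRow n (Function.update G i v) = ∑ j, v j * (Matrix.of G).adjugate j i := by
  have h := Matrix.det_eq_sum_mul_adjugate_row ((Matrix.of G).updateRow i v) i
  have h2 : detRow n (Function.update G i v) = ((Matrix.of G).updateRow i v).det := rfl
  rw [h2, h]
  refine Finset.sum_congr rfl fun j _ => ?_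
  rw [Matrix.updateRow_self, Matrix.adjugate_apply, Matrix.adjugate_apply,
    Matrix.updateRow_idem]

/-- The determinant is multilinear in the rows, so its derivative is a sum of determinants with one
row replaced by its derivative, each then expanded by cofactors. -/
theorem fderiv_det_apply {u : Cn n → Arr n} {z : Cn n} (hu : DifferentiableAt ℝ u z)
    (v : Cn n) : fderiv ℝ (fun w => (Matrix.of (u w)).det) z v
      = ∑ a, ∑ b, (Matrix.of (u z)).adjugate b a * fderiv ℝ (fun w => u w a b) z v := by
  have h1 : HasFDerivAt (fun G : Arr n => (Matrix.of G).det)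
      (((detRow n).linearDeriv (u z)).restrictScalars ℝ) (u z) :=
    ((detRow n).hasFDerivAt (u z)).restrictScalars ℝ
  have h2 := h1.comp z hu.hasFDerivAt
  have h3 : fderiv ℝ (fun w => (Matrix.of (u w)).det) z
      = (((detRow n).linearDeriv (u z)).restrictScalars ℝ).comp (fderiv ℝ u z) := h2.fderiv
  rw [h3]
  simp only [ContinuousLinearMap.comp_apply, ContinuousLinearMap.coe_restrictScalars',
    ContinuousMultilinearMap.linearDeriv_apply, det_update_eq, fderiv_arr_apply hu]
  exact Finset.sum_congr rfl fun a _ => Finset.sum_congr rfl fun b _ => mul_comm _ _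

namespace IsMetricOn

variable {U : Set (Cn n)} {u : Cn n → Arr n} {z : Cn n}

theorem det_ne_zero (h : IsMetricOn U u) (hz : z ∈ U) : (Matrix.of (u z)).det ≠ 0 :=
  (h.posDef z hz).det_ne_zero'

theorem isHermitian (h : IsMetricOn U u) (hz : z ∈ U) : (Matrix.of (u z)).IsHermitian :=
  (h.posDef z hz).isHermitian

theorem conj_apply (h : IsMetricOn U u) (hz : z ∈ U) (a b : Fin n) :
    conj (u z a b) = u z b a :=
  (h.isHermitian hz).apply b a

theorem differentiableAt (h : IsMetricOn U u) (hz : z ∈ U) : DifferentiableAt ℝ u z :=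
  h.smooth.differentiableAt_of_isOpen h.isOpen hz

theorem smooth_invMet (h : IsMetricOn U u) (a b : Fin n) :
    ContDiffOn ℝ ∞ (fun w => invMet (u w) a b) U :=
  (contDiffOn_invMet a b).comp h.smooth fun _ hz => h.det_ne_zero hz

theorem smooth_det (h : IsMetricOn U u) : ContDiffOn ℝ ∞ (fun w => (Matrix.of (u w)).det) U :=
  contDiff_det.comp_contDiffOn h.smooth

theorem smooth_detMet (h : IsMetricOn U u) : ContDiffOn ℝ ∞ (fun w => detMet (u w)) U :=
  Complex.reCLM.contDiff.comp_contDiffOn h.smooth_det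

theorem coe_detMet (h : IsMetricOn U u) (hz : z ∈ U) :
    (detMet (u z) : ℂ) = (Matrix.of (u z)).det := (h.isHermitian hz).coe_detMet

theorem smooth_logDet (h : IsMetricOn U u) :
    ContDiffOn ℝ ∞ (fun w => (Real.log (detMet (u w)) : ℂ)) U :=
  Complex.ofRealCLM.contDiff.comp_contDiffOn
    (h.smooth_detMet.log fun _ hz => (h.posDef _ hz).detMet_pos.ne')

theorem fderiv_det (h : IsMetricOn U u) (hz : z ∈ U) (v : Cn n) :
    fderiv ℝ (fun w => (Matrix.of (u w)).det) z v = (Matrix.of (u z)).det *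
      ∑ a, ∑ b, invMet (u z) a b * fderiv ℝ (fun w => u w a b) z v := by
  rw [fderiv_det_apply (h.differentiableAt hz), Finset.mul_sum]
  refine Finset.sum_congr rfl fun a _ => ?_
  rw [Finset.mul_sum]
  refine Finset.sum_congr rfl fun b _ => ?_
  rw [invMet_eq, ← mul_assoc, mul_inv_cancel_left₀ (h.det_ne_zero hz)]

/-- `d log det g = tr (g⁻¹ dg)`. The complex-valued Jacobi formula is transferred to the real
function `detMet`, which agrees with the determinant near `z`. -/
theorem fderiv_logDet (h : IsMetricOn U u) (hz : z ∈ U) (v : Cn n) :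
    fderiv ℝ (fun w => (Real.log (detMet (u w)) : ℂ)) z v =
      ∑ a, ∑ b, invMet (u z) a b * fderiv ℝ (fun w => u w a b) z v := by
  have hd : DifferentiableAt ℝ (fun w => detMet (u w)) z :=
    h.smooth_detMet.differentiableAt_of_isOpen h.isOpen hz
  have h0 : detMet (u z) ≠ 0 := (h.posDef _ hz).detMet_pos.ne'
  have h1 := (Complex.ofRealCLM.hasFDerivAt.comp z (hd.hasFDerivAt.log h0)).fderiv
  have h2 := (Complex.ofRealCLM.hasFDerivAt.comp z hd.hasFDerivAt).fderiv
  have h3 : Set.EqOn (Complex.ofRealCLM ∘ fun w => detMet (u w))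
      (fun w => (Matrix.of (u w)).det) U := fun w hw => h.coe_detMet hw
  rw [(h3.eventuallyEq_of_mem (h.isOpen.mem_nhds hz)).fderiv_eq] at h2
  have h4 := h.fderiv_det hz v
  rw [h2, ← h.coe_detMet hz] at h4
  change fderiv ℝ (Complex.ofRealCLM ∘ fun w => Real.log (detMet (u w))) z v = _
  rw [h1]
  simp only [ContinuousLinearMap.comp_apply, _root_.smul_apply, smul_eq_mul,
    Complex.ofRealCLM_apply, Complex.ofReal_mul, Complex.ofReal_inv] at h4 ⊢
  rw [h4, inv_mul_cancel_left₀ (Complex.ofReal_ne_zero.2 h0)]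

theorem wirtBar_logDet (h : IsMetricOn U u) (hz : z ∈ U) (k : Fin n) :
    wirtBar k (fun w => (Real.log (detMet (u w)) : ℂ)) z =
      ∑ a, ∑ b, invMet (u z) a b * wirtBar k (fun w => u w a b) z := by
  simp only [wirtBar, h.fderiv_logDet hz, Finset.mul_sum, ← Finset.sum_add_distrib]
  exact Finset.sum_congr rfl fun a _ => Finset.sum_congr rfl fun b _ => by ring

/-- `d(g⁻¹) = -g⁻¹ (dg) g⁻¹`: differentiate `∑ g^{c q̄} g_{c d̄} = δ` (`key`), then remove the
factor `g_{c d̄}` by contracting with the inverse. -/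
theorem fderiv_invMet (h : IsMetricOn U u) (hz : z ∈ U) (p q : Fin n) (v : Cn n) :
    fderiv ℝ (fun w => invMet (u w) p q) z v = -∑ c, ∑ d,
      invMet (u z) p d * invMet (u z) c q * fderiv ℝ (fun w => u w c d) z v := by
  have hi : ∀ a b, DifferentiableAt ℝ (fun w => invMet (u w) a b) z := fun a b =>
    (h.smooth_invMet a b).differentiableAt_of_isOpen h.isOpen hz
  have hu : ∀ a b, DifferentiableAt ℝ (fun w => u w a b) z := fun a b =>
    (h.smooth.arr_apply a b).differentiableAt_of_isOpen h.isOpen hz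
  have key : ∀ d, ∑ c, (fderiv ℝ (fun w => invMet (u w) c q) z v * u z c d) =
      -∑ c, invMet (u z) c q * fderiv ℝ (fun w => u w c d) z v := by
    intro d
    have h1 : Set.EqOn (fun w => ∑ c, invMet (u w) c q * u w c d)
        (fun _ => if q = d then (1 : ℂ) else 0) U :=
      fun w hw => sum_invMet_mul_left (h.det_ne_zero hw) q d
    have h2 := (h1.eventuallyEq_of_mem (h.isOpen.mem_nhds hz)).fderiv_eq (𝕜 := ℝ)
    rw [fderiv_fun_sum fun c _ => (hi c q).fun_mul (hu c d)] at h2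
    have h3 := congrArg (fun D : Cn n →L[ℝ] ℂ => D v) h2
    simp only [_root_.sum_apply, fderiv_fun_mul (hi _ _) (hu _ _), _root_.add_apply,
      _root_.smul_apply, smul_eq_mul, Finset.sum_add_distrib, fderiv_fun_const, Pi.zero_apply,
      _root_.zero_apply] at h3
    rw [← sub_eq_zero, ← h3, sub_neg_eq_add, add_comm]
    congr 1
    exact Finset.sum_congr rfl fun c _ => mul_comm _ _
  calc fderiv ℝ (fun w => invMet (u w) p q) z v
      = ∑ c, (∑ d, invMet (u z) p d * u z c d) * fderiv ℝ (fun w => invMet (u w) c q) z v := by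
        simp only [sum_invMet_mul_right (h.det_ne_zero hz), ite_mul, one_mul, zero_mul,
          Finset.sum_ite_eq, Finset.mem_univ, if_true]
    _ = ∑ d, invMet (u z) p d * ∑ c, (fderiv ℝ (fun w => invMet (u w) c q) z v * u z c d) := by
        simp only [Finset.sum_mul, Finset.mul_sum]
        rw [Finset.sum_comm]
        exact Finset.sum_congr rfl fun d _ => Finset.sum_congr rfl fun c _ => by ring
    _ = _ := by
        simp only [key, mul_neg, Finset.sum_neg_distrib, Finset.mul_sum]
        rw [Finset.sum_comm]
        exact congrArg _ (Finset.sum_congr rfl fun d _ => Finset.sum_congr rfl fun c _ => by ring)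

end IsMetricOn

/-- The components of `∂_j g^{p q̄}` in terms of `g` and `P = Dg`. -/
def dInv (j : Fin n) (G : Arr n) (P : Cn n →L[ℝ] Arr n) (p q : Fin n) : ℂ :=
  -∑ c, ∑ d, invMet G p d * invMet G c q * dA j P c d

/-- The components of `∂_j̄ g^{p q̄}` in terms of `g` and `P = Dg`. -/
def dbInv (j : Fin n) (G : Arr n) (P : Cn n →L[ℝ] Arr n) (p q : Fin n) : ℂ :=
  -∑ c, ∑ d, invMet G p d * invMet G c q * dbA j P c d

namespace IsMetricOn

variable {U : Set (Cn n)} {u : Cn n → Arr n} {z : Cn n}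

theorem wirt_invMet (h : IsMetricOn U u) (hz : z ∈ U) (j p q : Fin n) :
    wirt j (fun w => invMet (u w) p q) z = dInv j (u z) (fderiv ℝ u z) p q := by
  simp only [wirt, h.fderiv_invMet hz, dInv, dA, fderiv_arr_apply (h.differentiableAt hz),
    Finset.mul_sum, ← Finset.sum_neg_distrib, ← Finset.sum_sub_distrib]
  exact Finset.sum_congr rfl fun a _ => Finset.sum_congr rfl fun b _ => by ring

theorem wirtBar_invMet (h : IsMetricOn U u) (hz : z ∈ U) (j p q : Fin n) :
    wirtBar j (fun w => invMet (u w) p q) z = dbInv j (u z) (fderiv ℝ u z) p q := by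
  simp only [wirtBar, h.fderiv_invMet hz, dbInv, dbA, fderiv_arr_apply (h.differentiableAt hz),
    Finset.mul_sum, ← Finset.sum_neg_distrib, ← Finset.sum_add_distrib]
  exact Finset.sum_congr rfl fun a _ => Finset.sum_congr rfl fun b _ => by ring

end IsMetricOn

/-- The components of `∂* ω`. -/
def delStarComp (u : Cn n → Arr n) (z : Cn n) (k : Fin n) : ℂ :=
  (Complex.I / 2) * ∑ a, ∑ b, invMet (u z) a b *
    (wirtBar b (fun w => u w a k) z - wirtBar k (fun w => u w a b) z)

/-- The components of `∂̄* ω`. -/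
def delBarStarComp (u : Cn n → Arr n) (z : Cn n) (j : Fin n) : ℂ :=
  -(Complex.I / 2) * ∑ a, ∑ b, invMet (u z) a b *
    (wirt a (fun w => u w j b) z - wirt j (fun w => u w a b) z)

/-- The Hermitian components of `Φ(ω)`. -/
def phiComp (u : Cn n → Arr n) (z : Cn n) : Arr n := fun j k =>
  2 * Complex.I * wirt j (fun w => delStarComp u w k) z
    - 2 * Complex.I * wirtBar k (fun w => delBarStarComp u w j) z
    - wirt j (wirtBar k (fun w => (Real.log (detMet (u w)) : ℂ))) z

/-- The second-order part of `Φ(ω)` in terms of `g` and `D²g`. -/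
def phiTop (G : Arr n) (B : Cn n →L[ℝ] Cn n →L[ℝ] Arr n) : Arr n := fun j k =>
  -∑ a, ∑ b, invMet G a b * (ddA j b B a k + ddA a k B j b - ddA j k B a b)

/-- The lower-order part of `Φ(ω)` in terms of `g` and `Dg`. -/
def phiLow (G : Arr n) (P : Cn n →L[ℝ] Arr n) : Arr n := fun j k =>
  -∑ a, ∑ b, (dInv j G P a b * dbA b P a k + dbInv k G P a b * (dA a P j b - dA j P a b))

/-! ### Smoothness, reality and quasilinear form of the local expression for `Φ` -/

namespace IsMetricOn

variable {U : Set (Cn n)} {u : Cn n → Arr n} {z : Cn n}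

theorem smooth_delStarComp (h : IsMetricOn U u) (k : Fin n) :
    ContDiffOn ℝ ∞ (fun w => delStarComp u w k) U :=
  contDiffOn_const.mul (ContDiffOn.sum fun a _ => ContDiffOn.sum fun b _ =>
    (h.smooth_invMet a b).mul ((contDiffOn_wirtBar h.isOpen (h.smooth.arr_apply a k) b).sub
      (contDiffOn_wirtBar h.isOpen (h.smooth.arr_apply a b) k)))

/-- Since `g` is Hermitian, conjugation swaps the two indices of `g` and of its inverse and turns
`∂_b̄` into `∂_b`. Facts about `∂̄*ω` can thus be read off from those about `∂*ω`. -/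
theorem delBarStarComp_eq_conj (h : IsMetricOn U u) (hz : z ∈ U) (j : Fin n) :
    delBarStarComp u z j = conj (delStarComp u z j) := by
  have hw : ∀ a b c : Fin n, conj (wirtBar a (fun w => u w b c) z) =
      wirt a (fun w => u w c b) z := by
    intro a b c
    rw [← wirt_conj]
    exact wirt_congr_on h.isOpen (fun w hw => h.conj_apply hw b c) a hz
  simp only [delBarStarComp, delStarComp, map_mul, map_sum, map_sub, map_div₀, Complex.conj_I,
    map_ofNat, conj_invMet (h.isHermitian hz), hw, neg_div]
  rw [Finset.sum_comm]

theorem smooth_delBarStarComp (h : IsMetricOn U u) (k : Fin n) :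
    ContDiffOn ℝ ∞ (fun w => delBarStarComp u w k) U :=
  contDiffOn_const.mul (ContDiffOn.sum fun a _ => ContDiffOn.sum fun b _ =>
    (h.smooth_invMet a b).mul ((contDiffOn_wirt h.isOpen (h.smooth.arr_apply k b) a).sub
      (contDiffOn_wirt h.isOpen (h.smooth.arr_apply a b) k)))

theorem smooth_phiComp (h : IsMetricOn U u) : ContDiffOn ℝ ∞ (phiComp u) U :=
  contDiffOn_arr.2 fun j k =>
    ((contDiffOn_const.mul (contDiffOn_wirt h.isOpen (h.smooth_delStarComp k) j)).sub
      (contDiffOn_const.mul (contDiffOn_wirtBar h.isOpen (h.smooth_delBarStarComp j) k))).sub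
      (contDiffOn_wirt h.isOpen (contDiffOn_wirtBar h.isOpen h.smooth_logDet k) j)

/-- Conjugation exchanges the two adjoint terms, and the complex Hessian of the real function `log
det g` is Hermitian. Hence `Φ(ω)` is a real form. -/
theorem isHermitian_phiComp (h : IsMetricOn U u) (hz : z ∈ U) (j k : Fin n) :
    conj (phiComp u z j k) = phiComp u z k j := by
  have h1 : ∀ a b, wirtBar a (fun w => delBarStarComp u w b) z =
      conj (wirt a (fun w => delStarComp u w b) z) := by
    intro a b
    rw [← wirtBar_conj]
    exact wirtBar_congr_on h.isOpen (fun w hw => h.delBarStarComp_eq_conj hw b) a hz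
  have h2 : conj (wirt j (wirtBar k (fun w => (Real.log (detMet (u w)) : ℂ))) z) =
      wirt k (wirtBar j (fun w => (Real.log (detMet (u w)) : ℂ))) z := by
    rw [← wirtBar_wirt_comm h.isOpen h.smooth_logDet hz, ← wirt_conj]
    congr 1; ext w
    rw [← wirtBar_conj]
    simp
  simp only [phiComp, map_sub, map_mul, h1, h2, Complex.conj_I, Complex.conj_conj, map_ofNat]
  ring

/-- In coordinates `Φ` is a quasilinear operator of second order. -/
theorem phiComp_eq (h : IsMetricOn U u) (hz : z ∈ U) :
    phiComp u z = phiTop (u z) (fderiv ℝ (fderiv ℝ u) z) + phiLow (u z) (fderiv ℝ u z) := by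
  have hU := h.isOpen
  have hi : ∀ a b, DifferentiableAt ℝ (fun w => invMet (u w) a b) z := fun a b =>
    (h.smooth_invMet a b).differentiableAt_of_isOpen hU hz
  have hw : ∀ a b c, DifferentiableAt ℝ (wirt a (fun w => u w b c)) z := fun a b c =>
    (contDiffOn_wirt hU (h.smooth.arr_apply b c) a).differentiableAt_of_isOpen hU hz
  have hwb : ∀ a b c, DifferentiableAt ℝ (wirtBar a (fun w => u w b c)) z := fun a b c =>
    (contDiffOn_wirtBar hU (h.smooth.arr_apply b c) a).differentiableAt_of_isOpen hU hz
  have hud := h.differentiableAt hz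
  have h2 : ∀ a b c d, wirtBar a (wirt b (fun w => u w c d)) z =
      ddA b a (fderiv ℝ (fderiv ℝ u) z) c d := fun a b c d => by
    rw [wirtBar_wirt_comm hU (h.smooth.arr_apply c d) hz,
      wirt_wirtBar_arr_apply hU h.smooth hz]
  ext j k
  have e1 : wirt j (fun w => delStarComp u w k) z = (Complex.I / 2) * ∑ a, ∑ b,
      (dInv j (u z) (fderiv ℝ u z) a b * (dbA b (fderiv ℝ u z) a k - dbA k (fderiv ℝ u z) a b) +
        invMet (u z) a b * (ddA j b (fderiv ℝ (fderiv ℝ u) z) a k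
          - ddA j k (fderiv ℝ (fderiv ℝ u) z) a b)) := by
    unfold delStarComp
    have hd : ∀ a b, DifferentiableAt ℝ (fun w => invMet (u w) a b *
        (wirtBar b (fun w => u w a k) w - wirtBar k (fun w => u w a b) w)) z := fun a b =>
      (hi a b).fun_mul ((hwb b a k).fun_sub (hwb k a b))
    rw [wirt_const_mul _ _ (DifferentiableAt.fun_sum fun a _ => DifferentiableAt.fun_sum fun b _ =>
      hd a b), wirt_sum _ _ _ fun a _ => DifferentiableAt.fun_sum fun b _ => hd a b]
    congr 1
    refine Finset.sum_congr rfl fun a _ => ?_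
    rw [wirt_sum _ _ _ fun b _ => hd a b]
    refine Finset.sum_congr rfl fun b _ => ?_
    rw [wirt_mul _ (hi a b) ((hwb b a k).fun_sub (hwb k a b)), wirt_sub _ (hwb b a k) (hwb k a b),
      h.wirt_invMet hz, wirt_wirtBar_arr_apply hU h.smooth hz,
      wirt_wirtBar_arr_apply hU h.smooth hz, wirtBar_arr_apply hud, wirtBar_arr_apply hud]
  have e2 : wirtBar k (fun w => delBarStarComp u w j) z = -(Complex.I / 2) * ∑ a, ∑ b,
      (dbInv k (u z) (fderiv ℝ u z) a b * (dA a (fderiv ℝ u z) j b - dA j (fderiv ℝ u z) a b) +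
        invMet (u z) a b * (ddA a k (fderiv ℝ (fderiv ℝ u) z) j b
          - ddA j k (fderiv ℝ (fderiv ℝ u) z) a b)) := by
    unfold delBarStarComp
    have hd : ∀ a b, DifferentiableAt ℝ (fun w => invMet (u w) a b *
        (wirt a (fun w => u w j b) w - wirt j (fun w => u w a b) w)) z := fun a b =>
      (hi a b).fun_mul ((hw a j b).fun_sub (hw j a b))
    rw [wirtBar_const_mul _ _ (DifferentiableAt.fun_sum fun a _ =>
      DifferentiableAt.fun_sum fun b _ => hd a b),
      wirtBar_sum _ _ _ fun a _ => DifferentiableAt.fun_sum fun b _ => hd a b]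
    congr 1
    refine Finset.sum_congr rfl fun a _ => ?_
    rw [wirtBar_sum _ _ _ fun b _ => hd a b]
    refine Finset.sum_congr rfl fun b _ => ?_
    rw [wirtBar_mul _ (hi a b) ((hw a j b).fun_sub (hw j a b)), wirtBar_sub _ (hw a j b) (hw j a b),
      h.wirtBar_invMet hz, h2, h2, wirt_arr_apply hud, wirt_arr_apply hud]
  have e3 : wirt j (wirtBar k (fun w => (Real.log (detMet (u w)) : ℂ))) z = ∑ a, ∑ b,
      (dInv j (u z) (fderiv ℝ u z) a b * dbA k (fderiv ℝ u z) a b +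
        invMet (u z) a b * ddA j k (fderiv ℝ (fderiv ℝ u) z) a b) := by
    rw [wirt_congr_on hU (fun w hw => h.wirtBar_logDet hw k) j hz]
    have hd : ∀ a b, DifferentiableAt ℝ (fun w => invMet (u w) a b *
        wirtBar k (fun w => u w a b) w) z := fun a b => (hi a b).fun_mul (hwb k a b)
    rw [wirt_sum _ _ _ fun a _ => DifferentiableAt.fun_sum fun b _ => hd a b]
    refine Finset.sum_congr rfl fun a _ => ?_
    rw [wirt_sum _ _ _ fun b _ => hd a b]
    refine Finset.sum_congr rfl fun b _ => ?_
    rw [wirt_mul _ (hi a b) (hwb k a b), h.wirt_invMet hz, wirt_wirtBar_arr_apply hU h.smooth hz,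
      wirtBar_arr_apply hud]
  simp only [phiComp, phiTop, phiLow, Pi.add_apply, e1, e2, e3]
  have hI : ∀ s : ℂ, 2 * Complex.I * (Complex.I / 2 * s) = -s := fun s => by
    linear_combination s * Complex.I_mul_I
  have hI' : ∀ s : ℂ, 2 * Complex.I * (-(Complex.I / 2) * s) = s := fun s => by
    linear_combination -s * Complex.I_mul_I
  rw [hI, hI']
  -- The `log det` term cancels one of the two traces `g^{a b̄} ∂_j ∂_k̄ g_{a b̄}`, and also the
  -- product of `∂_j g^{a b̄}` with `∂_k̄ g_{a b̄}` that comes from `∂∂*ω`.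
  simp only [← Finset.sum_neg_distrib, ← Finset.sum_sub_distrib, ← Finset.sum_add_distrib]
  exact Finset.sum_congr rfl fun a _ => Finset.sum_congr rfl fun b _ => by ring

end IsMetricOn

end LocalMetric
/-! ### Formal adjoints -/

section Adjoint

open Filter Topology MeasureTheory

variable {n : ℕ} {U : Set (Cn n)} {u : Cn n → Arr n}

/-! #### Integration by parts -/

/-- Coefficients are smooth only on the coordinate domain. Multiplication by a function supported
there extends them smoothly by zero, so integration by parts can take place on all of `ℂⁿ`. -/
theorem contDiff_mul_of_tsupport_subset {f ψ : Cn n → ℂ} (hU : IsOpen U)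
    (hf : ContDiffOn ℝ ∞ f U) (hψ : ContDiff ℝ ∞ ψ) (hs : tsupport ψ ⊆ U) :
    ContDiff ℝ ∞ (fun w => f w * ψ w) := by
  refine contDiff_iff_contDiffAt.2 fun z => ?_
  by_cases hz : z ∈ tsupport ψ
  · exact (hf.contDiffAt (hU.mem_nhds (hs hz))).mul hψ.contDiffAt
  · refine (contDiffAt_const (c := (0 : ℂ))).congr_of_eventuallyEq ?_
    filter_upwards [(isClosed_tsupport ψ).isOpen_compl.mem_nhds hz] with w hw
    rw [image_eq_zero_of_notMem_tsupport hw, mul_zero]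

theorem integrable_mul_of_tsupport_subset {f ψ : Cn n → ℂ} (hU : IsOpen U)
    (hf : ContDiffOn ℝ ∞ f U) (hψ : ContDiff ℝ ∞ ψ) (hc : HasCompactSupport ψ)
    (hs : tsupport ψ ⊆ U) : Integrable (fun w => f w * ψ w) :=
  (contDiff_mul_of_tsupport_subset hU hf hψ hs).continuous.integrable_of_hasCompactSupport
    hc.mul_left

/-- Integration by parts against the constant `1`. This function need not be integrable; only the
products must be, and they have compact support. -/
theorem integral_fderiv_apply_eq_zero {F : Cn n → ℂ} (hF : ContDiff ℝ ∞ F)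
    (hc : HasCompactSupport F) (v : Cn n) : ∫ z, fderiv ℝ F z v = 0 := by
  have h1 : Integrable (fun z => fderiv ℝ F z v) :=
    ((hF.continuous_fderiv (by simp)).clm_apply continuous_const).integrable_of_hasCompactSupport
      (hc.fderiv_apply ℝ v)
  have h := integral_mul_fderiv_eq_neg_fderiv_mul_of_integrable (μ := volume)
    (f := fun _ : Cn n => (1 : ℂ)) (g := F) (v := v) (by simp)
    (by simpa using h1) (by simpa using hF.continuous.integrable_of_hasCompactSupport hc)
    (fun _ _ => differentiableAt_const _) (fun z _ => hF.differentiable (by simp) z)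
  simpa using h

theorem integral_wirtBar_eq_zero {F : Cn n → ℂ} (hF : ContDiff ℝ ∞ F)
    (hc : HasCompactSupport F) (k : Fin n) : ∫ z, wirtBar k F z = 0 := by
  have h1 : ∀ v, Integrable (fun z => fderiv ℝ F z v) := fun v =>
    ((hF.continuous_fderiv (by simp)).clm_apply continuous_const).integrable_of_hasCompactSupport
      (hc.fderiv_apply ℝ v)
  unfold wirtBar
  rw [integral_const_mul, integral_add (h1 _) ((h1 _).const_mul _), integral_const_mul,
    integral_fderiv_apply_eq_zero hF hc, integral_fderiv_apply_eq_zero hF hc]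
  simp

theorem wirtBar_eq_zero_of_notMem_tsupport {ψ : Cn n → ℂ} {z : Cn n} (hz : z ∉ tsupport ψ)
    (k : Fin n) : wirtBar k ψ z = 0 := by
  rw [wirtBar_congr (g := fun _ => 0) k (notMem_tsupport_iff_eventuallyEq.1 hz), wirtBar_const]

theorem tsupport_wirtBar_subset (ψ : Cn n → ℂ) (k : Fin n) :
    tsupport (wirtBar k ψ) ⊆ tsupport ψ :=
  closure_minimal (fun _ hz => by_contra fun h => hz (wirtBar_eq_zero_of_notMem_tsupport h k))
    (isClosed_tsupport ψ)

theorem contDiff_wirtBar {ψ : Cn n → ℂ} (hψ : ContDiff ℝ ∞ ψ) (k : Fin n) :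
    ContDiff ℝ ∞ (wirtBar k ψ) :=
  contDiffOn_univ.1 (contDiffOn_wirtBar isOpen_univ hψ.contDiffOn k)

/-- The integral of `∂_k̄ (f ψ)` vanishes, and the product rule splits it. It may be taken over `U`
because the product vanishes near every point outside `U`. -/
theorem integral_mul_wirtBar {f ψ : Cn n → ℂ} (hU : IsOpen U)
    (hf : ContDiffOn ℝ ∞ f U) (hψ : ContDiff ℝ ∞ ψ) (hc : HasCompactSupport ψ)
    (hs : tsupport ψ ⊆ U) (k : Fin n) :
    ∫ z in U, f z * wirtBar k ψ z = -∫ z in U, wirtBar k f z * ψ z := by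
  have hF := contDiff_mul_of_tsupport_subset hU hf hψ hs
  have h0 := integral_wirtBar_eq_zero hF hc.mul_left k
  have hz : ∀ z ∉ U, wirtBar k (fun w => f w * ψ w) z = 0 := fun z hz =>
    wirtBar_eq_zero_of_notMem_tsupport (fun h => hz (hs (tsupport_mul_subset_right h))) k
  rw [← setIntegral_eq_integral_of_forall_compl_eq_zero hz,
    setIntegral_congr_fun hU.measurableSet fun z hz => wirtBar_mul k
      (hf.differentiableAt_of_isOpen hU hz) (hψ.differentiable (by simp) z)] at h0
  have hc' : HasCompactSupport (wirtBar k ψ) :=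
    hc.of_isClosed_subset (isClosed_tsupport _) (tsupport_wirtBar_subset ψ k)
  rw [integral_add
    (integrable_mul_of_tsupport_subset hU (contDiffOn_wirtBar hU hf k) hψ hc hs).integrableOn
    (integrable_mul_of_tsupport_subset hU hf (contDiff_wirtBar hψ k) hc'
      ((tsupport_wirtBar_subset ψ k).trans hs)).integrableOn] at h0
  exact (neg_eq_of_add_eq_zero_right h0).symm

/-! #### Inner products in components -/

theorem sum_fin_one_fun (f : (Fin 1 → Fin n) → ℂ) : ∑ I, f I = ∑ i, f fun _ => i :=
  ((Equiv.funUnique (Fin 1) (Fin n)).symm.sum_comp f).symm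

/-- The form `∑ b_k dz̄^k`. -/
def form01 (b : Cn n → Fin n → ℂ) : PQ n 0 1 := fun z _ J => b z (J 0)

/-- The form `∑ c_k dz^k`. -/
def form10 (c : Cn n → Fin n → ℂ) : PQ n 1 0 := fun z I _ => c z (I 0)

/-- The form with components `(i/2) u_{j k̄}`. -/
def kahlerForm (u : Cn n → Arr n) : PQ n 1 1 := arrForm fun z j k => (Complex.I / 2) * u z j k

theorem l2Inner_congr {p q : ℕ} (hU : IsOpen U) {φ φ' : PQ n p q} (h : Set.EqOn φ φ' U)
    (ψ : PQ n p q) : l2Inner U u φ ψ = l2Inner U u φ' ψ :=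
  setIntegral_congr_fun hU.measurableSet fun z hz => by simp only [h hz]

theorem formInner_01 (G : Arr n) (b : Fin n → ℂ) (ψ : (Fin 0 → Fin n) → (Fin 1 → Fin n) → ℂ) :
    formInner G (fun _ J => b (J 0)) ψ =
      ∑ l, (∑ j, invMet G l j * b j) * conj (ψ default fun _ => l) := by
  simp only [formInner, Nat.factorial, sum_fin_one_fun, Finset.univ_unique, Finset.sum_singleton,
    Finset.prod_singleton, Finset.univ_eq_empty, Finset.prod_empty, Finset.sum_mul]
  rw [Finset.sum_comm]
  simp

theorem formInner_10 (G : Arr n) (c : Fin n → ℂ) (ψ : (Fin 1 → Fin n) → (Fin 0 → Fin n) → ℂ) :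
    formInner G (fun I _ => c (I 0)) ψ =
      ∑ l, (∑ j, invMet G j l * c j) * conj (ψ (fun _ => l) default) := by
  simp only [formInner, Nat.factorial, sum_fin_one_fun, Finset.univ_unique, Finset.sum_singleton,
    Finset.prod_singleton, Finset.univ_eq_empty, Finset.prod_empty, Finset.sum_mul]
  rw [Finset.sum_comm]
  simp

/-- One inverse metric in the inner product cancels against the components of `ω` itself, so pairing
with `ω` is a trace. -/
theorem formInner_kahler {G : Arr n} (hG : (Matrix.of G).det ≠ 0)
    (ψ : (Fin 1 → Fin n) → (Fin 1 → Fin n) → ℂ) :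
    formInner G (fun I J => (Complex.I / 2) * G (I 0) (J 0)) ψ =
      (Complex.I / 2) * ∑ l, ∑ k, invMet G l k * conj (ψ (fun _ => k) fun _ => l) := by
  simp only [formInner, Nat.factorial, sum_fin_one_fun, Finset.univ_unique,
    Finset.prod_singleton]
  calc _ = (Complex.I / 2) * ∑ k, ∑ l, ∑ j, invMet G l j * (∑ i, invMet G i k * G i j) *
        conj (ψ (fun _ => k) fun _ => l) := by
        simp only [Finset.mul_sum, Finset.sum_mul]
        rw [Finset.sum_comm]
        refine Finset.sum_congr rfl fun k _ => ?_
        refine Finset.sum_comm.trans ((Finset.sum_congr rfl fun j _ => Finset.sum_comm).trans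
          (Finset.sum_comm.trans ?_))
        exact Finset.sum_congr rfl fun l _ => Finset.sum_congr rfl fun j _ =>
          Finset.sum_congr rfl fun i _ => by norm_num; ring
    _ = _ := by
        simp only [sum_invMet_mul_left hG, mul_ite, mul_one, mul_zero, ite_mul, zero_mul,
          Finset.sum_ite_eq, Finset.mem_univ, if_true]
        rw [Finset.sum_comm]

theorem del_01_apply (α : PQ n 0 1) (z : Cn n) (I J : Fin 1 → Fin n) :
    del α z I J = wirt (I 0) (fun w => α w default J) z := by
  simp [del, Subsingleton.elim _ (default : Fin 0 → Fin n)]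

theorem delBar_10_apply (α : PQ n 1 0) (z : Cn n) (I J : Fin 1 → Fin n) :
    delBar α z I J = -wirtBar (J 0) (fun w => α w I default) z := by
  simp [delBar, Subsingleton.elim _ (default : Fin 0 → Fin n)]

namespace IsMetricOn

variable {z : Cn n}

/-- The divergence formula for the contracted form. -/
theorem sum_invMet_mul_delStarComp (h : IsMetricOn U u) (hz : z ∈ U) (l : Fin n) :
    (∑ j, invMet (u z) l j * delStarComp u z j) * (detMet (u z) : ℂ) =
      -(Complex.I / 2) * ∑ k, wirtBar k (fun w => invMet (u w) l k * (detMet (u w) : ℂ)) z := by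
  have hdet : ∀ k, wirtBar k (fun w => (detMet (u w) : ℂ)) z = (detMet (u z) : ℂ) *
      ∑ a, ∑ b, invMet (u z) a b * wirtBar k (fun w => u w a b) z := by
    intro k
    rw [wirtBar_congr_on h.isOpen (fun w hw => h.coe_detMet hw) k hz, h.coe_detMet hz]
    simp only [wirtBar, h.fderiv_det hz, Finset.mul_sum, ← Finset.sum_add_distrib]
    exact Finset.sum_congr rfl fun a _ => Finset.sum_congr rfl fun b _ => by ring
  have hd : DifferentiableAt ℝ (fun w => (detMet (u w) : ℂ)) z :=
    (Complex.ofRealCLM.contDiff.comp_contDiffOn h.smooth_detMet).differentiableAt_of_isOpen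
      h.isOpen hz
  have hi : ∀ a b, DifferentiableAt ℝ (fun w => invMet (u w) a b) z := fun a b =>
    (h.smooth_invMet a b).differentiableAt_of_isOpen h.isOpen hz
  have h1 : ∀ k, wirtBar k (fun w => invMet (u w) l k * (detMet (u w) : ℂ)) z =
      (detMet (u z) : ℂ) * ((∑ a, ∑ b, invMet (u z) l k * (invMet (u z) a b *
        wirtBar k (fun w => u w a b) z)) - ∑ c, ∑ d, invMet (u z) l d * (invMet (u z) c k *
          wirtBar k (fun w => u w c d) z)) := by
    intro k
    rw [wirtBar_mul k (hi l k) hd, h.wirtBar_invMet hz, hdet]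
    simp only [dbInv, ← wirtBar_arr_apply (h.differentiableAt hz), Finset.mul_sum,
      Finset.sum_mul, neg_mul, mul_sub]
    rw [neg_add_eq_sub]
    congr 1 <;>
    exact Finset.sum_congr rfl fun a _ => Finset.sum_congr rfl fun b _ => by ring
  -- Only a renaming of indices: the derivative of the inverse metric yields the first term of
  -- `delStarComp`, as the derivative of `det g` yields the second.
  have h2 : ∑ k, ∑ c, ∑ d, invMet (u z) l d * (invMet (u z) c k *
      wirtBar k (fun w => u w c d) z) = ∑ j, ∑ a, ∑ b, invMet (u z) l j * (invMet (u z) a b *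
        wirtBar b (fun w => u w a j) z) := by
    rw [Finset.sum_congr rfl fun k _ => Finset.sum_comm, Finset.sum_comm]
    exact Finset.sum_congr rfl fun d _ => Finset.sum_comm
  have h3 : ∑ j, invMet (u z) l j * delStarComp u z j = (Complex.I / 2) *
      (∑ j, ∑ a, ∑ b, invMet (u z) l j * (invMet (u z) a b * wirtBar b (fun w => u w a j) z) -
        ∑ j, ∑ a, ∑ b, invMet (u z) l j * (invMet (u z) a b * wirtBar j (fun w => u w a b) z)) := by
    simp only [delStarComp, Finset.mul_sum, ← Finset.sum_sub_distrib]
    exact Finset.sum_congr rfl fun j _ => Finset.sum_congr rfl fun a _ =>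
      Finset.sum_congr rfl fun b _ => by ring
  simp only [h1, h3]
  rw [← Finset.mul_sum, Finset.sum_sub_distrib, h2]
  ring

end IsMetricOn


/-- `∂* ω` in coordinates. -/
theorem IsMetricOn.l2Inner_del (h : IsMetricOn U u) {α : PQ n 0 1} (hα : IsTestForm U α) :
    l2Inner U u (kahlerForm u) (del α) = l2Inner U u (form01 (delStarComp u)) α := by
  have hU := h.isOpen
  -- The inner product is conjugate-linear in its second argument, so `∂` acting on `α` becomes `∂̄`
  -- acting on these conjugated components.
  set ψ : Fin n → Cn n → ℂ := fun l w => conj (α w default fun _ => l) with hψd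
  have hψ : ∀ l, ContDiff ℝ ∞ (ψ l) := fun l => Complex.conjCLE.contDiff.comp
    (contDiff_pi.1 (contDiff_pi.1 hα.1 default) fun _ => l)
  have hsub : ∀ l, tsupport (ψ l) ⊆ tsupport α := fun l => closure_mono fun w hw hw' => hw (by
    simp [hψd, hw'])
  have hc : ∀ l, HasCompactSupport (ψ l) := fun l =>
    hα.2.1.of_isClosed_subset (isClosed_tsupport _) (hsub l)
  have hs : ∀ l, tsupport (ψ l) ⊆ U := fun l => (hsub l).trans hα.2.2
  have hdet : ContDiffOn ℝ ∞ (fun w => (detMet (u w) : ℂ)) U :=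
    Complex.ofRealCLM.contDiff.comp_contDiffOn h.smooth_detMet
  have hf : ∀ l k, ContDiffOn ℝ ∞ (fun w => invMet (u w) l k * (detMet (u w) : ℂ)) U :=
    fun l k => (h.smooth_invMet l k).mul hdet
  have hint1 : ∀ l k, IntegrableOn (fun w => invMet (u w) l k * (detMet (u w) : ℂ) *
      wirtBar k (ψ l) w) U := fun l k =>
    (integrable_mul_of_tsupport_subset hU (hf l k) (contDiff_wirtBar (hψ l) k)
      ((hc l).of_isClosed_subset (isClosed_tsupport _) (tsupport_wirtBar_subset _ k))
      ((tsupport_wirtBar_subset _ k).trans (hs l))).integrableOn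
  have hint2 : ∀ l k, IntegrableOn (fun w => wirtBar k
      (fun w => invMet (u w) l k * (detMet (u w) : ℂ)) w * ψ l w) U := fun l k =>
    (integrable_mul_of_tsupport_subset hU (contDiffOn_wirtBar hU (hf l k) k) (hψ l) (hc l)
      (hs l)).integrableOn
  have e1 : l2Inner U u (kahlerForm u) (del α) = ∫ z in U, (Complex.I / 2) * ∑ l, ∑ k,
      invMet (u z) l k * (detMet (u z) : ℂ) * wirtBar k (ψ l) z := by
    refine setIntegral_congr_fun hU.measurableSet fun z hz => ?_
    change formInner (u z) (fun I J => (Complex.I / 2) * u z (I 0) (J 0)) _ * _ = _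
    rw [formInner_kahler (h.det_ne_zero hz), mul_assoc, Finset.sum_mul]
    congr 1
    refine Finset.sum_congr rfl fun l _ => ?_
    rw [Finset.sum_mul]
    refine Finset.sum_congr rfl fun k _ => ?_
    rw [del_01_apply, ← wirtBar_conj]
    ring
  have e2 : l2Inner U u (form01 (delStarComp u)) α = ∫ z in U, -(Complex.I / 2) * ∑ l, ∑ k,
      wirtBar k (fun w => invMet (u w) l k * (detMet (u w) : ℂ)) z * ψ l z := by
    refine setIntegral_congr_fun hU.measurableSet fun z hz => ?_
    change formInner (u z) (fun _ J => delStarComp u z (J 0)) _ * _ = _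
    rw [formInner_01, Finset.sum_mul, Finset.mul_sum]
    refine Finset.sum_congr rfl fun l _ => ?_
    rw [mul_right_comm, h.sum_invMet_mul_delStarComp hz, mul_assoc, Finset.sum_mul]
  rw [e1, e2, integral_const_mul, integral_const_mul,
    integral_finsetSum _ fun l _ => integrable_finsetSum _ fun k _ => hint1 l k,
    integral_finsetSum _ fun l _ => integrable_finsetSum _ fun k _ => hint2 l k, neg_mul,
    ← mul_neg, ← Finset.sum_neg_distrib]
  congr 1
  refine Finset.sum_congr rfl fun l _ => ?_
  rw [integral_finsetSum _ fun k _ => hint1 l k, integral_finsetSum _ fun k _ => hint2 l k,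
    ← Finset.sum_neg_distrib]
  exact Finset.sum_congr rfl fun k _ =>
    integral_mul_wirtBar hU (hf l k) (hψ l) (hc l) (hs l) k

/-- A smooth form is determined by its inner products with test forms. -/
theorem IsMetricOn.eqOn_of_l2Inner_eq (h : IsMetricOn U u) {b b' : Cn n → Fin n → ℂ}
    (hb : ∀ k, ContDiffOn ℝ ∞ (fun w => b w k) U) (hb' : ∀ k, ContDiffOn ℝ ∞ (fun w => b' w k) U)
    (he : ∀ α : PQ n 0 1, IsTestForm U α →
      l2Inner U u (form01 b) α = l2Inner U u (form01 b') α) : Set.EqOn b b' U := by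
  have hU := h.isOpen
  have hdet : ContDiffOn ℝ ∞ (fun w => (detMet (u w) : ℂ)) U :=
    Complex.ofRealCLM.contDiff.comp_contDiffOn h.smooth_detMet
  set H : (Cn n → Fin n → ℂ) → Fin n → Cn n → ℂ := fun c l w =>
    (∑ j, invMet (u w) l j * c w j) * (detMet (u w) : ℂ) with hH
  have hHs : ∀ c : Cn n → Fin n → ℂ, (∀ k, ContDiffOn ℝ ∞ (fun w => c w k) U) → ∀ l,
      ContDiffOn ℝ ∞ (H c l) U := fun c hc l =>
    (ContDiffOn.sum fun j _ => (h.smooth_invMet l j).mul (hc j)).mul hdet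
  have key : ∀ l, Set.EqOn (H b l) (H b' l) U := by
    intro l
    have hsm : ContDiffOn ℝ ∞ (fun w => H b l w - H b' l w) U := (hHs b hb l).sub (hHs b' hb' l)
    -- The fundamental lemma of the calculus of variations. Real test functions `φ` suffice, and the
    -- test form `φ dz̄^l` isolates the component `l`.
    have hae : ∀ᵐ x ∂volume, x ∈ U → H b l x - H b' l x = 0 := by
      refine hU.ae_eq_zero_of_integral_contDiff_smul_eq_zero
        (hsm.continuousOn.locallyIntegrableOn hU.measurableSet) fun φ hφ hφc hφs => ?_
      set ψ : Cn n → ℂ := fun w => (φ w : ℂ) with hψ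
      have hψd : ContDiff ℝ ∞ ψ := Complex.ofRealCLM.contDiff.comp hφ
      have hsup : tsupport ψ ⊆ tsupport φ := closure_mono fun w hw hw' => hw (by simp [hψ, hw'])
      have hψc : HasCompactSupport ψ := hφc.of_isClosed_subset (isClosed_tsupport _) hsup
      set α : PQ n 0 1 := fun w _ J => if J 0 = l then ψ w else 0 with hα
      have hαt : IsTestForm U α := by
        have hsα : tsupport α ⊆ tsupport φ := closure_mono fun w hw hw' => hw (by
          ext I J; simp [hα, hψ, hw'])
        refine ⟨contDiff_pi.2 fun I => contDiff_pi.2 fun J => ?_,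
          hφc.of_isClosed_subset (isClosed_tsupport _) hsα, hsα.trans hφs⟩
        by_cases hJ : J 0 = l
        · simpa [hα, hJ] using hψd
        · simpa [hα, hJ] using contDiff_const
      have hl2 : ∀ c : Cn n → Fin n → ℂ, l2Inner U u (form01 c) α = ∫ z in U, H c l z * ψ z := by
        intro c
        refine setIntegral_congr_fun hU.measurableSet fun z hz => ?_
        change formInner (u z) (fun _ J => c z (J 0)) _ * _ = _
        rw [formInner_01]
        have : ∀ i, conj (α z default fun _ => i) = if i = l then ψ z else 0 := by
          intro i
          simp only [hα, hψ]
          split_ifs <;> simp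
        simp only [this, mul_ite, mul_zero, Finset.sum_ite_eq', Finset.mem_univ, if_true, hH]
        ring
      have hi : ∀ c : Cn n → Fin n → ℂ, (∀ k, ContDiffOn ℝ ∞ (fun w => c w k) U) →
          IntegrableOn (fun z => H c l z * ψ z) U := fun c hc =>
        (integrable_mul_of_tsupport_subset hU (hHs c hc l) hψd hψc
          (hsup.trans hφs)).integrableOn
      have hz : ∀ z ∉ U, φ z • (H b l z - H b' l z) = 0 := fun z hz => by
        rw [image_eq_zero_of_notMem_tsupport fun h => hz (hφs h), zero_smul]
      rw [← setIntegral_eq_integral_of_forall_compl_eq_zero hz]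
      have h1 := he α hαt
      rw [hl2, hl2, ← sub_eq_zero, ← integral_sub (hi b hb) (hi b' hb')] at h1
      rw [← h1]
      refine setIntegral_congr_fun hU.measurableSet fun z hz => ?_
      simp only [Complex.real_smul, hψ]
      ring
    have hae' : H b l =ᵐ[volume.restrict U] H b' l := by
      rw [Filter.EventuallyEq, ae_restrict_iff' hU.measurableSet]
      filter_upwards [hae] with x hx hxU using sub_eq_zero.1 (hx hxU)
    exact Measure.eqOn_open_of_ae_eq hae' hU (hHs b hb l).continuousOn (hHs b' hb' l).continuousOn
  intro z hz
  have hd : (detMet (u z) : ℂ) ≠ 0 := Complex.ofReal_ne_zero.2 (h.posDef z hz).detMet_pos.ne'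
  have hk : ∀ l, ∑ j, invMet (u z) l j * b z j = ∑ j, invMet (u z) l j * b' z j := fun l =>
    mul_right_cancel₀ hd (key l hz)
  -- Only the components with index raised by the inverse metric have been compared; contracting
  -- with `g` lowers it again.
  have hrec : ∀ (c : Cn n → Fin n → ℂ) m, ∑ l, u z l m * ∑ j, invMet (u z) l j * c z j = c z m := by
    intro c m
    calc _ = ∑ j, (∑ l, invMet (u z) l j * u z l m) * c z j := by
          simp only [Finset.mul_sum, Finset.sum_mul]
          rw [Finset.sum_comm]
          exact Finset.sum_congr rfl fun j _ => Finset.sum_congr rfl fun l _ => by ring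
      _ = c z m := by
          simp [sum_invMet_mul_left (h.det_ne_zero hz)]
  ext m
  rw [← hrec b m, ← hrec b' m]
  simp only [hk]

/-! #### Passage to the conjugate forms -/

/-- The conjugate of a form of type `(p,q)`, up to sign. -/
def conjForm {p q : ℕ} (α : PQ n p q) : PQ n q p := fun z I J => conj (α z J I)

theorem IsTestForm.conjForm {p q : ℕ} {α : PQ n p q} (hα : IsTestForm U α) :
    IsTestForm U (conjForm α) := by
  have hs : tsupport (_root_.conjForm α) ⊆ tsupport α := closure_mono fun w hw hw' => hw (by
    ext I J; simp [_root_.conjForm, hw'])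
  exact ⟨contDiff_pi.2 fun I => contDiff_pi.2 fun J => Complex.conjCLE.contDiff.comp
    (contDiff_pi.1 (contDiff_pi.1 hα.1 J) I), hα.2.1.of_isClosed_subset (isClosed_tsupport _) hs,
    hs.trans hα.2.2⟩

theorem conjForm_conjForm {p q : ℕ} (α : PQ n p q) : conjForm (conjForm α) = α := by
  ext z I J; simp [conjForm]

theorem IsMetricOn.l2Inner_form10 (h : IsMetricOn U u) (c : Cn n → Fin n → ℂ) (α : PQ n 1 0) :
    l2Inner U u (form10 c) α =
      conj (l2Inner U u (form01 fun z k => conj (c z k)) (conjForm α)) := by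
  rw [l2Inner, l2Inner, ← integral_conj]
  refine setIntegral_congr_fun h.isOpen.measurableSet fun z hz => ?_
  change formInner (u z) (fun I _ => c z (I 0)) _ * _ =
    conj (formInner (u z) (fun _ J => conj (c z (J 0))) _ * _)
  rw [formInner_10, formInner_01 _ fun k => conj (c z k)]
  simp [conj_invMet (h.isHermitian hz), conjForm]

/-- Two signs cancel: the `-1` in `∂̄` of a `(1,0)`-form, and the one from conjugating the factor
`i/2` of `ω`. -/
theorem IsMetricOn.l2Inner_delBar_eq (h : IsMetricOn U u) (α : PQ n 1 0) :
    l2Inner U u (kahlerForm u) (delBar α) =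
      conj (l2Inner U u (kahlerForm u) (del (conjForm α))) := by
  rw [l2Inner, l2Inner, ← integral_conj]
  refine setIntegral_congr_fun h.isOpen.measurableSet fun z hz => ?_
  change formInner (u z) (fun I J => (Complex.I / 2) * u z (I 0) (J 0)) _ * _ =
    conj (formInner (u z) (fun I J => (Complex.I / 2) * u z (I 0) (J 0)) _ * _)
  rw [formInner_kahler (h.det_ne_zero hz), formInner_kahler (h.det_ne_zero hz)]
  simp only [del_01_apply, delBar_10_apply, conjForm, wirt_conj, map_mul, map_sum, map_div₀,
    Complex.conj_I, map_ofNat, Complex.conj_conj, Complex.conj_ofReal,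
    conj_invMet (h.isHermitian hz), map_neg, mul_neg, Finset.sum_neg_distrib]
  rw [Finset.sum_comm]
  ring

/-- `∂̄* ω` in coordinates. -/
theorem IsMetricOn.l2Inner_delBar (h : IsMetricOn U u) {α : PQ n 1 0} (hα : IsTestForm U α) :
    l2Inner U u (kahlerForm u) (delBar α) = l2Inner U u (form10 (delBarStarComp u)) α := by
  rw [h.l2Inner_delBar_eq, h.l2Inner_del hα.conjForm, h.l2Inner_form10]
  refine congrArg conj (l2Inner_congr h.isOpen (fun z hz => ?_) _)
  ext I J
  simp only [form01, h.delBarStarComp_eq_conj hz, Complex.conj_conj]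

/-- The adjoint property alone forces the local formula, so the forms `β` in the definition of `Φ`
involve no choice. -/
theorem IsMetricOn.eqOn_delStarComp (h : IsMetricOn U u) {b : Cn n → Fin n → ℂ}
    (hb : ∀ k, ContDiffOn ℝ ∞ (fun w => b w k) U)
    (he : ∀ α : PQ n 0 1, IsTestForm U α →
      l2Inner U u (kahlerForm u) (del α) = l2Inner U u (form01 b) α) :
    Set.EqOn b (delStarComp u) U :=
  h.eqOn_of_l2Inner_eq hb h.smooth_delStarComp fun α hα => by
    rw [← he α hα, h.l2Inner_del hα]

theorem IsMetricOn.eqOn_delBarStarComp (h : IsMetricOn U u) {c : Cn n → Fin n → ℂ}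
    (hc : ∀ k, ContDiffOn ℝ ∞ (fun w => c w k) U)
    (he : ∀ α : PQ n 1 0, IsTestForm U α →
      l2Inner U u (kahlerForm u) (delBar α) = l2Inner U u (form10 c) α) :
    Set.EqOn c (delBarStarComp u) U := by
  have h1 := h.eqOn_delStarComp (b := fun z k => conj (c z k)) (fun k => (hc k).conj_smooth)
    fun α hα => by
      have h2 := he _ hα.conjForm
      rw [h.l2Inner_delBar_eq, h.l2Inner_form10, conjForm_conjForm] at h2
      exact (starRingEnd ℂ).injective h2
  intro z hz
  ext k
  rw [h.delBarStarComp_eq_conj hz, ← h1 hz, Complex.conj_conj]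

end Adjoint
/-! ### Holomorphic changes of coordinates -/

section CoordinateChange

open Filter Topology

variable {n : ℕ} {U V : Set (Cn n)} {T : Cn n → Cn n} {z : Cn n}

theorem ContDiffOn.real_smooth {E : Type*} [NormedAddCommGroup E] [NormedSpace ℂ E]
    {f : Cn n → E} (hf : ContDiffOn ℂ ω f U) :
    ContDiffOn ℝ ∞ f U := (hf.restrict_scalars ℝ).of_le le_top

theorem ContDiffOn.holomorphicAt {E : Type*} [NormedAddCommGroup E] [NormedSpace ℂ E]
    {f : Cn n → E} (hf : ContDiffOn ℂ ω f U) (hU : IsOpen U)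
    (hz : z ∈ U) : DifferentiableAt ℂ f z :=
  (hf.contDiffAt (hU.mem_nhds hz)).differentiableAt (by simp)

theorem contDiffOn_holJac (hU : IsOpen U) (hT : ContDiffOn ℂ ω T U) (a j : Fin n) :
    ContDiffOn ℂ ω (fun w => holJac T w a j) U :=
  contDiffOn_pi.1 ((hT.fderiv_of_isOpen hU le_top).clm_apply contDiffOn_const) a

/-- Symmetry of the complex second derivative of `T`. This removes the non-tensorial terms in the
transformation of `∂*ω`. -/
theorem wirt_holJac_comm (hU : IsOpen U) (hT : ContDiffOn ℂ ω T U) (hz : z ∈ U) (a j k : Fin n) :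
    wirt k (fun w => holJac T w a j) z = wirt j (fun w => holJac T w a k) z := by
  have hd : DifferentiableAt ℂ (fderiv ℂ T) z :=
    (hT.fderiv_of_isOpen (m := ω) hU le_top).holomorphicAt hU hz
  have h1 : ∀ i l, wirt l (fun w => holJac T w a i) z =
      fderiv ℂ (fderiv ℂ T) z (Pi.single l 1) (Pi.single i 1) a := by
    intro i l
    rw [wirt_eq_fderiv_of_holomorphic ((contDiffOn_holJac hU hT a i).holomorphicAt hU hz)]
    have h2 : HasFDerivAt (fun w => fderiv ℂ T w (Pi.single i 1))
        ((fderiv ℂ (fderiv ℂ T) z).flip (Pi.single i 1)) z := by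
      simpa using hd.hasFDerivAt.clm_apply (hasFDerivAt_const (Pi.single i 1 : Cn n) z)
    have h3 := (hasFDerivAt_pi'.1 h2 a).fderiv
    simp only [holJac]
    rw [h3]; rfl
  rw [h1, h1]
  exact congrFun ((hT.contDiffAt (hU.mem_nhds hz)).isSymmSndFDerivAt le_top _ _) a

theorem wirtBar_log {r : Cn n → ℝ} (hr : DifferentiableAt ℝ r z) (h0 : r z ≠ 0) (k : Fin n) :
    wirtBar k (fun w => (Real.log (r w) : ℂ)) z =
      (r z : ℂ)⁻¹ * wirtBar k (fun w => (r w : ℂ)) z := by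
  have h1 : fderiv ℝ (fun w => (Real.log (r w) : ℂ)) z =
      Complex.ofRealCLM.comp ((r z)⁻¹ • fderiv ℝ r z) :=
    (Complex.ofRealCLM.hasFDerivAt.comp z (hr.hasFDerivAt.log h0)).fderiv
  have h2 : fderiv ℝ (fun w => (r w : ℂ)) z = Complex.ofRealCLM.comp (fderiv ℝ r z) :=
    (Complex.ofRealCLM.hasFDerivAt.comp z hr.hasFDerivAt).fderiv
  simp only [wirtBar, h1, h2, ContinuousLinearMap.comp_apply, _root_.smul_apply, smul_eq_mul,
    Complex.ofRealCLM_apply, Complex.ofReal_mul, Complex.ofReal_inv]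
  ring

theorem smooth_log_normSq {f : Cn n → ℂ} (hf : ContDiffOn ℂ ω f U) (h0 : ∀ w ∈ U, f w ≠ 0) :
    ContDiffOn ℝ ∞ (fun w => (Real.log (Complex.normSq (f w)) : ℂ)) U := by
  have h1 : ContDiffOn ℝ ∞ (fun w => (f w * conj (f w)).re) U :=
    Complex.reCLM.contDiff.comp_contDiffOn (hf.real_smooth.mul hf.real_smooth.conj_smooth)
  refine Complex.ofRealCLM.contDiff.comp_contDiffOn (ContDiffOn.log ?_ fun w hw =>
    (Complex.normSq_pos.2 (h0 w hw)).ne')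
  refine h1.congr fun w _ => ?_
  rw [Complex.mul_conj, Complex.ofReal_re]

/-- The function `log |f|²` is pluriharmonic if `f` is holomorphic without zeros. -/
theorem wirt_wirtBar_log_normSq (hU : IsOpen U) {f : Cn n → ℂ} (hf : ContDiffOn ℂ ω f U)
    (h0 : ∀ w ∈ U, f w ≠ 0) (hz : z ∈ U) (j k : Fin n) :
    wirt j (wirtBar k fun w => (Real.log (Complex.normSq (f w)) : ℂ)) z = 0 := by
  have hfr := hf.real_smooth
  -- From `|f|² = f conj(f)` one gets `∂_k̄ log |f|² = conj (∂_k f / f)`, which is antiholomorphic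
  -- and so killed by `∂_j`.
  have h1 : Set.EqOn (wirtBar k fun w => (Real.log (Complex.normSq (f w)) : ℂ))
      (fun w => conj (fderiv ℂ f w (Pi.single k 1) / f w)) U := by
    intro w hw
    have hd := hfr.differentiableAt_of_isOpen hU hw
    have hdc := hfr.conj_smooth.differentiableAt_of_isOpen hU hw
    have hn : DifferentiableAt ℝ (fun w => Complex.normSq (f w)) w := by
      have h2 : ContDiffOn ℝ ∞ (fun w => (f w * conj (f w)).re) U :=
        Complex.reCLM.contDiff.comp_contDiffOn (hfr.mul hfr.conj_smooth)
      simpa only [Complex.mul_conj, Complex.ofReal_re] using h2.differentiableAt_of_isOpen hU hw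
    rw [wirtBar_log hn (Complex.normSq_pos.2 (h0 w hw)).ne']
    simp only [← Complex.mul_conj]
    rw [wirtBar_mul k hd hdc, wirtBar_eq_zero_of_holomorphic (hf.holomorphicAt hU hw),
      wirtBar_conj, wirt_eq_fderiv_of_holomorphic (hf.holomorphicAt hU hw), map_div₀]
    have := h0 w hw
    have h3 : conj (f w) ≠ 0 := by simpa using this
    field_simp
    ring
  rw [wirt_congr_on hU h1 j hz, wirt_conj, wirtBar_eq_zero_of_holomorphic, map_zero]
  simp only [div_eq_mul_inv]
  refine DifferentiableAt.fun_mul ?_ ((hf.holomorphicAt hU hz).fun_inv (h0 z hz))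
  exact (ContDiffOn.clm_apply (hf.fderiv_of_isOpen (m := ω) hU le_top)
    contDiffOn_const).holomorphicAt hU hz

/-- Derivative of the pull-back of a `(0,1)`-form. -/
theorem wirt_pullback01 (hU : IsOpen U) (hV : IsOpen V) (hT : ContDiffOn ℂ ω T U)
    (hm : Set.MapsTo T U V) {F : Fin n → Cn n → ℂ} (hF : ∀ d, ContDiffOn ℝ ∞ (F d) V)
    (hz : z ∈ U) (j k : Fin n) :
    wirt j (fun w => ∑ d, conj (holJac T w d k) * F d (T w)) z =
      ∑ a, ∑ d, holJac T z a j * conj (holJac T z d k) * wirt a (F d) (T z) := by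
  have hJ : ∀ d, DifferentiableAt ℝ (fun w => conj (holJac T w d k)) z := fun d =>
    (contDiffOn_holJac hU hT d k).real_smooth.conj_smooth.differentiableAt_of_isOpen hU hz
  have hFT : ∀ d, DifferentiableAt ℝ (fun w => F d (T w)) z := fun d =>
    ((hF d).comp hT.real_smooth hm).differentiableAt_of_isOpen hU hz
  rw [wirt_sum _ _ _ fun d _ => (hJ d).fun_mul (hFT d), Finset.sum_comm]
  refine Finset.sum_congr rfl fun d _ => ?_
  -- The conjugated Jacobian is antiholomorphic, so `∂_j` does not differentiate it and no second
  -- derivative of `T` appears.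
  rw [wirt_mul j (hJ d) (hFT d), wirt_conj, wirtBar_eq_zero_of_holomorphic
    ((contDiffOn_holJac hU hT d k).holomorphicAt hU hz), wirt_comp_holomorphic
    (hT.holomorphicAt hU hz) ((hF d).differentiableAt_of_isOpen hV (hm hz)), Finset.mul_sum]
  simp only [map_zero, zero_mul, zero_add]
  exact Finset.sum_congr rfl fun a _ => by ring

/-- The metrics `u'` on `U` and `u` on `V` are related by the holomorphic map `T`. -/
structure IsMetricPullback (U V : Set (Cn n)) (T : Cn n → Cn n) (u' u : Cn n → Arr n) : Prop where
  left : IsMetricOn U u'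
  right : IsMetricOn V u
  smooth : ContDiffOn ℂ ω T U
  mapsTo : Set.MapsTo T U V
  apply_eq : ∀ z ∈ U, ∀ j k, u' z j k =
    ∑ a, ∑ b, holJac T z a j * conj (holJac T z b k) * u (T z) a b

/-! ### Transformation laws of the local expressions -/

namespace IsMetricPullback

variable {u u' : Cn n → Arr n}

theorem eq_mul (h : IsMetricPullback U V T u' u) (hz : z ∈ U) :
    Matrix.of (u' z) = (Matrix.of (holJac T z)).transpose * Matrix.of (u (T z)) *
      (Matrix.of (holJac T z)).map conj := by
  ext j k
  simp only [Matrix.of_apply, h.apply_eq z hz, Matrix.mul_apply, Matrix.transpose_apply,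
    Matrix.map_apply, Finset.sum_mul]
  rw [Finset.sum_comm]
  exact Finset.sum_congr rfl fun a _ => Finset.sum_congr rfl fun b _ => by ring

theorem det_eq (h : IsMetricPullback U V T u' u) (hz : z ∈ U) :
    (Matrix.of (u' z)).det = (Complex.normSq (Matrix.of (holJac T z)).det : ℂ) *
      (Matrix.of (u (T z))).det := by
  have h1 : ((Matrix.of (holJac T z)).map conj).det = conj (Matrix.of (holJac T z)).det :=
    ((starRingEnd ℂ).map_det (Matrix.of (holJac T z))).symm
  rw [h.eq_mul hz, Matrix.det_mul, Matrix.det_mul, Matrix.det_transpose, h1, ← Complex.mul_conj]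
  ring

/-- Invertibility of the Jacobian is not part of the structure: it follows because the pulled-back
metric is nondegenerate. -/
theorem det_holJac_ne_zero (h : IsMetricPullback U V T u' u) (hz : z ∈ U) :
    (Matrix.of (holJac T z)).det ≠ 0 := by
  intro h0
  apply h.left.det_ne_zero hz
  rw [h.det_eq hz, h0]; simp

/-- With Jacobian matrix `A`, inverting `g' = Aᵀ g Ā` gives `g⁻¹ = Ā g'⁻¹ Aᵀ`. -/
theorem sum_invMet (h : IsMetricPullback U V T u' u) (hz : z ∈ U) (c e : Fin n) :
    ∑ a, ∑ b, invMet (u' z) a b * (holJac T z c a * conj (holJac T z e b)) =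
      invMet (u (T z)) c e := by
  set A := Matrix.of (holJac T z) with hA
  set C := A.map conj with hC
  have h1 : C.det ≠ 0 := by
    have : C.det = conj A.det := ((starRingEnd ℂ).map_det A).symm
    rw [this]
    simpa using h.det_holJac_ne_zero hz
  have h2 : (Matrix.of (u (T z)))⁻¹ = C * (Matrix.of (u' z))⁻¹ * A.transpose := by
    refine Matrix.inv_eq_left_inv ?_
    have h3 : (Matrix.of (u' z))⁻¹ * Matrix.of (u' z) = 1 :=
      Matrix.nonsing_inv_mul _ (isUnit_iff_ne_zero.2 (h.left.det_ne_zero hz))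
    have h4 : C * C⁻¹ = 1 := Matrix.mul_nonsing_inv _ (isUnit_iff_ne_zero.2 h1)
    calc C * (Matrix.of (u' z))⁻¹ * A.transpose * Matrix.of (u (T z))
        = C * ((Matrix.of (u' z))⁻¹ * (A.transpose * Matrix.of (u (T z)) * C)) * C⁻¹ := by
          simp only [Matrix.mul_assoc, h4, Matrix.mul_one]
      _ = 1 := by rw [← h.eq_mul hz, h3, Matrix.mul_one, h4]
  simp only [invMet]
  rw [h2, Matrix.mul_apply]
  refine Finset.sum_congr rfl fun a _ => ?_
  rw [Matrix.mul_apply, Finset.sum_mul]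
  refine Finset.sum_congr rfl fun b _ => ?_
  simp only [hC, hA, Matrix.map_apply, Matrix.of_apply, Matrix.transpose_apply]
  ring

/-- The first sum is the failure to be tensorial. It arises from the conjugated Jacobian only, since
the other one is holomorphic. -/
theorem wirtBar_apply (h : IsMetricPullback U V T u' u) (hz : z ∈ U) (a b k : Fin n) :
    wirtBar b (fun w => u' w a k) z =
      ∑ c, ∑ d, holJac T z c a * conj (wirt b (fun w => holJac T w d k) z) * u (T z) c d +
      ∑ c, ∑ d, ∑ e, holJac T z c a * (conj (holJac T z e b) * conj (holJac T z d k)) *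
        wirtBar e (fun w => u w c d) (T z) := by
  have hU := h.left.isOpen
  have hJ : ∀ c i, ContDiffOn ℂ ω (fun w => holJac T w c i) U := contDiffOn_holJac hU h.smooth
  have d1 : ∀ c i, DifferentiableAt ℝ (fun w => holJac T w c i) z := fun c i =>
    (hJ c i).real_smooth.differentiableAt_of_isOpen hU hz
  have d2 : ∀ c i, DifferentiableAt ℝ (fun w => conj (holJac T w c i)) z := fun c i =>
    (hJ c i).real_smooth.conj_smooth.differentiableAt_of_isOpen hU hz
  have d3 : ∀ c d, DifferentiableAt ℝ (fun w => u (T w) c d) z := fun c d =>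
    ((h.right.smooth.arr_apply c d).comp h.smooth.real_smooth
      h.mapsTo).differentiableAt_of_isOpen hU hz
  have d4 : ∀ c d, DifferentiableAt ℝ
      (fun w => holJac T w c a * conj (holJac T w d k) * u (T w) c d) z := fun c d =>
    ((d1 c a).fun_mul (d2 d k)).fun_mul (d3 c d)
  rw [wirtBar_congr_on hU (fun w hw => h.apply_eq w hw a k) b hz,
    wirtBar_sum _ _ _ fun c _ => DifferentiableAt.fun_sum fun d _ => d4 c d,
    ← Finset.sum_add_distrib]
  refine Finset.sum_congr rfl fun c _ => ?_
  rw [wirtBar_sum _ _ _ fun d _ => d4 c d, ← Finset.sum_add_distrib]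
  refine Finset.sum_congr rfl fun d _ => ?_
  rw [wirtBar_mul b ((d1 c a).fun_mul (d2 d k)) (d3 c d), wirtBar_mul b (d1 c a) (d2 d k),
    wirtBar_eq_zero_of_holomorphic ((hJ c a).holomorphicAt hU hz), wirtBar_conj,
    wirtBar_comp_holomorphic (f := fun w => u w c d) (h.smooth.holomorphicAt hU hz)
      ((h.right.smooth.arr_apply c d).differentiableAt_of_isOpen h.right.isOpen (h.mapsTo hz)),
    zero_mul, zero_add, Finset.mul_sum]
  congr 1
  exact Finset.sum_congr rfl fun e _ => by ring

/-- The terms with second derivatives of `T` are symmetric in `b` and `k`, so they drop out of the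
difference (`h1`). The remaining Jacobians are absorbed by the inverse metric (`h2`). -/
theorem delStarComp_eq (h : IsMetricPullback U V T u' u) (hz : z ∈ U) (k : Fin n) :
    delStarComp u' z k = ∑ d, conj (holJac T z d k) * delStarComp u (T z) d := by
  have h1 : ∀ a b, wirtBar b (fun w => u' w a k) z - wirtBar k (fun w => u' w a b) z =
      ∑ c, ∑ e, (holJac T z c a * conj (holJac T z e b)) * ∑ d, conj (holJac T z d k) *
        (wirtBar e (fun w => u w c d) (T z) - wirtBar d (fun w => u w c e) (T z)) := by
    intro a b
    rw [h.wirtBar_apply hz, h.wirtBar_apply hz]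
    simp only [wirt_holJac_comm h.left.isOpen h.smooth hz _ k b]
    rw [add_sub_add_left_eq_sub, ← Finset.sum_sub_distrib]
    refine Finset.sum_congr rfl fun c _ => ?_
    rw [Finset.sum_comm, ← Finset.sum_sub_distrib]
    refine Finset.sum_congr rfl fun e _ => ?_
    rw [Finset.mul_sum, ← Finset.sum_sub_distrib]
    exact Finset.sum_congr rfl fun d _ => by ring
  have h2 : ∀ X : Fin n → Fin n → ℂ, ∑ a, ∑ b, invMet (u' z) a b *
      ∑ c, ∑ e, (holJac T z c a * conj (holJac T z e b)) * X c e =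
        ∑ c, ∑ e, invMet (u (T z)) c e * X c e := by
    intro X
    simp only [← h.sum_invMet hz, Finset.mul_sum, Finset.sum_mul]
    rw [Finset.sum_congr rfl fun a _ => Finset.sum_comm.trans
      (Finset.sum_congr rfl fun c _ => Finset.sum_comm), Finset.sum_comm]
    refine Finset.sum_congr rfl fun c _ => Finset.sum_comm.trans ?_
    exact Finset.sum_congr rfl fun e _ => Finset.sum_congr rfl fun a _ =>
      Finset.sum_congr rfl fun b _ => by ring
  simp only [delStarComp, h1, h2]
  simp only [Finset.mul_sum]
  rw [Finset.sum_congr rfl fun c _ => Finset.sum_comm, Finset.sum_comm]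
  exact Finset.sum_congr rfl fun d _ => Finset.sum_congr rfl fun c _ =>
    Finset.sum_congr rfl fun e _ => by ring

theorem wirt_delStarComp (h : IsMetricPullback U V T u' u) (hz : z ∈ U) (j k : Fin n) :
    wirt j (fun w => delStarComp u' w k) z = ∑ a, ∑ d, holJac T z a j * conj (holJac T z d k) *
      wirt a (fun w => delStarComp u w d) (T z) := by
  rw [wirt_congr_on h.left.isOpen (fun w hw => h.delStarComp_eq hw k) j hz]
  exact wirt_pullback01 h.left.isOpen h.right.isOpen h.smooth h.mapsTo
    (fun d => h.right.smooth_delStarComp d) hz j k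

theorem _root_.IsMetricOn.wirtBar_delBarStarComp (h : IsMetricOn U u) (hz : z ∈ U) (k j : Fin n) :
    wirtBar k (fun w => delBarStarComp u w j) z = conj (wirt k (fun w => delStarComp u w j) z) := by
  rw [← wirtBar_conj]
  exact wirtBar_congr_on h.isOpen (fun w hw => h.delBarStarComp_eq_conj hw j) k hz

theorem wirtBar_delBarStarComp (h : IsMetricPullback U V T u' u) (hz : z ∈ U) (j k : Fin n) :
    wirtBar k (fun w => delBarStarComp u' w j) z =
      ∑ a, ∑ d, holJac T z a j * conj (holJac T z d k) *
        wirtBar d (fun w => delBarStarComp u w a) (T z) := by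
  rw [h.left.wirtBar_delBarStarComp hz, h.wirt_delStarComp hz, Finset.sum_comm]
  simp only [map_sum, map_mul, Complex.conj_conj, h.right.wirtBar_delBarStarComp (h.mapsTo hz)]
  exact Finset.sum_congr rfl fun a _ => Finset.sum_congr rfl fun d _ => by ring

/-- `log det g' = log |det T'|² + (log det g) ∘ T`, where the first summand is pluriharmonic and the
second has a tensorial complex Hessian. -/
theorem wirt_wirtBar_logDet (h : IsMetricPullback U V T u' u) (hz : z ∈ U) (j k : Fin n) :
    wirt j (wirtBar k (fun w => (Real.log (detMet (u' w)) : ℂ))) z =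
      ∑ a, ∑ d, holJac T z a j * conj (holJac T z d k) *
        wirt a (wirtBar d (fun w => (Real.log (detMet (u w)) : ℂ))) (T z) := by
  have hU := h.left.isOpen
  have hJ : ContDiffOn ℂ ω (fun w => (Matrix.of (holJac T w)).det) U := by
    simp only [Matrix.det_apply]
    refine ContDiffOn.sum fun σ _ => ContDiffOn.const_smul _ (contDiffOn_prod fun i _ => ?_)
    exact contDiffOn_holJac hU h.smooth _ _
  have h0 : ∀ w ∈ U, (Matrix.of (holJac T w)).det ≠ 0 := fun w hw => h.det_holJac_ne_zero hw
  have hT : ContDiffOn ℝ ∞ (fun w => (Real.log (detMet (u (T w))) : ℂ)) U :=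
    h.right.smooth_logDet.comp h.smooth.real_smooth h.mapsTo
  have e1 : Set.EqOn (fun w => (Real.log (detMet (u' w)) : ℂ)) (fun w =>
      (Real.log (Complex.normSq (Matrix.of (holJac T w)).det) : ℂ) +
        (Real.log (detMet (u (T w))) : ℂ)) U := by
    intro w hw
    have h1 : detMet (u' w) = Complex.normSq (Matrix.of (holJac T w)).det * detMet (u (T w)) := by
      simp only [detMet]
      rw [h.det_eq hw, Complex.re_ofReal_mul]
    simp only [h1]
    rw [Real.log_mul (Complex.normSq_pos.2 (h0 w hw)).ne'
      (h.right.posDef _ (h.mapsTo hw)).detMet_pos.ne', Complex.ofReal_add]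
  have e2 : Set.EqOn (wirtBar k (fun w => (Real.log (detMet (u' w)) : ℂ))) (fun w =>
      wirtBar k (fun w => (Real.log (Complex.normSq (Matrix.of (holJac T w)).det) : ℂ)) w +
        ∑ d, conj (holJac T w d k) *
          wirtBar d (fun w => (Real.log (detMet (u w)) : ℂ)) (T w)) U := by
    intro w hw
    rw [wirtBar_congr_on hU e1 k hw, wirtBar_add k
      ((smooth_log_normSq hJ h0).differentiableAt_of_isOpen hU hw)
      (hT.differentiableAt_of_isOpen hU hw), wirtBar_comp_holomorphic
      (f := fun w => (Real.log (detMet (u w)) : ℂ)) (h.smooth.holomorphicAt hU hw)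
      (h.right.smooth_logDet.differentiableAt_of_isOpen h.right.isOpen (h.mapsTo hw))]
  have hFd : ∀ d, ContDiffOn ℝ ∞ (wirtBar d (fun w => (Real.log (detMet (u w)) : ℂ))) V :=
    contDiffOn_wirtBar h.right.isOpen h.right.smooth_logDet
  have hs : ContDiffOn ℝ ∞ (fun w => ∑ d, conj (holJac T w d k) *
      wirtBar d (fun w => (Real.log (detMet (u w)) : ℂ)) (T w)) U :=
    ContDiffOn.sum fun d _ => (contDiffOn_holJac hU h.smooth d k).real_smooth.conj_smooth.mul
      ((hFd d).comp h.smooth.real_smooth h.mapsTo)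
  rw [wirt_congr_on hU e2 j hz, wirt_add j
    ((contDiffOn_wirtBar hU (smooth_log_normSq hJ h0) k).differentiableAt_of_isOpen hU hz)
    (hs.differentiableAt_of_isOpen hU hz), wirt_wirtBar_log_normSq hU hJ h0 hz, zero_add]
  exact wirt_pullback01 hU h.right.isOpen h.smooth h.mapsTo hFd hz j k

/-- `Φ(ω)` is compatible with holomorphic changes of coordinates. -/
theorem phiComp_eq (h : IsMetricPullback U V T u' u) (hz : z ∈ U) (j k : Fin n) :
    phiComp u' z j k = ∑ a, ∑ d, holJac T z a j * conj (holJac T z d k) *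
      phiComp u (T z) a d := by
  simp only [phiComp, h.wirt_delStarComp hz, h.wirtBar_delBarStarComp hz,
    h.wirt_wirtBar_logDet hz, Finset.mul_sum, ← Finset.sum_sub_distrib]
  exact Finset.sum_congr rfl fun a _ => Finset.sum_congr rfl fun d _ => by ring

end IsMetricPullback

end CoordinateChange
/-! ### Charts and tangent vectors -/

section Overlap

variable {n : ℕ} {M : Type*} [TopologicalSpace M] {e e' : OpenPartialHomeomorph M (Cn n)}

/-- The coordinate change from the chart `e'` to the chart `e`. -/
def transition (e' e : OpenPartialHomeomorph M (Cn n)) : Cn n → Cn n := e ∘ e'.symm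

/-- The domain of the coordinate change. -/
def overlap (e' e : OpenPartialHomeomorph M (Cn n)) : Set (Cn n) :=
  e'.target ∩ e'.symm ⁻¹' e.source

theorem isOpen_overlap (e' e : OpenPartialHomeomorph M (Cn n)) : IsOpen (overlap e' e) :=
  e'.symm.isOpen_inter_preimage e.open_source

theorem symm_transition {z : Cn n} (hz : z ∈ overlap e' e) :
    e.symm (transition e' e z) = e'.symm z := e.left_inv hz.2

theorem mapsTo_transition : Set.MapsTo (transition e' e) (overlap e' e) e.target :=
  fun _ hz => e.map_source hz.2

end Overlap

section Charts

open Filter Topology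

variable {n : ℕ} {M : Type*} [TopologicalSpace M] [ChartedSpace (Cn n) M]
  {e e' : OpenPartialHomeomorph M (Cn n)}

theorem mdifferentiable_of_mem_holCharts (he : e ∈ holCharts n M) :
    e.MDifferentiable 𝓘(ℂ, Cn n) 𝓘(ℂ, Cn n) :=
  ⟨(contMDiffOn_of_mem_maximalAtlas he).mdifferentiableOn (by simp),
    (contMDiffOn_symm_of_mem_maximalAtlas he).mdifferentiableOn (by simp)⟩

theorem chartAt_mem_holCharts [IsManifold 𝓘(ℂ, Cn n) ω M] (x : M) :
    chartAt (Cn n) x ∈ holCharts n M :=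
  IsManifold.chart_mem_maximalAtlas x

theorem contDiffOn_transition (he' : e' ∈ holCharts n M) (he : e ∈ holCharts n M) :
    ContDiffOn ℂ ω (transition e' e) (overlap e' e) := by
  rw [← contMDiffOn_iff_contDiffOn]
  exact (contMDiffOn_of_mem_maximalAtlas he).comp
    ((contMDiffOn_symm_of_mem_maximalAtlas he').mono Set.inter_subset_left) fun _ hz => hz.2

/-- The components of a tangent vector in the chart `e`. -/
def vecCoord (e : OpenPartialHomeomorph M (Cn n)) (x : M) : Tan n M x →L[ℂ] Cn n :=
  mfderiv 𝓘(ℂ, Cn n) 𝓘(ℂ, Cn n) e x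

/-- The map `coordVec` as a linear map. -/
def coordMap (e : OpenPartialHomeomorph M (Cn n)) (z : Cn n) : Cn n →L[ℂ] Tan n M (e.symm z) :=
  mfderiv 𝓘(ℂ, Cn n) 𝓘(ℂ, Cn n) e.symm z

theorem coordMap_apply (e : OpenPartialHomeomorph M (Cn n)) (z a : Cn n) :
    coordMap e z a = coordVec e z a := rfl

theorem vecCoord_coordVec (he' : e' ∈ holCharts n M) (he : e ∈ holCharts n M) {z : Cn n}
    (hz : z ∈ overlap e' e) (a : Cn n) :
    vecCoord e (e'.symm z) (coordVec e' z a) = fderiv ℂ (transition e' e) z a := by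
  have h := mfderiv_comp_apply z ((mdifferentiable_of_mem_holCharts he).mdifferentiableAt hz.2)
    ((mdifferentiable_of_mem_holCharts he').mdifferentiableAt_symm hz.1) a
  rw [mfderiv_eq_fderiv] at h
  exact h.symm

theorem coordVec_vecCoord (he : e ∈ holCharts n M) {x : M} (hx : x ∈ e.source)
    (v : Tan n M x) : (coordVec e (e x) (vecCoord e x v) : Cn n) = (v : Cn n) := by
  have h := (mdifferentiable_of_mem_holCharts he).symm_comp_deriv hx
  exact congrArg (fun L => (L : Cn n →L[ℂ] Cn n) v) h

theorem vecCoord_coordVec_self (he : e ∈ holCharts n M) {z : Cn n} (hz : z ∈ e.target)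
    (a : Cn n) : vecCoord e (e.symm z) (coordVec e z a) = a := by
  have h := (mdifferentiable_of_mem_holCharts he).comp_symm_deriv hz
  exact congrArg (fun L => (L : Cn n →L[ℂ] Cn n) a) h

/-- The two sides are tangent at base points that agree only propositionally. They are compared in
`Cn n`, to which every tangent space unfolds. -/
theorem coordVec_transition (he' : e' ∈ holCharts n M) (he : e ∈ holCharts n M) {z : Cn n}
    (hz : z ∈ overlap e' e) (a : Cn n) : (coordVec e' z a : Cn n) =
      (coordVec e (transition e' e z) (fderiv ℂ (transition e' e) z a) : Cn n) := by
  rw [← vecCoord_coordVec he' he hz]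
  exact (coordVec_vecCoord he hz.2 (coordVec e' z a)).symm

theorem congr_tan {β : Type*} (Q : ∀ x : M, Tan n M x → Tan n M x → β) {x y : M} (h : x = y)
    (u v : Cn n) : Q x u v = Q y u v := by subst h; rfl

/-- Changes charts in any expression in two tangent vectors; equality of base points is handled once
here, through `congr_tan`. -/
theorem transition_congr_tan {β : Type*} (Q : ∀ x : M, Tan n M x → Tan n M x → β)
    (he' : e' ∈ holCharts n M) (he : e ∈ holCharts n M) {z : Cn n} (hz : z ∈ overlap e' e)
    (s t : Cn n) : Q (e'.symm z) (coordVec e' z s) (coordVec e' z t) =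
      Q (e.symm (transition e' e z))
        (coordVec e (transition e' e z) (fderiv ℂ (transition e' e) z s))
        (coordVec e (transition e' e z) (fderiv ℂ (transition e' e) z t)) := by
  refine Eq.trans ?_ (congr_tan Q (symm_transition hz) _ _).symm
  exact congrArg₂ (Q (e'.symm z)) (coordVec_transition he' he hz s)
    (coordVec_transition he' he hz t)

theorem coordVec_eq_sum (e : OpenPartialHomeomorph M (Cn n)) (z s : Cn n) :
    coordVec e z s = ∑ j, s j • coordVec e z (Pi.single j 1) := by
  have h : s = ∑ j, s j • (Pi.single j 1 : Cn n) := by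
    ext i
    simp [Finset.sum_apply, Pi.single_apply]
  conv_lhs => rw [← coordMap_apply, h, map_sum]
  simp only [map_smul, coordMap_apply]

theorem fderiv_transition_apply (T : Cn n → Cn n) (z s : Cn n) (a : Fin n) :
    fderiv ℂ T z s a = ∑ j, holJac T z a j * s j := by
  have h : s = ∑ j, s j • (Pi.single j 1 : Cn n) := by
    ext i
    simp [Finset.sum_apply, Pi.single_apply]
  conv_lhs => rw [h, map_sum]
  simp only [map_smul, Finset.sum_apply, Pi.smul_apply, smul_eq_mul, holJac]
  exact Finset.sum_congr rfl fun j _ => mul_comm _ _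

/-! #### The sesquilinear form of a `J`-invariant real bilinear form -/

section Sesq

variable {V : Type*} [AddCommGroup V] [Module ℂ V]

theorem map_I_smul_left (B : V →ₗ[ℝ] V →ₗ[ℝ] ℝ)
    (hB : ∀ u v, B (Complex.I • u) (Complex.I • v) = B u v) (u v : V) :
    B (Complex.I • u) v = -B u (Complex.I • v) := by
  rw [← hB u (Complex.I • v), smul_smul, Complex.I_mul_I, neg_one_smul, map_neg, neg_neg]

theorem complex_smul_eq (c : ℂ) (v : V) : c • v = c.re • v + c.im • (Complex.I • v) := by
  conv_lhs => rw [← Complex.re_add_im c, add_smul, mul_smul]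
  rfl

/-- The form `B(u, v) + i B(u, iv)`. -/
def sesqOf (B : V →ₗ[ℝ] V →ₗ[ℝ] ℝ)
    (hB : ∀ u v, B (Complex.I • u) (Complex.I • v) = B u v) : V →ₗ[ℂ] V →ₗ⋆[ℂ] ℂ :=
  LinearMap.mk₂'ₛₗ (RingHom.id ℂ) (starRingEnd ℂ)
    (fun u v => (B u v : ℂ) + Complex.I * (B u (Complex.I • v) : ℂ))
    (fun u u' v => by simp only [map_add, LinearMap.add_apply]; push_cast; ring)
    (fun c u v => by
      simp only [complex_smul_eq c u, map_add, map_smul, LinearMap.add_apply, LinearMap.smul_apply,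
        map_I_smul_left B hB, smul_smul, Complex.I_mul_I, neg_one_smul, map_neg, neg_neg,
        smul_eq_mul, RingHom.id_apply]
      conv_rhs => rw [← Complex.re_add_im c]
      push_cast
      linear_combination (-(c.im : ℂ) * (B u (Complex.I • v) : ℂ)) * Complex.I_mul_I)
    (fun u v v' => by simp only [map_add, smul_add]; push_cast; ring)
    (fun c u v => by
      have h : Complex.I • c.im • Complex.I • v = -(c.im • v) := by
        rw [smul_comm Complex.I c.im, smul_smul, Complex.I_mul_I, neg_one_smul, smul_neg]
      have h' : conj c = c.re - c.im * Complex.I := by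
        apply Complex.ext <;> simp
      simp only [complex_smul_eq c v, map_add, map_smul, smul_add, h, map_neg, smul_eq_mul, h',
        smul_comm Complex.I c.re v]
      push_cast
      linear_combination ((c.im : ℂ) * (B u (Complex.I • v) : ℂ)) * Complex.I_mul_I)

theorem sesqOf_apply (B : V →ₗ[ℝ] V →ₗ[ℝ] ℝ)
    (hB : ∀ u v, B (Complex.I • u) (Complex.I • v) = B u v) (u v : V) :
    sesqOf B hB u v = (B u v : ℂ) + Complex.I * (B u (Complex.I • v) : ℂ) := rfl

theorem sesqOf_re (B : V →ₗ[ℝ] V →ₗ[ℝ] ℝ)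
    (hB : ∀ u v, B (Complex.I • u) (Complex.I • v) = B u v) (u v : V) :
    (sesqOf B hB u v).re = B u v := by
  simp [sesqOf_apply]

end Sesq

/-- The sesquilinear form given by an array. -/
def arrSesq (A : Arr n) (s t : Cn n) : ℂ := ∑ a, ∑ b, A a b * s a * conj (t b)

theorem arrSesq_single (A : Arr n) (j k : Fin n) :
    arrSesq A (Pi.single j 1) (Pi.single k 1) = A j k := by
  simp only [arrSesq, Pi.single_apply, apply_ite conj, map_one, map_zero, mul_ite, mul_one,
    mul_zero, Finset.sum_ite_eq', Finset.mem_univ, if_true]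

theorem sesq_coordVec (e : OpenPartialHomeomorph M (Cn n)) (z s t : Cn n)
    (S : Tan n M (e.symm z) →ₗ[ℂ] Tan n M (e.symm z) →ₗ⋆[ℂ] ℂ) :
    S (coordVec e z s) (coordVec e z t) =
      arrSesq (fun j k => S (coordVec e z (Pi.single j 1)) (coordVec e z (Pi.single k 1))) s t := by
  rw [coordVec_eq_sum e z s, map_sum, LinearMap.sum_apply]
  refine Finset.sum_congr rfl fun j _ => ?_
  rw [coordVec_eq_sum e z t, map_smul, LinearMap.smul_apply, map_sum, Finset.smul_sum]
  refine Finset.sum_congr rfl fun k _ => ?_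
  rw [LinearMap.map_smulₛₗ, smul_eq_mul, smul_eq_mul]
  ring

theorem arrSesq_fderiv (T : Cn n → Cn n) (z s t : Cn n) (A : Arr n) :
    arrSesq A (fderiv ℂ T z s) (fderiv ℂ T z t) =
      arrSesq (fun j k => ∑ a, ∑ b, holJac T z a j * conj (holJac T z b k) * A a b) s t := by
  simp only [arrSesq, fderiv_transition_apply, map_sum, map_mul, Finset.mul_sum, Finset.sum_mul]
  rw [Finset.sum_congr rfl fun a _ => Finset.sum_congr rfl fun b _ => Finset.sum_comm]
  rw [Finset.sum_congr rfl fun a _ => Finset.sum_comm, Finset.sum_comm]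
  refine Finset.sum_congr rfl fun j _ => ?_
  rw [Finset.sum_congr rfl fun a _ => Finset.sum_comm, Finset.sum_comm]
  exact Finset.sum_congr rfl fun k _ => Finset.sum_congr rfl fun a _ =>
    Finset.sum_congr rfl fun b _ => by ring

end Charts
/-! ### The operator `Φ` on a complex manifold -/

section ManifoldOperator

open Filter Topology

variable {n : ℕ} {M : Type*} [TopologicalSpace M] [ChartedSpace (Cn n) M]
  {e e' : OpenPartialHomeomorph M (Cn n)} {z : Cn n}

/-- The sesquilinear form on tangent vectors given by a real `(1,1)`-form. -/
def RealForm11.sesq (η : RealForm11 n M) (x : M) : Tan n M x →ₗ[ℂ] Tan n M x →ₗ⋆[ℂ] ℂ :=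
  sesqOf (η.val x) (η.compat x)

/-- The sesquilinear form on tangent vectors given by a Hermitian metric. -/
def HermMetric.sesq (g : HermMetric n M) (x : M) : Tan n M x →ₗ[ℂ] Tan n M x →ₗ⋆[ℂ] ℂ :=
  sesqOf (g.val x) (g.compat x)

theorem RealForm11.herm_eq_sesq (η : RealForm11 n M) (e : OpenPartialHomeomorph M (Cn n))
    (z : Cn n) (j k : Fin n) : η.herm e z j k = -Complex.I * η.sesq (e.symm z)
      (coordVec e z (Pi.single j 1)) (coordVec e z (Pi.single k 1)) := by
  simp only [RealForm11.herm, RealForm11.comp, RealForm11.sesq, sesqOf_apply]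
  ring

theorem HermMetric.coeff_eq_sesq (g : HermMetric n M) (e : OpenPartialHomeomorph M (Cn n))
    (z : Cn n) (j k : Fin n) : g.coeff e z j k = g.sesq (e.symm z)
      (coordVec e z (Pi.single j 1)) (coordVec e z (Pi.single k 1)) :=
  g.coeff_eq e z j k

theorem HermMetric.sesq_coordVec (g : HermMetric n M) (e : OpenPartialHomeomorph M (Cn n))
    (z s t : Cn n) :
    g.sesq (e.symm z) (coordVec e z s) (coordVec e z t) = arrSesq (g.coeff e z) s t := by
  rw [_root_.sesq_coordVec]
  simp only [← g.coeff_eq_sesq]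

theorem HermMetric.conj_sesq (g : HermMetric n M) (x : M) (u v : Tan n M x) :
    conj (g.sesq x u v) = g.sesq x v u := by
  simp only [HermMetric.sesq, sesqOf_apply, map_add, map_mul, Complex.conj_ofReal, Complex.conj_I]
  rw [g.symm x u v, g.symm x u, map_I_smul_left _ (g.compat x)]
  push_cast; ring

theorem RealForm11.smooth_herm (η : RealForm11 n M) (he : e ∈ holCharts n M) :
    ContDiffOn ℝ ∞ (η.herm e) e.target := by
  have h : ∀ a b : Cn n, ContDiffOn ℝ ∞
      (fun z => (η.val (e.symm z) (coordVec e z a) (coordVec e z b) : ℂ)) e.target := fun a b =>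
    Complex.ofRealCLM.contDiff.comp_contDiffOn (η.smooth e he a b)
  refine contDiffOn_arr.2 fun j k => contDiffOn_const.mul (contDiffOn_const.mul
    ((h _ _).add (contDiffOn_const.mul ?_)))
  simp only [← coordVec_I]
  exact h _ _

theorem HermMetric.isMetricOn (g : HermMetric n M) (he : e ∈ holCharts n M) :
    IsMetricOn e.target (g.coeff e) where
  isOpen := e.open_target
  smooth := g.kahler.smooth_herm he
  posDef z hz := by
    refine Matrix.PosDef.of_dotProduct_mulVec_pos ?_ fun x hx => ?_
    · ext j k
      simp only [Matrix.conjTranspose_apply, Matrix.of_apply, g.coeff_eq_sesq]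
      exact g.conj_sesq _ _ _
    -- `Matrix.PosDef` conjugates the left vector, whereas `arrSesq` conjugates the right one; hence
    -- the tangent vector with components `star x`.
    · have h1 : star x ⬝ᵥ (Matrix.of (g.coeff e z)).mulVec x =
          g.sesq (e.symm z) (coordVec e z (star x)) (coordVec e z (star x)) := by
        rw [g.sesq_coordVec, arrSesq, dotProduct]
        refine Finset.sum_congr rfl fun a _ => ?_
        rw [Matrix.mulVec, dotProduct, Finset.mul_sum]
        refine Finset.sum_congr rfl fun b _ => ?_
        simp only [Pi.star_apply, Matrix.of_apply, RCLike.star_def, Complex.conj_conj]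
        ring
      have h2 : coordVec e z (star x) ≠ 0 := by
        intro h0
        have h3 := vecCoord_coordVec_self he hz (star x)
        rw [h0, map_zero] at h3
        exact hx (star_eq_zero.1 h3.symm)
      rw [h1, Complex.pos_iff]
      refine ⟨?_, ?_⟩
      · rw [HermMetric.sesq, sesqOf_re]
        exact g.pos _ _ h2
      · have h4 := congrArg Complex.im (g.conj_sesq (e.symm z) (coordVec e z (star x))
          (coordVec e z (star x)))
        rw [Complex.conj_im] at h4
        linarith

theorem HermMetric.isMetricPullback (g : HermMetric n M) (he' : e' ∈ holCharts n M)
    (he : e ∈ holCharts n M) :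
    IsMetricPullback (overlap e' e) e.target (transition e' e) (g.coeff e') (g.coeff e) where
  left := ⟨isOpen_overlap e' e, (g.isMetricOn he').smooth.mono Set.inter_subset_left,
    fun z hz => (g.isMetricOn he').posDef z hz.1⟩
  right := g.isMetricOn he
  smooth := contDiffOn_transition he' he
  mapsTo := mapsTo_transition
  apply_eq z hz j k := by
    rw [g.coeff_eq_sesq, transition_congr_tan (fun x u v => g.sesq x u v) he' he hz,
      g.sesq_coordVec, arrSesq_fderiv, arrSesq_single]

theorem HermMetric.kahler_comp (g : HermMetric n M) (e : OpenPartialHomeomorph M (Cn n)) :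
    arrForm (g.kahler.comp e) = kahlerForm (g.coeff e) := by
  ext z I J
  simp only [arrForm, kahlerForm, HermMetric.coeff, RealForm11.herm]
  linear_combination (g.kahler.comp e z (I 0) (J 0)) * Complex.I_mul_I

/-- A real `(1,1)`-form is determined by its components. -/
theorem RealForm11.eq_of_herm_eq [IsManifold 𝓘(ℂ, Cn n) ω M] {η η' : RealForm11 n M}
    (h : ∀ e ∈ holCharts n M, ∀ z ∈ e.target, η.herm e z = η'.herm e z) : η = η' := by
  have h1 : η.val = η'.val := by
    funext x
    set e := chartAt (Cn n) x with he
    have hx : x ∈ e.source := mem_chart_source _ x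
    have hz : e x ∈ e.target := e.map_source hx
    have key : ∀ s t : Cn n, η.sesq (e.symm (e x)) (coordVec e (e x) s) (coordVec e (e x) t) =
        η'.sesq (e.symm (e x)) (coordVec e (e x) s) (coordVec e (e x) t) := by
      intro s t
      rw [_root_.sesq_coordVec, _root_.sesq_coordVec]
      congr 1
      ext j k
      have h2 := congrFun (congrFun (h e (chartAt_mem_holCharts x) _ hz) j) k
      rw [RealForm11.herm_eq_sesq, RealForm11.herm_eq_sesq] at h2
      exact mul_left_cancel₀ (neg_ne_zero.2 Complex.I_ne_zero) h2
    ext u v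
    have h3 : ∀ ζ : RealForm11 n M, ζ.sesq (e.symm (e x)) (coordVec e (e x) (vecCoord e x u))
        (coordVec e (e x) (vecCoord e x v)) = ζ.sesq x u v := by
      intro ζ
      refine (congr_tan (fun x u v => ζ.sesq x u v) (e.left_inv hx) _ _).trans ?_
      exact congrArg₂ (fun u v => ζ.sesq x u v) (coordVec_vecCoord (chartAt_mem_holCharts x) hx u)
        (coordVec_vecCoord (chartAt_mem_holCharts x) hx v)
    have h4 := key (vecCoord e x u) (vecCoord e x v)
    rw [h3, h3] at h4
    have h5 := congrArg Complex.re h4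
    rwa [RealForm11.sesq, RealForm11.sesq, sesqOf_re, sesqOf_re] at h5
  cases η; cases η'; cases h1; rfl

/-! #### Construction of forms from their components -/

/-- A real `(1,1)`-form from Hermitian components with the correct transformation law. -/
theorem exists_realForm11 [IsManifold 𝓘(ℂ, Cn n) ω M]
    (H : OpenPartialHomeomorph M (Cn n) → Cn n → Arr n)
    (hs : ∀ e ∈ holCharts n M, ContDiffOn ℝ ∞ (H e) e.target)
    (hh : ∀ e ∈ holCharts n M, ∀ z ∈ e.target, ∀ j k, conj (H e z j k) = H e z k j)
    (ht : ∀ e' ∈ holCharts n M, ∀ e ∈ holCharts n M, ∀ z ∈ overlap e' e, ∀ j k, H e' z j k =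
      ∑ a, ∑ b, holJac (transition e' e) z a j * conj (holJac (transition e' e) z b k) *
        H e (transition e' e z) a b) :
    ∃ η : RealForm11 n M, ∀ e ∈ holCharts n M, ∀ z ∈ e.target, η.herm e z = H e z := by
  have hadd : ∀ (A : Arr n) (s s' t : Cn n), arrSesq A (s + s') t =
      arrSesq A s t + arrSesq A s' t := fun A s s' t => by
    simp only [arrSesq, Pi.add_apply, mul_add, add_mul, Finset.sum_add_distrib]
  have hadd' : ∀ (A : Arr n) (s t t' : Cn n), arrSesq A s (t + t') =
      arrSesq A s t + arrSesq A s t' := fun A s t t' => by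
    simp only [arrSesq, Pi.add_apply, map_add, mul_add, Finset.sum_add_distrib]
  have hsm : ∀ (A : Arr n) (c : ℂ) (s t : Cn n), arrSesq A (c • s) t = c * arrSesq A s t :=
    fun A c s t => by
      simp only [arrSesq, Pi.smul_apply, smul_eq_mul, Finset.mul_sum]
      exact Finset.sum_congr rfl fun a _ => Finset.sum_congr rfl fun b _ => by ring
  have hsm' : ∀ (A : Arr n) (c : ℂ) (s t : Cn n), arrSesq A s (c • t) = conj c * arrSesq A s t :=
    fun A c s t => by
      simp only [arrSesq, Pi.smul_apply, smul_eq_mul, Finset.mul_sum, map_mul]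
      exact Finset.sum_congr rfl fun a _ => Finset.sum_congr rfl fun b _ => by ring
  have hconj : ∀ e ∈ holCharts n M, ∀ z ∈ e.target, ∀ s t : Cn n,
      conj (arrSesq (H e z) s t) = arrSesq (H e z) t s := by
    intro e he z hz s t
    simp only [arrSesq, map_sum, map_mul, hh e he z hz, Complex.conj_conj]
    rw [Finset.sum_comm]
    exact Finset.sum_congr rfl fun a _ => Finset.sum_congr rfl fun b _ => by ring
  -- The form at `x` is read in the preferred chart at `x`. By the transformation law every
  -- holomorphic chart gives the same value (`hS`), whence smoothness.
  let S : ∀ x : M, Tan n M x → Tan n M x → ℂ := fun x u v =>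
    arrSesq (H (chartAt (Cn n) x) (chartAt (Cn n) x x)) (vecCoord (chartAt (Cn n) x) x u)
      (vecCoord (chartAt (Cn n) x) x v)
  have hS : ∀ e ∈ holCharts n M, ∀ z ∈ e.target, ∀ s t : Cn n,
      S (e.symm z) (coordVec e z s) (coordVec e z t) = arrSesq (H e z) s t := by
    intro e he z hz s t
    have hov : z ∈ overlap e (chartAt (Cn n) (e.symm z)) := ⟨hz, mem_chart_source _ _⟩
    have he0 : chartAt (Cn n) (e.symm z) ∈ holCharts n M := chartAt_mem_holCharts _
    simp only [S, vecCoord_coordVec he he0 hov, arrSesq_fderiv]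
    congr 1
    ext j k
    exact (ht e he _ he0 z hov j k).symm
  -- Hermitian components `H` mean `η(u,v) + i η(u,iv) = i H(u,v)`, so `η` is the real part of `i
  -- H`, that is, `-Im H`. It alternates because `H` is Hermitian.
  refine ⟨⟨fun x => LinearMap.mk₂ ℝ (fun u v => -(S x u v).im) ?_ ?_ ?_ ?_, ?_, ?_, ?_⟩, ?_⟩
  · intro u u' v
    simp only [S, map_add, hadd, Complex.add_im]; ring
  · intro c u v
    have : c • u = (c : ℂ) • u := rfl
    simp only [S, this, map_smul, hsm, Complex.im_ofReal_mul, smul_eq_mul]; ring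
  · intro u v v'
    simp only [S, map_add, hadd', Complex.add_im]; ring
  · intro c u v
    have : c • v = (c : ℂ) • v := rfl
    simp only [S, this, map_smul, hsm', Complex.conj_ofReal, Complex.im_ofReal_mul, smul_eq_mul]
    ring
  · intro x u v
    simp only [LinearMap.mk₂_apply, S]
    rw [← hconj _ (chartAt_mem_holCharts x) _ (mem_chart_target _ x), Complex.conj_im]
  · intro x u v
    simp only [LinearMap.mk₂_apply, S, map_smul, hsm, hsm', Complex.conj_I]
    rw [← mul_assoc, mul_neg, Complex.I_mul_I, neg_neg, one_mul]
  · intro e he a b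
    have h1 : ContDiffOn ℝ ∞ (fun z => -(arrSesq (H e z) a b).im) e.target := by
      refine (Complex.imCLM.contDiff.comp_contDiffOn ?_).neg
      exact ContDiffOn.sum fun j _ => ContDiffOn.sum fun k _ =>
        (((hs e he).arr_apply j k).mul contDiffOn_const).mul contDiffOn_const
    refine h1.congr fun z hz => ?_
    simp only [LinearMap.mk₂_apply, hS e he z hz]
  · intro e he z hz
    ext j k
    simp only [RealForm11.herm, RealForm11.comp, LinearMap.mk₂_apply, ← coordVec_I,
      hS e he z hz, hsm', arrSesq_single, Complex.conj_I]
    have h2 := Complex.re_add_im (H e z j k)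
    simp only [neg_mul, Complex.neg_im, Complex.mul_im, Complex.I_re, Complex.I_im, zero_mul,
      one_mul, zero_add, neg_neg]
    push_cast
    linear_combination h2 - ((H e z j k).re : ℂ) * Complex.I_mul_I

/-- A `(0,1)`-form from components with the correct transformation law. -/
theorem exists_form01 [IsManifold 𝓘(ℂ, Cn n) ω M]
    (b : OpenPartialHomeomorph M (Cn n) → Cn n → Fin n → ℂ)
    (hs : ∀ e ∈ holCharts n M, ∀ k, ContDiffOn ℝ ∞ (fun z => b e z k) e.target)
    (ht : ∀ e' ∈ holCharts n M, ∀ e ∈ holCharts n M, ∀ z ∈ overlap e' e, ∀ k, b e' z k =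
      ∑ d, conj (holJac (transition e' e) z d k) * b e (transition e' e z) d) :
    ∃ β : Form01 n M, ∀ e ∈ holCharts n M, ∀ z ∈ e.target, ∀ s : Cn n,
      β.val (e.symm z) (coordVec e z s) = ∑ k, b e z k * conj (s k) := by
  let S : ∀ x : M, Tan n M x → ℂ := fun x u =>
    ∑ d, b (chartAt (Cn n) x) (chartAt (Cn n) x x) d * conj (vecCoord (chartAt (Cn n) x) x u d)
  have hS : ∀ e ∈ holCharts n M, ∀ z ∈ e.target, ∀ s : Cn n,
      S (e.symm z) (coordVec e z s) = ∑ k, b e z k * conj (s k) := by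
    intro e he z hz s
    have hov : z ∈ overlap e (chartAt (Cn n) (e.symm z)) := ⟨hz, mem_chart_source _ _⟩
    have he0 : chartAt (Cn n) (e.symm z) ∈ holCharts n M := chartAt_mem_holCharts _
    simp only [S, vecCoord_coordVec he he0 hov, fderiv_transition_apply, map_sum, map_mul,
      ht e he _ he0 z hov, Finset.sum_mul, Finset.mul_sum]
    rw [Finset.sum_comm]
    refine Finset.sum_congr rfl fun k _ => Finset.sum_congr rfl fun d _ => ?_
    simp only [transition, Function.comp_apply]
    ring
  refine ⟨⟨fun x => ⟨⟨S x, ?_⟩, ?_⟩, ?_⟩, hS⟩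
  · intro u v
    simp only [S, map_add, Pi.add_apply, mul_add, Finset.sum_add_distrib]
  · intro c u
    simp only [S, map_smul, Pi.smul_apply, smul_eq_mul, map_mul, Finset.mul_sum]
    exact Finset.sum_congr rfl fun d _ => by ring
  · intro e he a
    have h1 : ContDiffOn ℝ ∞ (fun z => ∑ k, b e z k * conj (a k)) e.target :=
      ContDiffOn.sum fun k _ => (hs e he k).mul contDiffOn_const
    exact h1.congr fun z hz => hS e he z hz a

/-- The conjugate of a `(0,1)`-form. -/
def Form01.conjForm (β : Form01 n M) : Form10 n M where
  val x := ⟨⟨fun u => conj (β.val x u), fun u v => by rw [map_add, map_add]⟩, fun c u => by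
    simp⟩
  smooth e he a := (β.smooth e he a).conj_smooth

/-! #### `Φ` in a holomorphic chart -/

theorem phi_comp_iff {u : Cn n → Arr n} {U : Set (Cn n)} (hU : IsOpen U) {β : PQ n 0 1}
    {γ : PQ n 1 0} (hβ : Set.EqOn β (form01 (delStarComp u)) U)
    (hγ : Set.EqOn γ (form10 (delBarStarComp u)) U) (hz : z ∈ U) (c : Cn n → Arr n) :
    (arrForm c z = -del β z - delBar γ z - (Complex.I / 2) •
      del (delBar (fun z _ _ => (Real.log (detMet (u z)) : ℂ) : PQ n 0 0)) z) ↔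
    (fun j k => -2 * Complex.I * c z j k) = phiComp u z := by
  -- Passing to Hermitian components is multiplication by `-2i`, the inverse of `i/2`. The sign of
  -- the `∂̄∂̄*` term flips because `∂̄` of a `(1,0)`-form carries a `-1`.
  have h1 : ∀ I J, (-del β z - delBar γ z - (Complex.I / 2) •
      del (delBar (fun z _ _ => (Real.log (detMet (u z)) : ℂ) : PQ n 0 0)) z) I J =
      (Complex.I / 2) * phiComp u z (I 0) (J 0) := by
    intro I J
    have e1 : wirt (I 0) (fun w => β w default J) z =
        wirt (I 0) (fun w => delStarComp u w (J 0)) z :=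
      wirt_congr_on hU (fun w hw => by rw [hβ hw]; rfl) _ hz
    have e2 : wirtBar (J 0) (fun w => γ w I default) z =
        wirtBar (J 0) (fun w => delBarStarComp u w (I 0)) z :=
      wirtBar_congr_on hU (fun w hw => by rw [hγ hw]; rfl) _ hz
    have e3 : (fun w => delBar (fun z _ _ => (Real.log (detMet (u z)) : ℂ) : PQ n 0 0) w
        default J) = wirtBar (J 0) (fun w => (Real.log (detMet (u w)) : ℂ)) := by
      ext w
      simp [delBar]
    simp only [Pi.sub_apply, Pi.neg_apply, Pi.smul_apply, smul_eq_mul, del_01_apply,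
      delBar_10_apply, e1, e2, e3, phiComp]
    linear_combination (-wirt (I 0) (fun w => delStarComp u w (J 0)) z +
      wirtBar (J 0) (fun w => delBarStarComp u w (I 0)) z) * Complex.I_mul_I
  constructor
  · intro h
    ext j k
    have h2 := congrFun (congrFun h fun _ => j) fun _ => k
    rw [h1] at h2
    simp only [arrForm] at h2
    rw [h2]
    linear_combination (-phiComp u z j k) * Complex.I_mul_I
  · intro h
    ext I J
    rw [h1, ← h]
    simp only [arrForm]
    linear_combination (c z (I 0) (J 0)) * Complex.I_mul_I

/-- The components of `Φ(ω)` in a holomorphic chart. -/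
theorem IsPhi.herm_eq {g : HermMetric n M} {η : RealForm11 n M} (h : IsPhi g η)
    (he : e ∈ holCharts n M) (hz : z ∈ e.target) : η.herm e z = phiComp (g.coeff e) z := by
  obtain ⟨β, γ, hβ, hγ, hη⟩ := h
  have hm := g.isMetricOn he
  have h1 : Set.EqOn (fun z k => β.val (e.symm z) (coordVec e z (Pi.single k 1)))
      (delStarComp (g.coeff e)) e.target :=
    hm.eqOn_delStarComp (fun k => β.smooth e he _) fun α hα => by
      rw [← g.kahler_comp]; exact hβ e he α hα
  have h2 : Set.EqOn (fun z k => γ.val (e.symm z) (coordVec e z (Pi.single k 1)))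
      (delBarStarComp (g.coeff e)) e.target :=
    hm.eqOn_delBarStarComp (fun k => γ.smooth e he _) fun α hα => by
      rw [← g.kahler_comp]; exact hγ e he α hα
  refine (phi_comp_iff e.open_target (β := β.comp e) (γ := γ.comp e) (fun w hw => ?_)
    (fun w hw => ?_) hz _).1 (hη e he z hz)
  · ext I J; exact congrFun (h1 hw) (J 0)
  · ext I J; exact congrFun (h2 hw) (I 0)

/-- The local formulas for `∂*ω` and `Φ(ω)` glue by their transformation laws, and `∂̄*ω` is taken
as the conjugate of the glued `∂*ω`. -/
theorem exists_isPhi [IsManifold 𝓘(ℂ, Cn n) ω M] (g : HermMetric n M) :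
    ∃ η : RealForm11 n M, IsPhi g η := by
  obtain ⟨β, hβ⟩ := exists_form01 (M := M) (fun e => delStarComp (g.coeff e))
    (fun e he k => (g.isMetricOn he).smooth_delStarComp k)
    (fun e' he' e he z hz k => (g.isMetricPullback he' he).delStarComp_eq hz k)
  obtain ⟨η, hη⟩ := exists_realForm11 (M := M) (fun e => phiComp (g.coeff e))
    (fun e he => (g.isMetricOn he).smooth_phiComp)
    (fun e he z hz j k => (g.isMetricOn he).isHermitian_phiComp hz j k)
    (fun e' he' e he z hz j k => (g.isMetricPullback he' he).phiComp_eq hz j k)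
  have hb : ∀ e ∈ holCharts n M,
      Set.EqOn (β.comp e) (form01 (delStarComp (g.coeff e))) e.target := by
    intro e he z hz
    ext I J
    simp only [Form01.comp, hβ e he z hz, form01, Pi.single_apply, apply_ite conj, map_one,
      map_zero, mul_ite, mul_one, mul_zero, Finset.sum_ite_eq', Finset.mem_univ, if_true]
  have hc : ∀ e ∈ holCharts n M,
      Set.EqOn (β.conjForm.comp e) (form10 (delBarStarComp (g.coeff e))) e.target := by
    intro e he z hz
    ext I J
    have h1 := congrFun (congrFun (hb e he hz) default) I
    simp only [form10, (g.isMetricOn he).delBarStarComp_eq_conj hz]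
    exact congrArg conj h1
  refine ⟨η, β, β.conjForm, fun e he α hα => ?_, fun e he α hα => ?_, fun e he z hz => ?_⟩
  · rw [g.kahler_comp, (g.isMetricOn he).l2Inner_del hα]
    exact (l2Inner_congr e.open_target (hb e he) α).symm
  · rw [g.kahler_comp, (g.isMetricOn he).l2Inner_delBar hα]
    exact (l2Inner_congr e.open_target (hc e he) α).symm
  · exact (phi_comp_iff e.open_target (hb e he) (hc e he) hz _).2 (hη e he z hz)

theorem existsUnique_isPhi [IsManifold 𝓘(ℂ, Cn n) ω M] (g : HermMetric n M) :
    ∃! η : RealForm11 n M, IsPhi g η := by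
  obtain ⟨η, hη⟩ := exists_isPhi g
  exact ⟨η, hη, fun η' hη' => RealForm11.eq_of_herm_eq fun e he z hz => by
    rw [hη.herm_eq he hz, hη'.herm_eq he hz]⟩

end ManifoldOperator
/-! ### Quasilinearity, linearization and symbol -/

section JetOperator

open Filter Topology

variable {n : ℕ}

/-! ### Smooth dependence of the jet expressions on parameters -/

section Smooth

variable {E : Type*} [NormedAddCommGroup E] [NormedSpace ℝ E] {s : Set E}
  {G : E → Arr n} {P : E → Cn n →L[ℝ] Arr n}

theorem smooth_dA (hP : ContDiffOn ℝ ∞ P s) (a j k : Fin n) :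
    ContDiffOn ℝ ∞ (fun t => dA a (P t) j k) s :=
  contDiffOn_const.mul (((hP.clm_apply contDiffOn_const).arr_apply j k).sub
    (contDiffOn_const.mul ((hP.clm_apply contDiffOn_const).arr_apply j k)))

theorem smooth_dbA (hP : ContDiffOn ℝ ∞ P s) (a j k : Fin n) :
    ContDiffOn ℝ ∞ (fun t => dbA a (P t) j k) s :=
  contDiffOn_const.mul (((hP.clm_apply contDiffOn_const).arr_apply j k).add
    (contDiffOn_const.mul ((hP.clm_apply contDiffOn_const).arr_apply j k)))

theorem smooth_ddA {B : E → Cn n →L[ℝ] Cn n →L[ℝ] Arr n} (hB : ContDiffOn ℝ ∞ B s)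
    (a b j k : Fin n) : ContDiffOn ℝ ∞ (fun t => ddA a b (B t) j k) s :=
  contDiffOn_const.mul ((smooth_dbA (hB.clm_apply contDiffOn_const) b j k).sub
    (contDiffOn_const.mul (smooth_dbA (hB.clm_apply contDiffOn_const) b j k)))

theorem smooth_invMet_comp (hG : ContDiffOn ℝ ∞ G s) (h0 : ∀ t ∈ s, (Matrix.of (G t)).det ≠ 0)
    (a b : Fin n) : ContDiffOn ℝ ∞ (fun t => invMet (G t) a b) s :=
  (contDiffOn_invMet a b).comp hG h0

theorem smooth_phiTop (hG : ContDiffOn ℝ ∞ G s) (h0 : ∀ t ∈ s, (Matrix.of (G t)).det ≠ 0)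
    {B : E → Cn n →L[ℝ] Cn n →L[ℝ] Arr n} (hB : ContDiffOn ℝ ∞ B s) :
    ContDiffOn ℝ ∞ (fun t => phiTop (G t) (B t)) s :=
  contDiffOn_arr.2 fun j k => (ContDiffOn.sum fun a _ => ContDiffOn.sum fun b _ =>
    (smooth_invMet_comp hG h0 a b).mul (((smooth_ddA hB j b a k).add (smooth_ddA hB a k j b)).sub
      (smooth_ddA hB j k a b))).neg

theorem smooth_phiLow (hG : ContDiffOn ℝ ∞ G s) (h0 : ∀ t ∈ s, (Matrix.of (G t)).det ≠ 0)
    (hP : ContDiffOn ℝ ∞ P s) : ContDiffOn ℝ ∞ (fun t => phiLow (G t) (P t)) s := by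
  have hi := smooth_invMet_comp hG h0
  have hd : ∀ j p q, ContDiffOn ℝ ∞ (fun t => dInv j (G t) (P t) p q) s := fun j p q =>
    (ContDiffOn.sum fun c _ => ContDiffOn.sum fun d _ =>
      ((hi p d).mul (hi c q)).mul (smooth_dA hP j c d)).neg
  have hdb : ∀ j p q, ContDiffOn ℝ ∞ (fun t => dbInv j (G t) (P t) p q) s := fun j p q =>
    (ContDiffOn.sum fun c _ => ContDiffOn.sum fun d _ =>
      ((hi p d).mul (hi c q)).mul (smooth_dbA hP j c d)).neg
  exact contDiffOn_arr.2 fun j k => (ContDiffOn.sum fun a _ => ContDiffOn.sum fun b _ =>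
    ((hd j a b).mul (smooth_dbA hP b a k)).add
      ((hdb k a b).mul ((smooth_dA hP a j b).sub (smooth_dA hP j a b)))).neg

end Smooth

/-! ### The second-order part and the `∂∂̄`-relation -/

theorem ddA_add (a b : Fin n) (B B' : Cn n →L[ℝ] Cn n →L[ℝ] Arr n) (j k : Fin n) :
    ddA a b (B + B') j k = ddA a b B j k + ddA a b B' j k := by
  simp only [ddA, dbA, _root_.add_apply, Pi.add_apply]; ring

theorem ddA_smul (a b : Fin n) (r : ℝ) (B : Cn n →L[ℝ] Cn n →L[ℝ] Arr n) (j k : Fin n) :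
    ddA a b (r • B) j k = r * ddA a b B j k := by
  simp only [ddA, dbA, _root_.smul_apply, Pi.smul_apply, Complex.real_smul]; ring

/-- The second-order part of `Φ` as a linear map. -/
def phiTopLin (G : Arr n) : (Cn n →L[ℝ] Cn n →L[ℝ] Arr n) →ₗ[ℝ] Arr n where
  toFun := phiTop G
  map_add' B B' := by
    ext j k
    simp only [phiTop, ddA_add, Pi.add_apply, ← neg_add, ← Finset.sum_add_distrib]
    exact congrArg Neg.neg (Finset.sum_congr rfl fun a _ => Finset.sum_congr rfl fun b _ => by ring)
  map_smul' r B := by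
    ext j k
    simp only [phiTop, ddA_smul, Pi.smul_apply, RingHom.id_apply, smul_neg, Finset.smul_sum,
      Complex.real_smul]
    exact congrArg Neg.neg (Finset.sum_congr rfl fun a _ => Finset.sum_congr rfl fun b _ => by ring)

theorem phiTopLin_apply (G : Arr n) (B : Cn n →L[ℝ] Cn n →L[ℝ] Arr n) :
    phiTopLin G B = phiTop G B := rfl

/-- The operator `u ↦ -∑ g^{a b̄} ∂_a ∂_b̄ u` in terms of `D²u`. -/
def lapTop (G : Arr n) : (Cn n →L[ℝ] Cn n →L[ℝ] Arr n) →ₗ[ℝ] Arr n where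
  toFun B := fun j k => -∑ a, ∑ b, invMet G a b * ddA a b B j k
  map_add' B B' := by
    ext j k
    simp only [ddA_add, Pi.add_apply, ← neg_add, ← Finset.sum_add_distrib, mul_add]
  map_smul' r B := by
    ext j k
    simp only [ddA_smul, Pi.smul_apply, RingHom.id_apply, smul_neg, Finset.smul_sum,
      Complex.real_smul]
    exact congrArg Neg.neg (Finset.sum_congr rfl fun a _ => Finset.sum_congr rfl fun b _ => by ring)

theorem lapTop_apply (G : Arr n) (B : Cn n →L[ℝ] Cn n →L[ℝ] Arr n) (j k : Fin n) :
    lapTop G B j k = -∑ a, ∑ b, invMet G a b * ddA a b B j k := rfl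

/-- The relation which the second derivatives of a `∂∂̄`-closed form satisfy. -/
def DDBarRel (B : Cn n →L[ℝ] Cn n →L[ℝ] Arr n) : Prop :=
  ∀ a b j k, ddA a b B j k - ddA a k B j b - ddA j b B a k + ddA j k B a b = 0

/-- Contract the relation with `g^{a b̄}`: the three second-derivative terms of `Φ` combine into
`∂_a ∂_b̄ u_{j k̄}`. This is the source of ellipticity. -/
theorem DDBarRel.phiTop_eq {B : Cn n →L[ℝ] Cn n →L[ℝ] Arr n} (h : DDBarRel B) (G : Arr n) :
    phiTop G B = lapTop G B := by
  ext j k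
  rw [phiTop, lapTop_apply]
  refine congrArg Neg.neg (Finset.sum_congr rfl fun a _ => Finset.sum_congr rfl fun b _ => ?_)
  linear_combination (-invMet G a b) * h a b j k

theorem del_delBar_arrForm {U : Set (Cn n)} (hU : IsOpen U) {u : Cn n → Arr n}
    (hu : ContDiffOn ℝ ∞ u U) {z : Cn n} (hz : z ∈ U) (I J : Fin 2 → Fin n) :
    del (delBar (arrForm u)) z I J =
      -(ddA (I 0) (J 0) (fderiv ℝ (fderiv ℝ u) z) (I 1) (J 1)
        - ddA (I 0) (J 1) (fderiv ℝ (fderiv ℝ u) z) (I 1) (J 0)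
        - ddA (I 1) (J 0) (fderiv ℝ (fderiv ℝ u) z) (I 0) (J 1)
        + ddA (I 1) (J 1) (fderiv ℝ (fderiv ℝ u) z) (I 0) (J 0)) := by
  have hs : ∀ b j k, DifferentiableAt ℝ (wirtBar b (fun w => u w j k)) z := fun b j k =>
    (contDiffOn_wirtBar hU (hu.arr_apply j k) b).differentiableAt_of_isOpen hU hz
  have h1 : ∀ (c : Fin n) (I' : Fin 1 → Fin n), wirt c (fun w => delBar (arrForm u) w I' J) z =
      -ddA c (J 0) (fderiv ℝ (fderiv ℝ u) z) (I' 0) (J 1) +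
        ddA c (J 1) (fderiv ℝ (fderiv ℝ u) z) (I' 0) (J 0) := by
    intro c I'
    have h2 : (fun w => delBar (arrForm u) w I' J) = fun w =>
        (-1 : ℂ) * wirtBar (J 0) (fun w => u w (I' 0) (J 1)) w +
          wirtBar (J 1) (fun w => u w (I' 0) (J 0)) w := by
      ext w
      simp [delBar, Fin.sum_univ_two, arrForm]
      ring
    rw [h2, wirt_add c ((hs _ _ _).const_mul _) (hs _ _ _), wirt_const_mul c _ (hs _ _ _),
      wirt_wirtBar_arr_apply hU hu hz, wirt_wirtBar_arr_apply hU hu hz, neg_one_mul]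
  simp only [del, h1]
  simp [Fin.sum_univ_two]
  ring

theorem ddBarRel_iff {U : Set (Cn n)} (hU : IsOpen U) {u : Cn n → Arr n}
    (hu : ContDiffOn ℝ ∞ u U) {z : Cn n} (hz : z ∈ U) :
    del (delBar (arrForm u)) z = 0 ↔ DDBarRel (fderiv ℝ (fderiv ℝ u) z) := by
  constructor
  · intro h a b j k
    -- These index pairs give the relation up to the sign `(-1)^p`, `p = 1`, in `∂̄`.
    have h1 := congrFun (congrFun h ![a, j]) ![b, k]
    rw [del_delBar_arrForm hU hu hz] at h1
    exact neg_eq_zero.1 h1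
  · intro h
    ext I J
    rw [del_delBar_arrForm hU hu hz, h]
    simp

/-! #### Symbols -/

theorem ddA_symbol (ξ : Cn n →L[ℝ] ℝ) (h : Arr n) (a b j k : Fin n) :
    ddA a b (ξ.smulRight (ξ.smulRight h)) j k =
      covecComp ξ a * conj (covecComp ξ b) * h j k := by
  simp only [ddA, dbA, covecComp, ContinuousLinearMap.smulRight_apply, _root_.smul_apply,
    Pi.smul_apply, Complex.real_smul, map_mul, map_sub, Complex.conj_ofReal, Complex.conj_I,
    map_div₀, map_one, map_ofNat]
  ring

/-- The factor `1/2` makes the Hessian of `(1/2) ξ² h` exactly `ξ ⊗ ξ ⊗ h`. -/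
theorem fderiv_fderiv_symbol (ξ : Cn n →L[ℝ] ℝ) (h : Arr n) :
    fderiv ℝ (fderiv ℝ fun (w : Cn n) (j k : Fin n) => (1 / 2 : ℂ) * (ξ w : ℂ) ^ 2 * h j k) 0 =
      ξ.smulRight (ξ.smulRight h) := by
  have h1 : (fun (w : Cn n) (j k : Fin n) => (1 / 2 : ℂ) * (ξ w : ℂ) ^ 2 * h j k) =
      fun w => ((1 / 2 : ℝ) * (ξ w) ^ 2) • h := by
    ext w j k
    simp only [Pi.smul_apply, Complex.real_smul]
    push_cast; ring
  have h2 : fderiv ℝ (fun w => ((1 / 2 : ℝ) * (ξ w) ^ 2) • h) =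
      ξ.smulRight (ξ.smulRight h) := by
    ext1 w
    have h3 : HasFDerivAt (fun w => (1 / 2 : ℝ) * (ξ w) ^ 2) (ξ w • ξ) w := by
      refine ((ξ.hasFDerivAt.pow 2).const_mul (1 / 2 : ℝ)).congr_fderiv ?_
      ext v
      simp
      ring
    rw [(h3.smul_const h).fderiv]
    ext v : 1
    simp [smul_smul]
  rw [h1, h2]
  exact (ξ.smulRight (ξ.smulRight h)).fderiv

/-- Apply `ddBarRel_iff` to the quadratic form `(1/2) ξ² h` at the origin. The symbol kernel and
closed variations thus satisfy the same algebraic condition on the second jet. -/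
theorem mem_symbolKer_iff (ξ : Cn n →L[ℝ] ℝ) (h : Arr n) :
    h ∈ symbolKer ξ ↔ (Matrix.of h).IsHermitian ∧ DDBarRel (ξ.smulRight (ξ.smulRight h)) := by
  have hs : ContDiff ℝ ∞ fun (w : Cn n) (j k : Fin n) =>
      (1 / 2 : ℂ) * (ξ w : ℂ) ^ 2 * h j k :=
    contDiff_pi.2 fun j => contDiff_pi.2 fun k => (contDiff_const.mul
      ((Complex.ofRealCLM.contDiff.comp ξ.contDiff).pow 2)).mul contDiff_const
  rw [← fderiv_fderiv_symbol, ← ddBarRel_iff isOpen_univ hs.contDiffOn (Set.mem_univ 0)]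
  rfl

theorem smul_mem_symbolKer {ξ : Cn n →L[ℝ] ℝ} {h : Arr n} (hh : h ∈ symbolKer ξ) (r : ℝ) :
    r • h ∈ symbolKer ξ := by
  rw [mem_symbolKer_iff] at hh ⊢
  refine ⟨?_, fun a b j k => ?_⟩
  · ext j k
    have h1 := hh.1.apply j k
    simp only [Matrix.conjTranspose_apply, Matrix.of_apply, Pi.smul_apply, Complex.real_smul,
      star_mul', RCLike.star_def, Complex.conj_ofReal] at h1 ⊢
    rw [h1]
  · have h1 := hh.2 a b j k
    simp only [ddA_symbol, Pi.smul_apply, Complex.real_smul] at h1 ⊢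
    linear_combination (r : ℂ) * h1

theorem coe_covecNormSq {G : Arr n} (hG : (Matrix.of G).IsHermitian) (ξ : Cn n →L[ℝ] ℝ) :
    (covecNormSq G ξ : ℂ) = ∑ p, ∑ q, invMet G p q * covecComp ξ p * conj (covecComp ξ q) := by
  refine Complex.conj_eq_iff_re.1 ?_
  simp only [map_sum, map_mul, conj_invMet hG, Complex.conj_conj]
  rw [Finset.sum_comm]
  exact Finset.sum_congr rfl fun a _ => Finset.sum_congr rfl fun b _ => by ring

theorem lapTop_symbol {G : Arr n} (hG : (Matrix.of G).IsHermitian) (ξ : Cn n →L[ℝ] ℝ)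
    (h : Arr n) : lapTop G (ξ.smulRight (ξ.smulRight h)) = (-covecNormSq G ξ) • h := by
  ext j k
  simp only [lapTop_apply, ddA_symbol, Pi.smul_apply, Complex.real_smul, Complex.ofReal_neg,
    coe_covecNormSq hG, neg_mul, Finset.sum_mul]
  exact congrArg Neg.neg (Finset.sum_congr rfl fun a _ => Finset.sum_congr rfl fun b _ => by ring)

theorem eq_zero_of_covecComp_eq_zero {ξ : Cn n →L[ℝ] ℝ} (h : ∀ p, covecComp ξ p = 0) : ξ = 0 := by
  have h1 : ∀ p, ξ (Pi.single p 1) = 0 ∧ ξ (Pi.single p Complex.I) = 0 := by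
    intro p
    have h2 := h p
    rw [covecComp, Complex.ext_iff] at h2
    simpa using h2
  ext v
  rw [eq_sum_single v, map_sum]
  simp [h1]

/-- The inverse of a positive definite matrix is positive definite, and the components `ξ_p`
determine the real covector. -/
theorem covecNormSq_pos {G : Arr n} (hG : (Matrix.of G).PosDef) {ξ : Cn n →L[ℝ] ℝ}
    (hξ : ξ ≠ 0) : 0 < covecNormSq G ξ := by
  have h0 : covecComp ξ ≠ 0 := fun h => hξ (eq_zero_of_covecComp_eq_zero (congrFun h))
  have h1 := hG.inv.dotProduct_mulVec_pos h0
  have h2 : star (covecComp ξ) ⬝ᵥ ((Matrix.of G)⁻¹).mulVec (covecComp ξ) =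
      (covecNormSq G ξ : ℂ) := by
    rw [coe_covecNormSq hG.isHermitian, Finset.sum_comm, dotProduct]
    refine Finset.sum_congr rfl fun q _ => ?_
    rw [Matrix.mulVec, dotProduct, Finset.mul_sum]
    refine Finset.sum_congr rfl fun p _ => ?_
    simp only [Pi.star_apply, RCLike.star_def, invMet]
    ring
  rw [h2] at h1
  exact_mod_cast h1

/-! #### The linearization -/

section Jets

variable {E F : Type*} [NormedAddCommGroup E] [NormedSpace ℝ E] [NormedAddCommGroup F]
  [NormedSpace ℝ F]

/-- Differentiation in a parameter commutes with differentiation in the point. -/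
theorem hasDerivAt_fderiv_param {f : ℝ × E → F} {U : Set E} (hU : IsOpen U)
    (hf : ContDiffOn ℝ ∞ f (Set.univ ×ˢ U)) {h : E → F}
    (hh : ∀ w ∈ U, HasDerivAt (fun s => f (s, w)) (h w) 0) {z : E} (hz : z ∈ U) :
    HasDerivAt (fun s => fderiv ℝ (fun w => f (s, w)) z) (fderiv ℝ h z) 0 := by
  have hO : IsOpen ((Set.univ : Set ℝ) ×ˢ U) := isOpen_univ.prod hU
  have hD : ContDiffOn ℝ ∞ (fderiv ℝ f) (Set.univ ×ˢ U) := hf.fderiv_of_isOpen hO (by simp)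
  have hmem : ∀ s : ℝ, ∀ w ∈ U, (s, w) ∈ (Set.univ : Set ℝ) ×ˢ U := fun s w hw =>
    ⟨Set.mem_univ s, hw⟩
  have h1 : ∀ s : ℝ, ∀ w ∈ U, HasFDerivAt (fun w => f (s, w))
      ((fderiv ℝ f (s, w)).comp (ContinuousLinearMap.inr ℝ ℝ E)) w := fun s w hw =>
    (hf.differentiableAt_of_isOpen hO (hmem s w hw)).hasFDerivAt.comp w
      (hasFDerivAt_prodMk_right s w)
  -- The velocity `h` is given only pointwise; as the `s`-partial derivative of the smooth `f` it is
  -- differentiable in the point.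
  have h2 : ∀ w ∈ U, h w = fderiv ℝ f (0, w) (1, 0) := by
    intro w hw
    have h3 := (hf.differentiableAt_of_isOpen hO (hmem 0 w hw)).hasFDerivAt.comp_hasDerivAt (0 : ℝ)
      ((hasDerivAt_id (0 : ℝ)).prodMk (hasDerivAt_const (0 : ℝ) w))
    exact (hh w hw).unique h3
  have hDz := (hD.differentiableAt_of_isOpen hO (hmem 0 z hz)).hasFDerivAt
  have h4 : HasFDerivAt h (((fderiv ℝ (fderiv ℝ f) (0, z)).comp
      (ContinuousLinearMap.inr ℝ ℝ E)).flip (1, 0)) z := by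
    have h5 := (hDz.comp z (hasFDerivAt_prodMk_right (0 : ℝ) z)).clm_apply
      (hasFDerivAt_const ((1, 0) : ℝ × E) z)
    refine HasFDerivAt.congr_of_eventuallyEq ?_
      (Filter.eventuallyEq_of_mem (hU.mem_nhds hz) fun w hw => h2 w hw)
    simpa using h5
  have h6 : HasDerivAt (fun s => fderiv ℝ f (s, z)) (fderiv ℝ (fderiv ℝ f) (0, z) (1, 0)) 0 :=
    hDz.comp_hasDerivAt (0 : ℝ) ((hasDerivAt_id (0 : ℝ)).prodMk (hasDerivAt_const (0 : ℝ) z))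
  have h7 : HasDerivAt (fun s => (fderiv ℝ f (s, z)).comp (ContinuousLinearMap.inr ℝ ℝ E))
      ((fderiv ℝ (fderiv ℝ f) (0, z) (1, 0)).comp (ContinuousLinearMap.inr ℝ ℝ E)) 0 :=
    (((ContinuousLinearMap.compL ℝ E (ℝ × E) F).flip
      (ContinuousLinearMap.inr ℝ ℝ E)).hasFDerivAt).comp_hasDerivAt (0 : ℝ) h6
  have h8 : (fun s => fderiv ℝ (fun w => f (s, w)) z) =
      fun s => (fderiv ℝ f (s, z)).comp (ContinuousLinearMap.inr ℝ ℝ E) :=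
    funext fun s => (h1 s z hz).fderiv
  rw [h8, h4.fderiv]
  -- Both sides are the second derivative of `f` in the directions `(1, 0)` and `(0, v)`, in
  -- opposite order.
  refine h7.congr_deriv ?_
  ext v
  exact ((hf.contDiffAt (hO.mem_nhds (hmem 0 z hz))).isSymmSndFDerivAt
    (by simp only [minSmoothness_of_isRCLikeNormedField]; exact ENat.LEInfty.out)) (1, 0) (0, v)

/-- Allows `hasDerivAt_fderiv_param` to be applied a second time, to reach `D²`. -/
theorem smooth_fderiv_param {f : ℝ × E → F} {U : Set E} (hU : IsOpen U)
    (hf : ContDiffOn ℝ ∞ f (Set.univ ×ˢ U)) :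
    ContDiffOn ℝ ∞ (fun t : ℝ × E => fderiv ℝ (fun w => f (t.1, w)) t.2) (Set.univ ×ˢ U) := by
  have hO : IsOpen ((Set.univ : Set ℝ) ×ˢ U) := isOpen_univ.prod hU
  have hD : ContDiffOn ℝ ∞ (fderiv ℝ f) (Set.univ ×ˢ U) := hf.fderiv_of_isOpen hO (by simp)
  refine (hD.clm_comp (contDiffOn_const (c := ContinuousLinearMap.inr ℝ ℝ E))).congr ?_
  rintro ⟨s, w⟩ hw
  exact ((hf.differentiableAt_of_isOpen hO hw).hasFDerivAt.comp w
    (hasFDerivAt_prodMk_right s w)).fderiv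

end Jets

/-! ### Derivatives of a function that is affine in its last variable -/

section Quasilinear

variable {D E₀ E₁ E₂ F : Type*} [NormedAddCommGroup D] [NormedSpace ℝ D] [NormedAddCommGroup E₀]
  [NormedSpace ℝ E₀] [NormedAddCommGroup E₁] [NormedSpace ℝ E₁] [NormedAddCommGroup E₂]
  [NormedSpace ℝ E₂] [NormedAddCommGroup F] [NormedSpace ℝ F] {U : Set D}

/-- The function `(x, y, w) ↦ A(x) w + b(x, y)`. -/
def quasiFun (A : E₀ → E₂ →ₗ[ℝ] F) (b : E₀ → E₁ → F) (t : E₀ × E₁ × E₂) : F :=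
  A t.1 t.2.2 + b t.1 t.2.1

/-- The partial derivative in the first variable. -/
def partial0 (Ψ : E₀ × E₁ × E₂ → F) (t : E₀ × E₁ × E₂) : E₀ →ₗ[ℝ] F :=
  (fderiv ℝ Ψ t ∘L ContinuousLinearMap.inl ℝ _ _ : E₀ →L[ℝ] F)

/-- The partial derivative in the second variable. -/
def partial1 (Ψ : E₀ × E₁ × E₂ → F) (t : E₀ × E₁ × E₂) : E₁ →ₗ[ℝ] F :=
  (fderiv ℝ Ψ t ∘L (ContinuousLinearMap.inr ℝ E₀ (E₁ × E₂) ∘L ContinuousLinearMap.inl ℝ E₁ E₂) :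
    E₁ →L[ℝ] F)

theorem smooth_fderiv_comp_apply {Ψ : E₀ × E₁ × E₂ → F} {O : Set E₀} (hO : IsOpen O)
    (hΨ : ContDiffOn ℝ ∞ Ψ (Prod.fst ⁻¹' O))
    {x : D → E₀} {y : D → E₁} {w : D → E₂} (hx : ContDiffOn ℝ ∞ x U)
    (hy : ContDiffOn ℝ ∞ y U) (hw : ContDiffOn ℝ ∞ w U) (hm : ∀ z ∈ U, x z ∈ O)
    (v : E₀ × E₁ × E₂) : ContDiffOn ℝ ∞ (fun z => fderiv ℝ Ψ (x z, y z, w z) v) U :=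
  ((hΨ.fderiv_of_isOpen (m := ∞) (hO.preimage continuous_fst) (by simp)).comp
    (hx.prodMk (hy.prodMk hw)) hm).clm_apply
    contDiffOn_const

theorem smooth_partial0 {Ψ : E₀ × E₁ × E₂ → F} {O : Set E₀} (hO : IsOpen O)
    (hΨ : ContDiffOn ℝ ∞ Ψ (Prod.fst ⁻¹' O))
    {x : D → E₀} {y : D → E₁} {w : D → E₂} (hx : ContDiffOn ℝ ∞ x U)
    (hy : ContDiffOn ℝ ∞ y U) (hw : ContDiffOn ℝ ∞ w U) (hm : ∀ z ∈ U, x z ∈ O)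
    (v : E₀) : ContDiffOn ℝ ∞ (fun z => partial0 Ψ (x z, y z, w z) v) U :=
  smooth_fderiv_comp_apply hO hΨ hx hy hw hm (v, 0, 0)

theorem smooth_partial1 {Ψ : E₀ × E₁ × E₂ → F} {O : Set E₀} (hO : IsOpen O)
    (hΨ : ContDiffOn ℝ ∞ Ψ (Prod.fst ⁻¹' O))
    {x : D → E₀} {y : D → E₁} {w : D → E₂} (hx : ContDiffOn ℝ ∞ x U)
    (hy : ContDiffOn ℝ ∞ y U) (hw : ContDiffOn ℝ ∞ w U) (hm : ∀ z ∈ U, x z ∈ O)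
    (v : E₁) : ContDiffOn ℝ ∞ (fun z => partial1 Ψ (x z, y z, w z) v) U :=
  smooth_fderiv_comp_apply hO hΨ hx hy hw hm (0, v, 0)

/-- Restricted to a line in the direction `(0, 0, w)` the function is affine with slope `A t.1 w`.
No differentiability of `A` as an operator-valued map is needed. -/
theorem fderiv_quasiFun_top {A : E₀ → E₂ →ₗ[ℝ] F} {b : E₀ → E₁ → F} {t : E₀ × E₁ × E₂}
    (hd : DifferentiableAt ℝ (quasiFun A b) t) (w : E₂) :
    fderiv ℝ (quasiFun A b) t (0, 0, w) = A t.1 w := by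
  have hl : HasDerivAt (fun r : ℝ => t + r • ((0, 0, w) : E₀ × E₁ × E₂)) (0, 0, w) 0 := by
    simpa using ((hasDerivAt_id (0 : ℝ)).smul_const ((0, 0, w) : E₀ × E₁ × E₂)).const_add t
  have h1 := hd.hasFDerivAt.comp_hasDerivAt_of_eq (0 : ℝ) hl (by simp)
  have h2 : (quasiFun A b ∘ fun r : ℝ => t + r • ((0, 0, w) : E₀ × E₁ × E₂)) =
      fun r => quasiFun A b t + r • A t.1 w := by
    ext1 r
    simp only [Function.comp_apply, quasiFun, Prod.fst_add, Prod.snd_add, Prod.smul_mk, smul_zero,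
      add_zero, map_add, map_smul]
    exact add_right_comm _ _ _
  rw [h2] at h1
  have h3 : HasDerivAt (fun r : ℝ => quasiFun A b t + r • A t.1 w) (A t.1 w) 0 := by
    simpa using ((hasDerivAt_id (0 : ℝ)).smul_const (A t.1 w)).const_add (quasiFun A b t)
  exact h1.unique h3

theorem hasDerivAt_quasiFun {A : E₀ → E₂ →ₗ[ℝ] F} {b : E₀ → E₁ → F} {O : Set E₀}
    (hO : IsOpen O) (hΨ : ContDiffOn ℝ ∞ (quasiFun A b) (Prod.fst ⁻¹' O))
    {x : ℝ → E₀} {y : ℝ → E₁} {w : ℝ → E₂}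
    {x' : E₀} {y' : E₁} {w' : E₂} (hx : HasDerivAt x x' 0) (hy : HasDerivAt y y' 0)
    (hw : HasDerivAt w w' 0) (hm : x 0 ∈ O) :
    HasDerivAt (fun s => A (x s) (w s) + b (x s) (y s))
      (A (x 0) w' + partial1 (quasiFun A b) (x 0, y 0, w 0) y' +
        partial0 (quasiFun A b) (x 0, y 0, w 0) x') 0 := by
  have hd := hΨ.differentiableAt_of_isOpen (hO.preimage continuous_fst)
    (show (x 0, y 0, w 0) ∈ Prod.fst ⁻¹' O from hm)
  have h1 := hd.hasFDerivAt.comp_hasDerivAt (0 : ℝ) (hx.prodMk (hy.prodMk hw))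
  -- The order of the summands is that of `LinOp2.app`: second-order, first-order and zeroth-order
  -- terms.
  have h2 : (x', y', w') = ((0, 0, w') : E₀ × E₁ × E₂) + (0, y', 0) + (x', 0, 0) := by simp
  rw [h2, map_add, map_add, fderiv_quasiFun_top hd] at h1
  exact h1

end Quasilinear

/-- `Φ` as a function of second jets. -/
def phiJet (n : ℕ) : Arr n × (Cn n →L[ℝ] Arr n) × (Cn n →L[ℝ] Cn n →L[ℝ] Arr n) → Arr n :=
  quasiFun phiTopLin phiLow

/-- Stated on invertible arrays, which form an open set, so that derivatives can be taken in all
directions; positive definite Hermitian arrays are in general not open among all arrays. -/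
theorem smooth_phiJet :
    ContDiffOn ℝ ∞ (phiJet n) (Prod.fst ⁻¹' {G : Arr n | (Matrix.of G).det ≠ 0}) :=
  (smooth_phiTop contDiff_fst.contDiffOn (fun _ ht => ht)
    (contDiff_snd.comp contDiff_snd).contDiffOn).add
    (smooth_phiLow contDiff_fst.contDiffOn (fun _ ht => ht)
      (contDiff_fst.comp contDiff_snd).contDiffOn)

/-- The linearization of `Φ` at the metric `u`. -/
def linPhi (u : Cn n → Arr n) : LinOp2 n where
  c2 z := phiTopLin (u z)
  c1 z := partial1 (phiJet n) (u z, fderiv ℝ u z, fderiv ℝ (fderiv ℝ u) z)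
  c0 z := partial0 (phiJet n) (u z, fderiv ℝ u z, fderiv ℝ (fderiv ℝ u) z)

/-- The operator with the lower-order terms of `linPhi` and the second-order part
`-∑ g^{a b̄} ∂_a ∂_b̄`. -/
def linPhiLap (u : Cn n → Arr n) : LinOp2 n where
  c2 z := lapTop (u z)
  c1 := (linPhi u).c1
  c0 := (linPhi u).c0

variable {U : Set (Cn n)} {u : Cn n → Arr n} {z : Cn n}

theorem IsMetricOn.smoothOn_linPhi (h : IsMetricOn U u) : (linPhi u).SmoothOn U := by
  have h1 : ContDiffOn ℝ ∞ (fderiv ℝ u) U := h.smooth.fderiv_of_isOpen h.isOpen (by simp)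
  have h2 : ContDiffOn ℝ ∞ (fderiv ℝ (fderiv ℝ u)) U := h1.fderiv_of_isOpen h.isOpen (by simp)
  exact ⟨fun B => smooth_phiTop h.smooth (fun _ hz => h.det_ne_zero hz) contDiffOn_const,
    smooth_partial1 isOpen_det_ne_zero smooth_phiJet h.smooth h1 h2 fun _ hz => h.det_ne_zero hz,
    smooth_partial0 isOpen_det_ne_zero smooth_phiJet h.smooth h1 h2 fun _ hz => h.det_ne_zero hz⟩

theorem IsMetricOn.smoothOn_linPhiLap (h : IsMetricOn U u) : (linPhiLap u).SmoothOn U :=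
  ⟨fun _ => contDiffOn_arr.2 fun _ _ => (ContDiffOn.sum fun a _ => ContDiffOn.sum fun b _ =>
    (h.smooth_invMet a b).mul contDiffOn_const).neg, h.smoothOn_linPhi.2⟩

/-- The two operators share their lower-order coefficients, and their second-order parts agree on
the Hessian of a `∂∂̄`-closed form. -/
theorem linPhi_app_eq {v : Cn n → Arr n} (hU : IsOpen U) (hv : ContDiffOn ℝ ∞ v U) (hz : z ∈ U)
    (hc : del (delBar (arrForm v)) z = 0) : (linPhi u).app v z = (linPhiLap u).app v z := by
  have h1 := ((ddBarRel_iff hU hv hz).1 hc).phiTop_eq (u z)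
  simp only [LinOp2.app, linPhi, linPhiLap, phiTopLin_apply, h1]

end JetOperator

/-! ### Quasilinearity and linearization of `Φ` on the manifold -/

section Linearization

variable {n : ℕ} {M : Type*} [TopologicalSpace M] [ChartedSpace (Cn n) M]
  {e : OpenPartialHomeomorph M (Cn n)}

theorem IsPhi.herm_eq_quasilinear {g : HermMetric n M} {η : RealForm11 n M} (h : IsPhi g η)
    (he : e ∈ holCharts n M) {z : Cn n} (hz : z ∈ e.target) :
    η.herm e z = phiTopLin (g.coeff e z) (fderiv ℝ (fderiv ℝ (g.coeff e)) z) +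
      phiLow (g.coeff e z) (fderiv ℝ (g.coeff e) z) := by
  rw [h.herm_eq he hz, (g.isMetricOn he).phiComp_eq hz]
  rfl

theorem isQuasilinear2_of_isPhi {Φ : HermMetric n M → RealForm11 n M} (hΦ : ∀ g, IsPhi g (Φ g)) :
    IsQuasilinear2 Φ := by
  intro e he
  refine ⟨fun t => phiTopLin t.2.1, fun t => phiLow t.2.1 t.2.2, fun B => ?_, ?_,
    fun g z hz => (hΦ g).herm_eq_quasilinear he hz⟩
  · exact smooth_phiTop (contDiff_fst.comp contDiff_snd).contDiffOn
      (fun t ht => ht.2.det_ne_zero') contDiffOn_const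
  · exact smooth_phiLow (contDiff_fst.comp contDiff_snd).contDiffOn
      (fun t ht => ht.2.det_ne_zero') (contDiff_snd.comp contDiff_snd).contDiffOn

/-- Metric components are fixed real-linear combinations of values of the Kähler form, so they have
velocity `h.herm e`. Two uses of `hasDerivAt_fderiv_param` give the velocity of the whole 2-jet, and
the chain rule for `phiJet` finishes. -/
theorem isLinearization_linPhi {Φ : HermMetric n M → RealForm11 n M} (hΦ : ∀ g, IsPhi g (Φ g))
    (g : HermMetric n M) (he : e ∈ holCharts n M) :
    IsLinearization Φ g e (linPhi (g.coeff e)) := by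
  intro G h hG hG0 hv z hz
  have hm := g.isMetricOn he
  have hd : ∀ w ∈ e.target, HasDerivAt (fun s => (G s).coeff e w) (h.herm e w) 0 := by
    intro w _
    refine hasDerivAt_pi.2 fun j => hasDerivAt_pi.2 fun k => ?_
    exact HasDerivAt.const_mul _ (HasDerivAt.const_mul _ ((hv _ _ _).ofReal_comp.add
      ((hv _ _ _).ofReal_comp.const_mul _)))
  have hd1 := fun w hw => hasDerivAt_fderiv_param e.open_target (hG e he) hd (z := w) hw
  have hd2 := hasDerivAt_fderiv_param e.open_target (smooth_fderiv_param e.open_target (hG e he))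
    hd1 hz
  have h1 := hasDerivAt_quasiFun isOpen_det_ne_zero (smooth_phiJet (n := n))
    (hd z hz) (hd1 z hz) hd2
    (((G 0).isMetricOn he).det_ne_zero hz)
  simp only [hG0] at h1
  simp only [(hΦ (G _)).herm_eq_quasilinear he hz]
  exact h1

end Linearization

end

theorem mainTheorem12 (n : ℕ) (M : Type*) [TopologicalSpace M] [ChartedSpace (Cn n) M]
    [IsManifold 𝓘(ℂ, Cn n) ω M] :
    -- `Φ(ω)` is a well-defined smooth real form of type `(1,1)` for every Hermitian metric
    (∀ g : HermMetric n M, ∃! η : RealForm11 n M, IsPhi g η) ∧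
    ∀ Φ : HermMetric n M → RealForm11 n M, (∀ g, IsPhi g (Φ g)) →
      -- the operator is quasilinear of second order
      IsQuasilinear2 Φ ∧
      -- the linearization at a pluriclosed metric
      ∀ g : HermMetric n M, g.Pluriclosed → ∀ e ∈ holCharts n M,
        ∃ L : LinOp2 n, L.SmoothOn e.target ∧ IsLinearization Φ g e L ∧
          -- on the kernel of the symbol of `∂∂̄`, its symbol is `-|ξ|²` times the identity
          (∀ z ∈ e.target, ∀ ξ : Cn n →L[ℝ] ℝ, ∀ h ∈ symbolKer ξ,
            L.symbol z ξ h = (-covecNormSq (g.coeff e z) ξ) • h) ∧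
          -- ellipticity
          (∀ z ∈ e.target, ∀ ξ : Cn n →L[ℝ] ℝ, ξ ≠ 0 →
            0 < covecNormSq (g.coeff e z) ξ ∧
            Set.BijOn (L.symbol z ξ) (symbolKer ξ) (symbolKer ξ)) ∧
          -- on `∂∂̄`-closed variations, the linearization coincides with an operator whose symbol is
          -- `-|ξ|²` times the identity on all real `(1,1)`-forms
          ∃ L' : LinOp2 n, L'.SmoothOn e.target ∧
            (∀ z ∈ e.target, ∀ (ξ : Cn n →L[ℝ] ℝ) (h : Arr n), (Matrix.of h).IsHermitian →
              L'.symbol z ξ h = (-covecNormSq (g.coeff e z) ξ) • h) ∧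
            ∀ u : Cn n → Arr n, ContDiffOn ℝ ∞ u e.target →
              (∀ z ∈ e.target, (Matrix.of (u z)).IsHermitian) →
              (∀ z ∈ e.target, del (delBar (arrForm u)) z = 0) →
              ∀ z ∈ e.target, L.app u z = L'.app u z := by
  refine ⟨existsUnique_isPhi, fun Φ hΦ => ⟨isQuasilinear2_of_isPhi hΦ, fun g _ e he => ?_⟩⟩
  have hm := g.isMetricOn he
  have hsym : ∀ z ∈ e.target, ∀ ξ : Cn n →L[ℝ] ℝ, ∀ h ∈ symbolKer ξ,
      (linPhi (g.coeff e)).symbol z ξ h = (-covecNormSq (g.coeff e z) ξ) • h := by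
    intro z hz ξ h hh
    rw [← lapTop_symbol (hm.isHermitian hz)]
    exact ((mem_symbolKer_iff ξ h).1 hh).2.phiTop_eq _
  refine ⟨linPhi (g.coeff e), hm.smoothOn_linPhi, isLinearization_linPhi hΦ g he, hsym,
    fun z hz ξ hξ => ?_, linPhiLap (g.coeff e), hm.smoothOn_linPhiLap,
    fun z hz ξ h _ => lapTop_symbol (hm.isHermitian hz) ξ h,
    fun u hu _ hc z hz => linPhi_app_eq e.open_target hu hz (hc z hz)⟩
  have hpos := covecNormSq_pos (hm.posDef z hz) hξ
  have hne : -covecNormSq (g.coeff e z) ξ ≠ 0 := neg_ne_zero.2 hpos.ne'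
  refine ⟨hpos, fun h hh => ?_, fun h hh h' hh' heq => ?_, fun h hh => ?_⟩
  · rw [hsym z hz ξ h hh]
    exact smul_mem_symbolKer hh _
  · rw [hsym z hz ξ h hh, hsym z hz ξ h' hh'] at heq
    exact smul_right_injective _ hne heq
  -- The symbol acts on the kernel as a nonzero real scalar, so the preimage is `h` divided by that
  -- scalar, still in the kernel.
  · have hk := smul_mem_symbolKer hh (-covecNormSq (g.coeff e z) ξ)⁻¹
    refine ⟨_, hk, ?_⟩
    rw [hsym z hz ξ _ hk, smul_inv_smul₀ hne]
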